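/- Let $0<q<1$. Put $[a]_q=\dfrac{q^{a/2}-q^{-a/2}}{q^{1/2}-q^{-1/2}}$, $[k]_q!=\prod_{i=1}^k[i]_q$, $([a]_q)_k=\prod_{i=0}^{k-1}[a+i]_q$, and $c_j=j(j+1)$. Let $U_q=U_q(sl(2,\mathbb C))$ be generated by $e,f,q^{\pm h/4}$ with $q^{h/4}e=q^{1/2}eq^{h/4}$, $q^{h/4}f=q^{-1/2}fq^{h/4}$, $[e,f]=[h]_q$, and coproduct $\Delta(q^{h/4})=q^{h/4}\otimes q^{h/4}$, $\Delta(e)=e\otimes q^{h/4}+q^{-h/4}\otimes e$, $\Delta(f)=f\otimes q^{h/4}+q^{-h/4}\otimes f$. For $j\in\frac12\mathbb Z_{\ge0}$ let $V^j$ be the irreducible $U_q$-module with basis $x_{2m}$ ($m=-j,-j+1,\dots,j$), where $q^{h/4}x_{2m}=q^{m/2}x_{2m}$, $f x_{2m}=x_{2m-2}$ (and $f x_{-2j}=0$), $e x_{2m}=[j-m]_q[j+m+1]_q\,x_{2m+2}$ (and $e x_{2j}=0$). Its standard basis is $e^j_m=\bigl(([j+m+1]_q)_{j-m}[j-m]_q!\bigr)^{-1/2}x_{2m}$.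 Let $\langle\cdot,\cdot\rangle$ be the symmetric bilinear form on $V^j$ for which the $e^j_m$ are orthonormal, and use the product form on tensor products. A triple $(j_1,j_2,j)$ in $\frac12\mathbb Z_{\ge0}$ is called a triad if $|j_1-j_2|\le j\le j_1+j_2$ and $j_1+j_2+j\in\mathbb Z$; this is the condition that $V^j$ occurs in $V^{j_1}\otimes V^{j_2}$, and then it occurs exactly once. For a triad let $e^j_m(j_1,j_2)$ be the image of $e^j_m$ under the unique form-preserving intertwining map $V^j\to V^{j_1}\otimes V^{j_2}$ for which $\langle e^j_j(j_1,j_2),\,e^{j_1}_{j_1}\otimes e^{j_2}_{j-j_1}\rangle>0$. Applying this twice gives standard bases $e_m^{j_{12},j}(j_1,j_2\mid j_3)$ of the copy of $V^j$ in $V^{j_{12}}\otimes V^{j_3}\subset V^{j_1}\otimes V^{j_2}\otimes V^{j_3}$ and $e_m^{j_{23},j}(j_1\mid j_2,j_3)$ of the copy of $V^j$ in $V^{j_1}\otimes V^{j_{23}}\subset V^{j_1}\otimes V^{j_2}\otimes V^{j_3}$. The $q$-Racah coefficients ${}_qW$ are defined by $$e_m^{j_{12},j}(j_1,j_2\mid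 j_3)=\sum_{j_{23}}{}_qW^{j_2,j_3,j_{23}}_{j_{12}-j_1,\,j-j_{12},\,j-j_1}(j)\;e_m^{j_{23},j}(j_1\mid j_2,j_3),$$ where $j_{23}$ runs over the spins such that $(j_2,j_3,j_{23})$ and $(j_1,j_{23},j)$ are triads, and the $q$-$6j$ symbols by $$\begin{Bmatrix}j_3&j_1&j_{13}\\ j_2&j&j_{12}\end{Bmatrix}_q=(-1)^{j_1+j_2+j+j_3}\bigl([2j_{12}+1]_q[2j_{13}+1]_q\bigr)^{-1/2}\,{}_qW^{j_1,j_2,j_{12}}_{j_{13}-j_3,\,j-j_{13},\,j-j_3}(j),$$ whenever $(j_3,j_1,j_{13})$, $(j_{13},j_2,j)$, $(j_1,j_2,j_{12})$, $(j_3,j_{12},j)$ are triads. Let $j_1,\dots,j_9\in\frac12\mathbb Z_{\ge0}$ be such that $(j_1,j_4,j_5)$, $(j_1,j_7,j_8)$, $(j_2,j_5,j_6)$, $(j_2,j_8,j_9)$, $(j_3,j_6,j_7)$, $(j_3,j_4,j_9)$ are triads. Then $$\sum_{j_{10}}(-1)^{2j_{10}}[2j_{10}+1]_q\,q^{-(c_{j_{10}}+c_{j_8}+c_{j_6}+c_{j_4})/2}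 \begin{Bmatrix}j_2&j_7&j_{10}\\ j_1&j_9&j_8\end{Bmatrix}_q \begin{Bmatrix}j_2&j_6&j_5\\ j_3&j_{10}&j_7\end{Bmatrix}_q \begin{Bmatrix}j_1&j_5&j_4\\ j_3&j_9&j_{10}\end{Bmatrix}_q$$ $$=\sum_{j_{10}}(-1)^{2j_{10}}[2j_{10}+1]_q\,q^{-(c_{j_{10}}+c_{j_7}+c_{j_9}+c_{j_5})/2} \begin{Bmatrix}j_1&j_6&j_{10}\\ j_3&j_8&j_7\end{Bmatrix}_q \begin{Bmatrix}j_2&j_{10}&j_4\\ j_3&j_9&j_8\end{Bmatrix}_q \begin{Bmatrix}j_2&j_6&j_5\\ j_1&j_4&j_{10}\end{Bmatrix}_q ,$$ where on each side $j_{10}$ runs over all elements of $\frac12\mathbb Z_{\ge0}$ for which the three $q$-$6j$ symbols are defined, that is, on the left over those for which $(j_1,j_9,j_{10})$, $(j_2,j_7,j_{10})$, $(j_3,j_5,j_{10})$ are triads, and on the right over those for which $(j_1,j_6,j_{10})$, $(j_2,j_4,j_{10})$, $(j_3,j_8,j_{10})$ are triads. -/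

import Mathlib

open scoped TensorProduct

noncomputable section

namespace QSixJ

/-- The `q`-number `[a]_q = (q^{a/2} - q^{-a/2}) / (q^{1/2} - q^{-1/2})`. -/
def qNum (q a : ℝ) : ℝ :=
  (q ^ (a / 2) - q ^ (-a / 2)) / (q ^ ((1 : ℝ) / 2) - q ^ (-(1 : ℝ) / 2))

/-- The `q`-factorial `[k]_q! = [1]_q ⋯ [k]_q`. -/
def qFact (q : ℝ) (k : ℕ) : ℝ := ∏ i ∈ Finset.range k, qNum q (i + 1)

/-- The `q`-Pochhammer symbol `([a]_q)_k = [a]_q [a+1]_q ⋯ [a+k-1]_q`. -/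
def qPoch (q a : ℝ) (k : ℕ) : ℝ := ∏ i ∈ Finset.range k, qNum q (a + i)

/-- A module over `U_q(sl(2,ℂ))`: a complex vector space with operators
`e`, `f`, `k = q^{h/4}`, `k' = q^{-h/4}` satisfying the defining relations. -/
structure UqRep (q : ℝ) (V : Type*) [AddCommGroup V] [Module ℂ V] where
  e : Module.End ℂ V
  f : Module.End ℂ V
  k : Module.End ℂ V
  k' : Module.End ℂ V
  k_mul_k' : k * k' = 1
  k'_mul_k : k' * k = 1
  k_mul_e : k * e = ((q ^ ((1 : ℝ) / 2) : ℝ) : ℂ) • (e * k)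
  k_mul_f : k * f = ((q ^ (-(1 : ℝ) / 2) : ℝ) : ℂ) • (f * k)
  e_f : e * f - f * e =
    (((q ^ ((1 : ℝ) / 2) - q ^ (-(1 : ℝ) / 2))⁻¹ : ℝ) : ℂ) • (k * k - k' * k')

namespace UqRep

variable {q : ℝ} {V W : Type*} [AddCommGroup V] [Module ℂ V] [AddCommGroup W] [Module ℂ W]

theorem k'_mul_e (ρ : UqRep q V) (hq : 0 < q) :
    ρ.k' * ρ.e = ((q ^ (-(1 : ℝ) / 2) : ℝ) : ℂ) • (ρ.e * ρ.k') := by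
  have h : ρ.e * ρ.k' = ((q ^ ((1 : ℝ) / 2) : ℝ) : ℂ) • (ρ.k' * ρ.e) := by
    calc ρ.e * ρ.k' = ρ.k' * (ρ.k * ρ.e) * ρ.k' := by
          rw [← mul_assoc, ρ.k'_mul_k, one_mul]
      _ = _ := by
          rw [ρ.k_mul_e, mul_smul_comm, smul_mul_assoc, mul_assoc, mul_assoc, ρ.k_mul_k', mul_one]
  rw [h, smul_smul, ← Complex.ofReal_mul, ← Real.rpow_add hq]
  norm_num

theorem k'_mul_f (ρ : UqRep q V) (hq : 0 < q) :
    ρ.k' * ρ.f = ((q ^ ((1 : ℝ) / 2) : ℝ) : ℂ) • (ρ.f * ρ.k') := by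
  have h : ρ.f * ρ.k' = ((q ^ (-(1 : ℝ) / 2) : ℝ) : ℂ) • (ρ.k' * ρ.f) := by
    calc ρ.f * ρ.k' = ρ.k' * (ρ.k * ρ.f) * ρ.k' := by
          rw [← mul_assoc, ρ.k'_mul_k, one_mul]
      _ = _ := by
          rw [ρ.k_mul_f, mul_smul_comm, smul_mul_assoc, mul_assoc, mul_assoc, ρ.k_mul_k', mul_one]
  rw [h, smul_smul, ← Complex.ofReal_mul, ← Real.rpow_add hq]
  norm_num

/-- The tensor product of two modules, through the coproduct
`Δ(e) = e ⊗ q^{h/4} + q^{-h/4} ⊗ e`, `Δ(f) = f ⊗ q^{h/4} + q^{-h/4} ⊗ f`,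
`Δ(q^{h/4}) = q^{h/4} ⊗ q^{h/4}`. -/
def tensor (hq : 0 < q) (ρ : UqRep q V) (σ : UqRep q W) : UqRep q (V ⊗[ℂ] W) where
  e := TensorProduct.map ρ.e σ.k + TensorProduct.map ρ.k' σ.e
  f := TensorProduct.map ρ.f σ.k + TensorProduct.map ρ.k' σ.f
  k := TensorProduct.map ρ.k σ.k
  k' := TensorProduct.map ρ.k' σ.k'
  k_mul_k' := by
    rw [← TensorProduct.map_mul, ρ.k_mul_k', σ.k_mul_k', TensorProduct.map_one]
  k'_mul_k := by
    rw [← TensorProduct.map_mul, ρ.k'_mul_k, σ.k'_mul_k, TensorProduct.map_one]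
  k_mul_e := by
    simp only [mul_add, add_mul, ← TensorProduct.map_mul, ρ.k_mul_e, σ.k_mul_e, smul_add,
      TensorProduct.map_smul_left, TensorProduct.map_smul_right, ρ.k_mul_k', ρ.k'_mul_k]
  k_mul_f := by
    simp only [mul_add, add_mul, ← TensorProduct.map_mul, ρ.k_mul_f, σ.k_mul_f, smul_add,
      TensorProduct.map_smul_left, TensorProduct.map_smul_right, ρ.k_mul_k', ρ.k'_mul_k]
  e_f := by
    have h1 : ρ.e * ρ.f = ρ.f * ρ.e +
        (((q ^ ((1 : ℝ) / 2) - q ^ (-(1 : ℝ) / 2))⁻¹ : ℝ) : ℂ) • (ρ.k * ρ.k - ρ.k' * ρ.k') := by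
      rw [← ρ.e_f]; abel
    have h2 : σ.e * σ.f = σ.f * σ.e +
        (((q ^ ((1 : ℝ) / 2) - q ^ (-(1 : ℝ) / 2))⁻¹ : ℝ) : ℂ) • (σ.k * σ.k - σ.k' * σ.k') := by
      rw [← σ.e_f]; abel
    have n1 : ∀ (a : Module.End ℂ V) (b : Module.End ℂ W),
        TensorProduct.map (-a) b = -TensorProduct.map a b := fun a b =>
      TensorProduct.ext' fun x y => by simp [TensorProduct.neg_tmul]
    have n2 : ∀ (a : Module.End ℂ V) (b : Module.End ℂ W),
        TensorProduct.map a (-b) = -TensorProduct.map a b := fun a b =>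
      TensorProduct.ext' fun x y => by simp [TensorProduct.tmul_neg]
    simp only [mul_add, add_mul, ← TensorProduct.map_mul, σ.k_mul_f, σ.k_mul_e, ρ.k'_mul_e hq,
      ρ.k'_mul_f hq, h1, h2, TensorProduct.map_smul_left, TensorProduct.map_smul_right,
      TensorProduct.map_add_left, TensorProduct.map_add_right, sub_eq_add_neg, smul_add, smul_neg,
      n1, n2]
    abel

/-- `Φ` is an intertwining operator of `U_q`-modules. -/
structure IsIntertwining (ρ : UqRep q V) (σ : UqRep q W) (Φ : V →ₗ[ℂ] W) : Prop where
  map_e : ∀ v, Φ (ρ.e v) = σ.e (Φ v)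
  map_f : ∀ v, Φ (ρ.f v) = σ.f (Φ v)
  map_k : ∀ v, Φ (ρ.k v) = σ.k (Φ v)

end UqRep

/-- The underlying space of the irreducible module `V^j`, `j = n/2`, of dimension `n + 1`. -/
abbrev Spin (n : ℕ) : Type := Fin (n + 1) → ℂ

/-- The weight vector `x_{n-2i} = f^i · x_n` of `V^{n/2}` (zero for `i > n`). -/
def xVec (n i : ℕ) : Spin n := fun l => if (l : ℕ) = i then 1 else 0

/-- The operator on `V^{n/2}` sending `x_{n-2i}` to `g i`. -/
def ofX (n : ℕ) (g : ℕ → Spin n) : Module.End ℂ (Spin n) :=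
  (Pi.basisFun ℂ (Fin (n + 1))).constr ℂ (fun i => g i)

theorem xVec_coe (n : ℕ) (i : Fin (n + 1)) : xVec n i = Pi.basisFun ℂ (Fin (n + 1)) i := by
  ext l
  simp [xVec, Pi.single_apply, Fin.ext_iff]

theorem xVec_eq_zero {n i : ℕ} (h : n < i) : xVec n i = 0 := by
  ext l
  have := l.2
  simp only [xVec, Pi.zero_apply, ite_eq_right_iff, one_ne_zero, imp_false]
  omega

theorem ofX_xVec {n i : ℕ} (g : ℕ → Spin n) (h : i ≤ n) : ofX n g (xVec n i) = g i := by
  have := xVec_coe n ⟨i, Nat.lt_succ_of_le h⟩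
  simp only at this
  rw [this, ofX, Module.Basis.constr_basis]

theorem end_ext {n : ℕ} {M : Type*} [AddCommGroup M] [Module ℂ M] {A B : Spin n →ₗ[ℂ] M}
    (h : ∀ i ≤ n, A (xVec n i) = B (xVec n i)) : A = B := by
  refine (Pi.basisFun ℂ (Fin (n + 1))).ext fun i => ?_
  rw [← xVec_coe]
  exact h i (Nat.le_of_lt_succ i.2)

theorem qNum_zero (q : ℝ) : qNum q 0 = 0 := by simp [qNum]

theorem qNum_rel {q : ℝ} (hq : q ∈ Set.Ioo (0 : ℝ) 1) (a b : ℝ) :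
    qNum q (a + 1) * qNum q b - qNum q a * qNum q (b + 1) = qNum q (b - a) := by
  have h0 := hq.1
  have hd : q ^ ((1 : ℝ) / 2) - q ^ (-(1 : ℝ) / 2) ≠ 0 := by
    have : q ^ ((1 : ℝ) / 2) < q ^ (-(1 : ℝ) / 2) :=
      Real.rpow_lt_rpow_of_exponent_gt h0 hq.2 (by norm_num)
    linarith
  have e1 : q ^ ((a + 1) / 2) = q ^ (a / 2) * q ^ ((1 : ℝ) / 2) := by
    rw [← Real.rpow_add h0]; ring_nf
  have e2 : q ^ (-(a + 1) / 2) = (q ^ (a / 2))⁻¹ * (q ^ ((1 : ℝ) / 2))⁻¹ := by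
    rw [← Real.rpow_neg h0.le, ← Real.rpow_neg h0.le, ← Real.rpow_add h0]; ring_nf
  have e3 : q ^ ((b + 1) / 2) = q ^ (b / 2) * q ^ ((1 : ℝ) / 2) := by
    rw [← Real.rpow_add h0]; ring_nf
  have e4 : q ^ (-(b + 1) / 2) = (q ^ (b / 2))⁻¹ * (q ^ ((1 : ℝ) / 2))⁻¹ := by
    rw [← Real.rpow_neg h0.le, ← Real.rpow_neg h0.le, ← Real.rpow_add h0]; ring_nf
  have e5 : q ^ ((b - a) / 2) = q ^ (b / 2) * (q ^ (a / 2))⁻¹ := by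
    rw [← Real.rpow_neg h0.le, ← Real.rpow_add h0]; ring_nf
  have e6 : q ^ (-(b - a) / 2) = (q ^ (b / 2))⁻¹ * (q ^ (a / 2)) := by
    rw [← Real.rpow_neg h0.le, ← Real.rpow_add h0]; ring_nf
  have e7 : q ^ (-a / 2) = (q ^ (a / 2))⁻¹ := by
    rw [← Real.rpow_neg h0.le]; ring_nf
  have e8 : q ^ (-b / 2) = (q ^ (b / 2))⁻¹ := by
    rw [← Real.rpow_neg h0.le]; ring_nf
  have e9 : q ^ (-(1 : ℝ) / 2) = (q ^ ((1 : ℝ) / 2))⁻¹ := by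
    rw [← Real.rpow_neg h0.le]; ring_nf
  rw [e9] at hd
  have hA : q ^ (a / 2) ≠ 0 := (Real.rpow_pos_of_pos h0 _).ne'
  have hB : q ^ (b / 2) ≠ 0 := (Real.rpow_pos_of_pos h0 _).ne'
  have hC : q ^ ((1 : ℝ) / 2) ≠ 0 := (Real.rpow_pos_of_pos h0 _).ne'
  simp only [qNum, e1, e2, e3, e4, e5, e6, e7, e8, e9]
  generalize q ^ (a / 2) = A at *
  generalize q ^ (b / 2) = B at *
  generalize q ^ ((1 : ℝ) / 2) = C at *
  rw [div_mul_div_comm, div_mul_div_comm, div_sub_div_same, div_eq_div_iff (mul_ne_zero hd hd) hd]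
  field_simp
  ring

/-- The irreducible `U_q`-module `V^j` with `j = n/2`:
`q^{h/4} x_{n-2i} = q^{(n-2i)/4} x_{n-2i}`,
`e x_{n-2i} = [i]_q [n-i+1]_q x_{n-2i+2}`, `f x_{n-2i} = x_{n-2i-2}`, `f x_{-n} = 0`. -/
def irrep {q : ℝ} (hq : q ∈ Set.Ioo (0 : ℝ) 1) (n : ℕ) : UqRep q (Spin n) where
  e := ofX n fun i => ((qNum q i * qNum q ((n : ℝ) - i + 1) : ℝ) : ℂ) • xVec n (i - 1)
  f := ofX n fun i => xVec n (i + 1)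
  k := ofX n fun i => ((q ^ (((n : ℝ) - 2 * i) / 4) : ℝ) : ℂ) • xVec n i
  k' := ofX n fun i => ((q ^ (-((n : ℝ) - 2 * i) / 4) : ℝ) : ℂ) • xVec n i
  k_mul_k' := by
    refine end_ext fun i hi => ?_
    simp only [Module.End.mul_apply, ofX_xVec _ hi, map_smul, smul_smul, Module.End.one_apply]
    rw [← Complex.ofReal_mul, ← Real.rpow_add hq.1]
    ring_nf; simp
  k'_mul_k := by
    refine end_ext fun i hi => ?_
    simp only [Module.End.mul_apply, ofX_xVec _ hi, map_smul, smul_smul, Module.End.one_apply]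
    rw [← Complex.ofReal_mul, ← Real.rpow_add hq.1]
    ring_nf; simp
  k_mul_e := by
    refine end_ext fun i hi => ?_
    rcases i with _ | i
    · simp [ofX_xVec _ hi, qNum_zero]
    · have hi' : i ≤ n := by omega
      simp only [Module.End.mul_apply, ofX_xVec _ hi, map_smul, smul_smul, LinearMap.smul_apply,
        Nat.add_sub_cancel, ofX_xVec _ hi']
      congr 1
      have : q ^ (((n : ℝ) - 2 * i) / 4) =
          q ^ ((1 : ℝ) / 2) * q ^ (((n : ℝ) - 2 * ((i + 1 : ℕ) : ℝ)) / 4) := by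
        rw [← Real.rpow_add hq.1]; push_cast; ring_nf
      rw [this]; push_cast; ring
  k_mul_f := by
    refine end_ext fun i hi => ?_
    simp only [Module.End.mul_apply, ofX_xVec _ hi, map_smul, smul_smul, LinearMap.smul_apply]
    rcases hi.lt_or_eq with h | h
    · rw [ofX_xVec _ (show i + 1 ≤ n from h)]
      congr 1
      rw [← Complex.ofReal_mul, ← Real.rpow_add hq.1]
      push_cast; ring_nf
    · rw [xVec_eq_zero (show n < i + 1 by omega)]; simp
  e_f := by
    refine end_ext fun i hi => ?_
    have key := qNum_rel hq (i : ℝ) ((n : ℝ) - i)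
    have lhs1 : ofX n (fun i => ((qNum q i * qNum q ((n : ℝ) - i + 1) : ℝ) : ℂ) • xVec n (i - 1))
        (xVec n (i + 1)) = ((qNum q (i + 1) * qNum q ((n : ℝ) - i) : ℝ) : ℂ) • xVec n i := by
      rcases hi.lt_or_eq with h | h
      · rw [ofX_xVec _ (show i + 1 ≤ n from h)]
        simp only [Nat.add_sub_cancel]; push_cast; ring_nf
      · rw [xVec_eq_zero (show n < i + 1 by omega), h]; simp [qNum_zero]
    have lhs2 : ofX n (fun i => xVec n (i + 1)) (xVec n (i - 1)) =
        if i = 0 then xVec n 1 else xVec n i := by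
      rcases i with _ | i
      · rw [ofX_xVec _ (by omega)]; simp
      · rw [Nat.add_sub_cancel, ofX_xVec _ (by omega)]; simp
    have lhs3 : ((qNum q i * qNum q ((n : ℝ) - i + 1) : ℝ) : ℂ) •
        (if i = 0 then xVec n 1 else xVec n i) =
        ((qNum q i * qNum q ((n : ℝ) - i + 1) : ℝ) : ℂ) • xVec n i := by
      rcases i with _ | i <;> simp [qNum_zero]
    simp only [Module.End.mul_apply, LinearMap.sub_apply, ofX_xVec _ hi, map_smul, smul_smul,
      LinearMap.smul_apply, lhs1, lhs2, lhs3, ← sub_smul]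
    congr 1
    rw [← Complex.ofReal_mul, ← Complex.ofReal_mul, ← Complex.ofReal_sub, ← Complex.ofReal_sub,
      ← Complex.ofReal_mul, key, ← Real.rpow_add hq.1, ← Real.rpow_add hq.1, qNum]
    congr 1
    rw [div_eq_inv_mul]
    ring_nf

/-- `⟨x_{n-2i}, x_{n-2i}⟩ = ([n-i+1]_q)_i [i]_q!`. -/
def xNormSq (q : ℝ) (n i : ℕ) : ℝ := qPoch q ((n : ℝ) - i + 1) i * qFact q i

/-- The standard basis vector `e_m^j = x_{2m} / √(([j+m+1]_q)_{j-m} [j-m]_q!)` of `V^j`,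
where `j = n/2` and `m = j - i`. -/
def stdVec (q : ℝ) (n i : ℕ) : Spin n := (((√(xNormSq q n i))⁻¹ : ℝ) : ℂ) • xVec n i

/-- The Shapovalov form on `V^{n/2}`: the symmetric bilinear form for which the `e_m^j` are
orthonormal, that is, the `x_{n-2i}` are orthogonal with `⟨x_{n-2i}, x_{n-2i}⟩ = xNormSq q n i`. -/
def shapovalov (q : ℝ) (n : ℕ) : LinearMap.BilinForm ℂ (Spin n) :=
  Matrix.toBilin' (Matrix.diagonal fun i : Fin (n + 1) => ((xNormSq q n i : ℝ) : ℂ))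

/-- The Shapovalov form on `V^{a/2} ⊗ V^{b/2}`:
`⟨v₁ ⊗ w₁, v₂ ⊗ w₂⟩ = ⟨v₁, v₂⟩ ⟨w₁, w₂⟩`. -/
def shapovalovTensor (q : ℝ) (a b : ℕ) : LinearMap.BilinForm ℂ (Spin a ⊗[ℂ] Spin b) :=
  (shapovalov q a).tmul (shapovalov q b)

/-- The triangle condition for spins `a/2, b/2, c/2`:
`|a/2 - b/2| ≤ c/2 ≤ a/2 + b/2` and `(a + b + c)/2` is an integer. -/
def Triad (a b c : ℕ) : Prop := a ≤ b + c ∧ b ≤ a + c ∧ c ≤ a + b ∧ Even (a + b + c)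

instance (a b c : ℕ) : Decidable (Triad a b c) := by unfold Triad; infer_instance

/-- `Φ : V^j → V^{j₁} ⊗ V^{j₂}` (with `j₁ = a/2`, `j₂ = b/2`, `j = c/2`) sends `e_m^j` to the
standard basis vectors `e_m^j(j₁, j₂)` of the copy of `V^j` in `V^{j₁} ⊗ V^{j₂}`: it intertwines
the actions, respects the Shapovalov forms, and is normalized by
`⟨e_j^j(j₁, j₂), e_{j₁}^{j₁} ⊗ e_{j-j₁}^{j₂}⟩ > 0`. -/
structure IsStdEmbedding {q : ℝ} (hq : q ∈ Set.Ioo (0 : ℝ) 1) (a b c : ℕ)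
    (Φ : Spin c →ₗ[ℂ] Spin a ⊗[ℂ] Spin b) : Prop where
  intertwining : (irrep hq c).IsIntertwining (UqRep.tensor hq.1 (irrep hq a) (irrep hq b)) Φ
  isometry : ∀ v w, shapovalovTensor q a b (Φ v) (Φ w) = shapovalov q c v w
  positive : ∃ r : ℝ, 0 < r ∧
    shapovalovTensor q a b (Φ (stdVec q c 0)) (stdVec q a 0 ⊗ₜ stdVec q b ((a + b - c) / 2)) = r

theorem shapovalov_xVec (q : ℝ) (n i j : ℕ) (hi : i ≤ n) :
    shapovalov q n (xVec n i) (xVec n j) = if i = j then ((xNormSq q n i : ℝ) : ℂ) else 0 := by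
  rw [shapovalov, Matrix.toBilin'_apply', dotProduct,
    Finset.sum_eq_single ⟨i, Nat.lt_succ_of_le hi⟩]
  · simp [xVec, Matrix.mulVec_diagonal]
  · intro l _ h
    have : (l : ℕ) ≠ i := fun h' => h (Fin.ext h')
    simp [xVec, this]
  · simp

theorem qNum_pos {q : ℝ} (hq : q ∈ Set.Ioo (0 : ℝ) 1) {a : ℝ} (ha : 0 < a) : 0 < qNum q a := by
  have h1 : q ^ (a / 2) < q ^ (-a / 2) :=
    Real.rpow_lt_rpow_of_exponent_gt hq.1 hq.2 (by linarith)
  have h2 : q ^ ((1 : ℝ) / 2) < q ^ (-(1 : ℝ) / 2) :=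
    Real.rpow_lt_rpow_of_exponent_gt hq.1 hq.2 (by norm_num)
  exact div_pos_of_neg_of_neg (by linarith) (by linarith)

theorem xNormSq_pos {q : ℝ} (hq : q ∈ Set.Ioo (0 : ℝ) 1) {n i : ℕ} (h : i ≤ n) :
    0 < xNormSq q n i := by
  have : (i : ℝ) ≤ n := by exact_mod_cast h
  exact mul_pos (Finset.prod_pos fun t _ => qNum_pos hq (by have : (0 : ℝ) ≤ (t : ℝ) := t.cast_nonneg; linarith))
    (Finset.prod_pos fun t _ => qNum_pos hq (by positivity))

theorem shapovalov_ext {n : ℕ} {A B : Spin n →ₗ[ℂ] Spin n →ₗ[ℂ] ℂ}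
    (h : ∀ i ≤ n, ∀ j ≤ n, A (xVec n i) (xVec n j) = B (xVec n i) (xVec n j)) : A = B :=
  end_ext fun i hi => end_ext fun j hj => h i hi j hj

theorem xNormSq_succ (q : ℝ) (n i : ℕ) :
    xNormSq q n (i + 1) = qNum q (i + 1) * qNum q ((n : ℝ) - i) * xNormSq q n i := by
  have h : qPoch q ((n : ℝ) - ((i + 1 : ℕ) : ℝ) + 1) (i + 1) =
      qNum q ((n : ℝ) - i) * qPoch q ((n : ℝ) - i + 1) i := by
    rw [qPoch, Finset.prod_range_succ', mul_comm]
    congr 1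
    · push_cast; ring_nf
    · refine Finset.prod_congr rfl fun t _ => ?_
      push_cast; ring_nf
  rw [xNormSq, h, qFact, Finset.prod_range_succ, xNormSq, qFact]
  ring

theorem irrep_e {q : ℝ} (hq : q ∈ Set.Ioo (0 : ℝ) 1) {n i : ℕ} (h : i ≤ n) :
    (irrep hq n).e (xVec n i) =
      ((qNum q i * qNum q ((n : ℝ) - i + 1) : ℝ) : ℂ) • xVec n (i - 1) := by
  simp only [irrep]
  rw [ofX_xVec _ h]

theorem irrep_f {q : ℝ} (hq : q ∈ Set.Ioo (0 : ℝ) 1) {n i : ℕ} :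
    (irrep hq n).f (xVec n i) = xVec n (i + 1) := by
  rcases le_or_gt i n with h | h
  · simp only [irrep]
    rw [ofX_xVec _ h]
  · rw [xVec_eq_zero h, xVec_eq_zero (by omega), map_zero]

theorem irrep_k {q : ℝ} (hq : q ∈ Set.Ioo (0 : ℝ) 1) {n i : ℕ} :
    (irrep hq n).k (xVec n i) = ((q ^ (((n : ℝ) - 2 * i) / 4) : ℝ) : ℂ) • xVec n i := by
  rcases le_or_gt i n with h | h
  · simp only [irrep]
    rw [ofX_xVec _ h]
  · rw [xVec_eq_zero h, map_zero, smul_zero]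

theorem irrep_k' {q : ℝ} (hq : q ∈ Set.Ioo (0 : ℝ) 1) {n i : ℕ} :
    (irrep hq n).k' (xVec n i) = ((q ^ (-((n : ℝ) - 2 * i) / 4) : ℝ) : ℂ) • xVec n i := by
  rcases le_or_gt i n with h | h
  · simp only [irrep]
    rw [ofX_xVec _ h]
  · rw [xVec_eq_zero h, map_zero, smul_zero]

theorem shapovalov_e {q : ℝ} (hq : q ∈ Set.Ioo (0 : ℝ) 1) (n : ℕ) (v w : Spin n) :
    shapovalov q n ((irrep hq n).e v) w = shapovalov q n v ((irrep hq n).f w) := by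
  have : (shapovalov q n) ∘ₗ (irrep hq n).e = LinearMap.compl₂ (shapovalov q n) (irrep hq n).f := by
    refine shapovalov_ext fun i hi j hj => ?_
    simp only [LinearMap.comp_apply, LinearMap.compl₂_apply, irrep_e hq hi, irrep_f, map_smul,
      LinearMap.smul_apply, shapovalov_xVec q n i _ hi,
      shapovalov_xVec q n (i - 1) _ (by omega : i - 1 ≤ n)]
    rcases i with _ | i
    · simp [qNum_zero]
    · rw [Nat.add_sub_cancel]
      by_cases hij : i = j
      · subst hij
        rw [if_pos rfl, if_pos rfl, xNormSq_succ]
        push_cast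
        rw [smul_eq_mul]
        ring_nf
      · rw [if_neg hij, if_neg (by omega), smul_zero]
  exact LinearMap.congr_fun₂ this v w

theorem shapovalov_k {q : ℝ} (hq : q ∈ Set.Ioo (0 : ℝ) 1) (n : ℕ) (v w : Spin n) :
    shapovalov q n ((irrep hq n).k v) w = shapovalov q n v ((irrep hq n).k w) := by
  have : (shapovalov q n) ∘ₗ (irrep hq n).k = LinearMap.compl₂ (shapovalov q n) (irrep hq n).k := by
    refine shapovalov_ext fun i hi j hj => ?_
    simp only [LinearMap.comp_apply, LinearMap.compl₂_apply, irrep_k, map_smul,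
      LinearMap.smul_apply, shapovalov_xVec q n i _ hi]
    by_cases hij : i = j <;> simp [hij]
  exact LinearMap.congr_fun₂ this v w

theorem shapovalov_k' {q : ℝ} (hq : q ∈ Set.Ioo (0 : ℝ) 1) (n : ℕ) (v w : Spin n) :
    shapovalov q n ((irrep hq n).k' v) w = shapovalov q n v ((irrep hq n).k' w) := by
  have : (shapovalov q n) ∘ₗ (irrep hq n).k' = LinearMap.compl₂ (shapovalov q n) (irrep hq n).k' := by
    refine shapovalov_ext fun i hi j hj => ?_
    simp only [LinearMap.comp_apply, LinearMap.compl₂_apply, irrep_k', map_smul,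
      LinearMap.smul_apply, shapovalov_xVec q n i _ hi]
    by_cases hij : i = j <;> simp [hij]
  exact LinearMap.congr_fun₂ this v w

theorem shapovalovTensor_tmul (q : ℝ) (a b : ℕ) (v v' : Spin a) (w w' : Spin b) :
    shapovalovTensor q a b (v ⊗ₜ w) (v' ⊗ₜ w') = shapovalov q a v v' * shapovalov q b w w' := by
  simp [shapovalovTensor, LinearMap.BilinForm.tmul, mul_comm]

theorem shapovalovTensor_e {q : ℝ} (hq : q ∈ Set.Ioo (0 : ℝ) 1) (a b : ℕ)
    (v w : Spin a ⊗[ℂ] Spin b) :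
    shapovalovTensor q a b ((UqRep.tensor hq.1 (irrep hq a) (irrep hq b)).e v) w =
      shapovalovTensor q a b v ((UqRep.tensor hq.1 (irrep hq a) (irrep hq b)).f w) := by
  induction v using TensorProduct.induction_on with
  | zero => simp
  | add x y hx hy => simp only [map_add, LinearMap.add_apply, hx, hy]
  | tmul x y =>
    induction w using TensorProduct.induction_on with
    | zero => simp
    | add x y hx hy => simp only [map_add, hx, hy]
    | tmul x' y' =>
      simp only [UqRep.tensor, LinearMap.add_apply, TensorProduct.map_tmul, map_add,
        shapovalovTensor_tmul, shapovalov_e, shapovalov_k, shapovalov_k']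

theorem shapovalovTensor_k {q : ℝ} (hq : q ∈ Set.Ioo (0 : ℝ) 1) (a b : ℕ)
    (v w : Spin a ⊗[ℂ] Spin b) :
    shapovalovTensor q a b ((UqRep.tensor hq.1 (irrep hq a) (irrep hq b)).k v) w =
      shapovalovTensor q a b v ((UqRep.tensor hq.1 (irrep hq a) (irrep hq b)).k w) := by
  induction v using TensorProduct.induction_on with
  | zero => simp
  | add x y hx hy => simp only [map_add, LinearMap.add_apply, hx, hy]
  | tmul x y =>
    induction w using TensorProduct.induction_on with
    | zero => simp
    | add x y hx hy => simp only [map_add, hx, hy]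
    | tmul x' y' =>
      simp only [UqRep.tensor, TensorProduct.map_tmul, shapovalovTensor_tmul, shapovalov_k]

/-- The action of `e` on the vectors `f^i v`, for a highest weight vector `v`. -/
theorem UqRep.e_f_pow {q : ℝ} (hq : q ∈ Set.Ioo (0 : ℝ) 1) {V : Type*} [AddCommGroup V]
    [Module ℂ V] (ρ : UqRep q V) (c : ℝ) (v : V) (he : ρ.e v = 0)
    (hk : ρ.k v = ((q ^ (c / 4) : ℝ) : ℂ) • v) (i : ℕ) :
    ρ.k ((ρ.f ^ i) v) = ((q ^ ((c - 2 * i) / 4) : ℝ) : ℂ) • (ρ.f ^ i) v ∧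
    ρ.e ((ρ.f ^ i) v) = ((qNum q i * qNum q (c - i + 1) : ℝ) : ℂ) • (ρ.f ^ (i - 1)) v := by
  have hk1 : ∀ i : ℕ, ρ.k ((ρ.f ^ i) v) = ((q ^ ((c - 2 * i) / 4) : ℝ) : ℂ) • (ρ.f ^ i) v := by
    intro i
    induction i with
    | zero => simpa using hk
    | succ i ih =>
      have := LinearMap.congr_fun ρ.k_mul_f ((ρ.f ^ i) v)
      simp only [Module.End.mul_apply, LinearMap.smul_apply, ih, map_smul, smul_smul] at this
      rw [pow_succ', Module.End.mul_apply, this]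
      congr 1
      rw [← Complex.ofReal_mul, ← Real.rpow_add hq.1]
      push_cast; ring_nf
  have hk2 : ∀ i : ℕ, ρ.k' ((ρ.f ^ i) v) = ((q ^ (-(c - 2 * i) / 4) : ℝ) : ℂ) • (ρ.f ^ i) v := by
    intro i
    have h1 := LinearMap.congr_fun ρ.k'_mul_k ((ρ.f ^ i) v)
    simp only [Module.End.mul_apply, hk1, map_smul, Module.End.one_apply] at h1
    conv_rhs => rw [← h1, smul_smul, ← Complex.ofReal_mul, ← Real.rpow_add hq.1]
    ring_nf; simp
  refine ⟨hk1 i, ?_⟩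
  induction i with
  | zero => simp [he, qNum_zero]
  | succ i ih =>
    have h := LinearMap.congr_fun ρ.e_f ((ρ.f ^ i) v)
    simp only [Module.End.mul_apply, LinearMap.smul_apply, LinearMap.sub_apply, ih, map_smul,
      smul_smul, hk1, hk2, ← sub_smul] at h
    have h2 : ((qNum q i * qNum q (c - i + 1) : ℝ) : ℂ) • ρ.f ((ρ.f ^ (i - 1)) v) =
        ((qNum q i * qNum q (c - i + 1) : ℝ) : ℂ) • (ρ.f ^ i) v := by
      rcases i with _ | i
      · simp [qNum_zero]
      · rw [Nat.add_sub_cancel, pow_succ' ρ.f i, Module.End.mul_apply]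
    rw [h2, sub_eq_iff_eq_add, ← add_smul] at h
    rw [pow_succ', Module.End.mul_apply, h, Nat.add_sub_cancel]
    congr 1
    have key := qNum_rel hq (i : ℝ) (c - i)
    have : qNum q ((c - i) - i) = (q ^ ((1 : ℝ) / 2) - q ^ (-(1 : ℝ) / 2))⁻¹ *
        (q ^ ((c - 2 * i) / 4) * q ^ ((c - 2 * i) / 4) -
          q ^ (-(c - 2 * i) / 4) * q ^ (-(c - 2 * i) / 4)) := by
      rw [← Real.rpow_add hq.1, ← Real.rpow_add hq.1, qNum, div_eq_inv_mul]
      ring_nf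
    rw [← Complex.ofReal_mul, ← Complex.ofReal_mul, ← Complex.ofReal_sub, ← Complex.ofReal_mul,
      ← Complex.ofReal_add, ← this, ← key]
    push_cast
    ring_nf

/-- Vectors of `V^{a/2} ⊗ V^{b/2}` with real coordinates. -/
def IsRealVec (a b : ℕ) (v : Spin a ⊗[ℂ] Spin b) : Prop :=
  ∃ C : Fin (a + 1) → Fin (b + 1) → ℝ,
    v = ∑ i, ∑ j, ((C i j : ℝ) : ℂ) • (xVec a i ⊗ₜ[ℂ] xVec b j)

theorem IsRealVec.zero (a b : ℕ) : IsRealVec a b 0 := ⟨0, by simp⟩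

theorem IsRealVec.add {a b : ℕ} {v w} (hv : IsRealVec a b v) (hw : IsRealVec a b w) :
    IsRealVec a b (v + w) := by
  obtain ⟨C, rfl⟩ := hv
  obtain ⟨D, rfl⟩ := hw
  exact ⟨C + D, by
    simp only [Pi.add_apply, Complex.ofReal_add, add_smul, Finset.sum_add_distrib]⟩

theorem IsRealVec.smul {a b : ℕ} {v} (r : ℝ) (hv : IsRealVec a b v) :
    IsRealVec a b ((r : ℂ) • v) := by
  obtain ⟨C, rfl⟩ := hv
  exact ⟨r • C, by simp [Finset.smul_sum, smul_smul]⟩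

theorem IsRealVec.sum {a b : ℕ} {ι : Type*} (s : Finset ι) (v : ι → Spin a ⊗[ℂ] Spin b)
    (h : ∀ i ∈ s, IsRealVec a b (v i)) : IsRealVec a b (∑ i ∈ s, v i) :=
  Finset.sum_induction _ _ (fun _ _ => IsRealVec.add) (IsRealVec.zero a b) h

theorem IsRealVec.xVec (a b i j : ℕ) : IsRealVec a b (xVec a i ⊗ₜ QSixJ.xVec b j) := by
  rcases le_or_gt i a with hi | hi
  · rcases le_or_gt j b with hj | hj
    · refine ⟨fun i' j' => if (i' : ℕ) = i ∧ (j' : ℕ) = j then 1 else 0, ?_⟩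
      rw [Finset.sum_eq_single ⟨i, Nat.lt_succ_of_le hi⟩,
        Finset.sum_eq_single ⟨j, Nat.lt_succ_of_le hj⟩]
      · simp
      · intro j' _ h
        have : (j' : ℕ) ≠ j := fun h' => h (Fin.ext h')
        simp [this]
      · simp
      · intro i' _ h
        have : (i' : ℕ) ≠ i := fun h' => h (Fin.ext h')
        simp [this]
      · simp
    · rw [xVec_eq_zero hj, TensorProduct.tmul_zero]; exact .zero a b
  · rw [xVec_eq_zero hi, TensorProduct.zero_tmul]; exact .zero a b

theorem IsRealVec.f {q : ℝ} (hq : q ∈ Set.Ioo (0 : ℝ) 1) {a b : ℕ} {v} (hv : IsRealVec a b v) :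
    IsRealVec a b ((UqRep.tensor hq.1 (irrep hq a) (irrep hq b)).f v) := by
  obtain ⟨C, rfl⟩ := hv
  simp only [map_sum, map_smul]
  refine .sum _ _ fun i _ => .sum _ _ fun j _ => .smul _ ?_
  simp only [UqRep.tensor, LinearMap.add_apply, TensorProduct.map_tmul, irrep_f, irrep_k, irrep_k',
    TensorProduct.tmul_smul, TensorProduct.smul_tmul']
  exact .add (.smul _ (.xVec _ _ _ _)) (.smul _ (.xVec _ _ _ _))

theorem shapovalovTensor_sum {q : ℝ} (a b : ℕ) (C : Fin (a + 1) → Fin (b + 1) → ℝ)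
    (i : Fin (a + 1)) (j : Fin (b + 1)) :
    shapovalovTensor q a b (xVec a i ⊗ₜ xVec b j)
      (∑ i, ∑ j, ((C i j : ℝ) : ℂ) • (xVec a i ⊗ₜ[ℂ] xVec b j)) =
      ((C i j * (xNormSq q a i * xNormSq q b j) : ℝ) : ℂ) := by
  simp only [map_sum, map_smul, shapovalovTensor_tmul,
    shapovalov_xVec q a i _ (Nat.le_of_lt_succ i.2), shapovalov_xVec q b j _ (Nat.le_of_lt_succ j.2)]
  rw [Finset.sum_eq_single i, Finset.sum_eq_single j]
  · simp
  · intro j' _ h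
    have : (j : ℕ) ≠ j' := fun h' => h (Fin.ext h').symm
    simp [this]
  · simp
  · intro i' _ h
    have : (i : ℕ) ≠ i' := fun h' => h (Fin.ext h').symm
    simp [this]
  · simp

/-- The Shapovalov form is positive definite on real vectors. -/
theorem IsRealVec.normSq {q : ℝ} (hq : q ∈ Set.Ioo (0 : ℝ) 1) {a b : ℕ} {v}
    (hv : IsRealVec a b v) :
    v = 0 ∨ ∃ r : ℝ, 0 < r ∧ shapovalovTensor q a b v v = r := by
  obtain ⟨C, rfl⟩ := hv
  have hpos : ∀ (i : Fin (a + 1)) (j : Fin (b + 1)), 0 < xNormSq q a i * xNormSq q b j :=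
    fun i j => mul_pos (xNormSq_pos hq (Nat.le_of_lt_succ i.2))
      (xNormSq_pos hq (Nat.le_of_lt_succ j.2))
  have hs : shapovalovTensor q a b
      (∑ i, ∑ j, ((C i j : ℝ) : ℂ) • (QSixJ.xVec a i ⊗ₜ[ℂ] QSixJ.xVec b j))
      (∑ i, ∑ j, ((C i j : ℝ) : ℂ) • (QSixJ.xVec a i ⊗ₜ[ℂ] QSixJ.xVec b j)) =
      ((∑ i, ∑ j, C i j ^ 2 * (xNormSq q a i * xNormSq q b j) : ℝ) : ℂ) := by
    conv_lhs => enter [1]; simp only [map_sum, map_smul]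
    simp only [LinearMap.sum_apply, LinearMap.smul_apply, shapovalovTensor_sum]
    push_cast
    simp only [smul_eq_mul]
    refine Finset.sum_congr rfl fun i _ => Finset.sum_congr rfl fun j _ => by ring
  by_cases h : ∀ i j, C i j = 0
  · left; simp [h]
  · right
    push Not at h
    obtain ⟨i, j, hij⟩ := h
    refine ⟨_, ?_, hs⟩
    have hn : ∀ i j, 0 ≤ C i j ^ 2 * (xNormSq q a i * xNormSq q b j) :=
      fun i j => mul_nonneg (sq_nonneg _) (hpos i j).le
    refine Finset.sum_pos' (fun i _ => Finset.sum_nonneg fun j _ => hn i j)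
      ⟨i, Finset.mem_univ _, Finset.sum_pos' (fun j _ => hn i j) ⟨j, Finset.mem_univ _, ?_⟩⟩
    exact mul_pos (by positivity) (hpos i j)

/-- Coefficients of the highest weight vector of `V^{(a+b-2l)/2}` in `V^{a/2} ⊗ V^{b/2}`. -/
def hwCoeff (q : ℝ) (a b l : ℕ) : ℕ → ℝ
  | 0 => 1
  | k + 1 => -(hwCoeff q a b l k *
      (q ^ (-((a : ℝ) - 2 * k) / 4) *
        (qNum q ((l - k : ℕ) : ℝ) * qNum q ((b : ℝ) - ((l - k : ℕ) : ℝ) + 1)))) /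
      (qNum q ((k + 1 : ℕ) : ℝ) * qNum q ((a : ℝ) - ((k + 1 : ℕ) : ℝ) + 1) *
        q ^ (((b : ℝ) - 2 * ((l - (k + 1) : ℕ) : ℝ)) / 4))

/-- The highest weight vector of `V^{(a+b-2l)/2}` in `V^{a/2} ⊗ V^{b/2}`. -/
def hwVec (q : ℝ) (a b l : ℕ) : Spin a ⊗[ℂ] Spin b :=
  ∑ k ∈ Finset.range (l + 1), ((hwCoeff q a b l k : ℝ) : ℂ) • (xVec a k ⊗ₜ[ℂ] xVec b (l - k))

theorem hwVec_e {q : ℝ} (hq : q ∈ Set.Ioo (0 : ℝ) 1) {a b l : ℕ} (ha : l ≤ a) (hb : l ≤ b) :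
    (UqRep.tensor hq.1 (irrep hq a) (irrep hq b)).e (hwVec q a b l) = 0 := by
  have h1 : ∀ k ∈ Finset.range (l + 1),
      ((hwCoeff q a b l k : ℝ) : ℂ) • (UqRep.tensor hq.1 (irrep hq a) (irrep hq b)).e
        (xVec a k ⊗ₜ[ℂ] xVec b (l - k)) =
      ((hwCoeff q a b l k * (qNum q (k : ℝ) * qNum q ((a : ℝ) - (k : ℝ) + 1) *
        q ^ (((b : ℝ) - 2 * ((l - k : ℕ) : ℝ)) / 4)) : ℝ) : ℂ) •
          (xVec a (k - 1) ⊗ₜ[ℂ] xVec b (l - k)) +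
      ((hwCoeff q a b l k * (q ^ (-((a : ℝ) - 2 * k) / 4) *
        (qNum q ((l - k : ℕ) : ℝ) * qNum q ((b : ℝ) - ((l - k : ℕ) : ℝ) + 1))) : ℝ) : ℂ) •
          (xVec a k ⊗ₜ[ℂ] xVec b (l - k - 1)) := by
    intro k hk
    have hk' : k ≤ l := Nat.le_of_lt_succ (Finset.mem_range.1 hk)
    simp only [UqRep.tensor, LinearMap.add_apply, TensorProduct.map_tmul,
      irrep_e hq (hk'.trans ha), irrep_k, irrep_k', irrep_e hq ((Nat.sub_le l k).trans hb),
      TensorProduct.smul_tmul_smul, smul_add, smul_smul]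
    push_cast
    rfl
  rw [hwVec, map_sum]
  simp only [map_smul]
  rw [Finset.sum_congr rfl h1, Finset.sum_add_distrib, Finset.sum_range_succ',
    Finset.sum_range_succ (fun k => ((hwCoeff q a b l k * (q ^ (-((a : ℝ) - 2 * k) / 4) *
        (qNum q ((l - k : ℕ) : ℝ) * qNum q ((b : ℝ) - ((l - k : ℕ) : ℝ) + 1))) : ℝ) : ℂ) •
          (xVec a k ⊗ₜ[ℂ] xVec b (l - k - 1)))]
  simp only [Nat.sub_self, Nat.cast_zero, qNum_zero, zero_mul, mul_zero, Complex.ofReal_zero,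
    zero_smul, add_zero]
  rw [← Finset.sum_add_distrib]
  refine Finset.sum_eq_zero fun k hk => ?_
  have hk' : k < l := Finset.mem_range.1 hk
  have hka : ((k + 1 : ℕ) : ℝ) ≤ a := by exact_mod_cast (show k + 1 ≤ a by omega)
  rw [Nat.add_sub_cancel, show l - k - 1 = l - (k + 1) by omega, ← add_smul, ← Complex.ofReal_add]
  have hne : qNum q ((k + 1 : ℕ) : ℝ) * qNum q ((a : ℝ) - ((k + 1 : ℕ) : ℝ) + 1) *
        q ^ (((b : ℝ) - 2 * ((l - (k + 1) : ℕ) : ℝ)) / 4) ≠ 0 :=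
    (mul_pos (mul_pos (qNum_pos hq (by positivity)) (qNum_pos hq (by linarith)))
      (Real.rpow_pos_of_pos hq.1 _)).ne'
  rw [hwCoeff, div_mul_cancel₀ _ hne, neg_add_cancel]
  simp

theorem hwVec_k {q : ℝ} (hq : q ∈ Set.Ioo (0 : ℝ) 1) {a b c l : ℕ} (h : c + 2 * l = a + b) :
    (UqRep.tensor hq.1 (irrep hq a) (irrep hq b)).k (hwVec q a b l) =
      ((q ^ ((c : ℝ) / 4) : ℝ) : ℂ) • hwVec q a b l := by
  rw [hwVec, map_sum, Finset.smul_sum]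
  refine Finset.sum_congr rfl fun k hk => ?_
  have hk' : k ≤ l := Nat.le_of_lt_succ (Finset.mem_range.1 hk)
  have hc : (c : ℝ) = a + b - 2 * l := by
    have : (c : ℝ) + 2 * l = a + b := by exact_mod_cast h
    linarith
  simp only [map_smul, UqRep.tensor, TensorProduct.map_tmul, irrep_k, TensorProduct.smul_tmul_smul]
  rw [smul_comm]
  congr 1
  rw [← Complex.ofReal_mul, ← Real.rpow_add hq.1, hc, Nat.cast_sub hk']
  ring_nf

theorem hwVec_real (q : ℝ) (a b l : ℕ) : IsRealVec a b (hwVec q a b l) :=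
  .sum _ _ fun _ _ => .smul _ (.xVec _ _ _ _)

theorem hwVec_top (q : ℝ) {a b l : ℕ} (ha : l ≤ a) (hb : l ≤ b) :
    shapovalovTensor q a b (hwVec q a b l) (xVec a 0 ⊗ₜ xVec b l) =
      ((xNormSq q a 0 * xNormSq q b l : ℝ) : ℂ) := by
  simp only [hwVec, map_sum, LinearMap.sum_apply, map_smul, LinearMap.smul_apply,
    shapovalovTensor_tmul]
  rw [Finset.sum_eq_single 0]
  · rw [shapovalov_xVec q a 0 0 (by omega), shapovalov_xVec q b _ l (by omega)]
    simp [hwCoeff]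
  · intro k hk h0
    have hk' : k ≤ l := Nat.le_of_lt_succ (Finset.mem_range.1 hk)
    rw [shapovalov_xVec q a k 0 (by omega), if_neg h0]
    simp
  · simp

/-- For an admissible triple the standard embedding exists. -/
theorem exists_isStdEmbedding {q : ℝ} (hq : q ∈ Set.Ioo (0 : ℝ) 1) {a b c : ℕ}
    (h : Triad a b c) : ∃ Φ, IsStdEmbedding hq a b c Φ := by
  obtain ⟨h1, h2, h3, m, hm⟩ := h
  set l := (a + b - c) / 2 with hl
  have hc : c + 2 * l = a + b := by omega
  have ha : l ≤ a := by omega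
  have hb : l ≤ b := by omega
  set T := UqRep.tensor hq.1 (irrep hq a) (irrep hq b) with hT
  set w := hwVec q a b l with hw
  have hpow := fun i => T.e_f_pow hq (c : ℝ) w (hwVec_e hq ha hb) (hwVec_k hq hc) i
  have hreal : ∀ i : ℕ, IsRealVec a b ((T.f ^ i) w) := by
    intro i
    induction i with
    | zero => exact hwVec_real q a b l
    | succ i ih => rw [pow_succ', Module.End.mul_apply]; exact ih.f hq
  have hN : 0 < xNormSq q a 0 * xNormSq q b l :=
    mul_pos (xNormSq_pos hq (by omega)) (xNormSq_pos hq hb)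
  have hw0 : w ≠ 0 := by
    intro h0
    have := hwVec_top q ha hb
    rw [← hw, h0] at this
    simp only [map_zero, LinearMap.zero_apply] at this
    exact hN.ne' (by exact_mod_cast this.symm)
  obtain ⟨r, hr, hwr⟩ := ((hreal 0).normSq hq).resolve_left (by simpa using hw0)
  simp only [pow_zero, Module.End.one_apply] at hwr
  have hstep : ∀ i : ℕ, shapovalovTensor q a b ((T.f ^ (i + 1)) w) ((T.f ^ (i + 1)) w) =
      ((qNum q (i + 1) * qNum q ((c : ℝ) - i) : ℝ) : ℂ) *
        shapovalovTensor q a b ((T.f ^ i) w) ((T.f ^ i) w) := by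
    intro i
    conv_lhs => enter [2]; rw [pow_succ', Module.End.mul_apply]
    rw [hT, ← shapovalovTensor_e hq, ← hT, (hpow (i + 1)).2, Nat.add_sub_cancel, map_smul,
      LinearMap.smul_apply, smul_eq_mul]
    push_cast
    ring_nf
  have hlast : (T.f ^ (c + 1)) w = 0 := by
    rcases (hreal (c + 1)).normSq hq with h0 | ⟨s, hs, h0⟩
    · exact h0
    · rw [hstep, sub_self, qNum_zero, mul_zero, Complex.ofReal_zero, zero_mul] at h0
      exact absurd (by exact_mod_cast h0.symm) hs.ne'
  have hdiag : ∀ i : ℕ, shapovalovTensor q a b ((T.f ^ i) w) ((T.f ^ i) w) =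
      ((xNormSq q c i * r : ℝ) : ℂ) := by
    intro i
    induction i with
    | zero => simp [hwr, xNormSq, qPoch, qFact]
    | succ i ih => rw [hstep, ih, xNormSq_succ]; push_cast; ring
  have hoff : ∀ i j : ℕ, i ≠ j → shapovalovTensor q a b ((T.f ^ i) w) ((T.f ^ j) w) = 0 := by
    intro i j hij
    have := shapovalovTensor_k hq a b ((T.f ^ i) w) ((T.f ^ j) w)
    rw [← hT, (hpow i).1, (hpow j).1, map_smul, map_smul, LinearMap.smul_apply, smul_eq_mul,
      smul_eq_mul, ← sub_eq_zero, ← sub_mul] at this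
    refine (mul_eq_zero.1 this).resolve_left fun h0 => hij ?_
    have h3 : q ^ (((c : ℝ) - 2 * i) / 4) = q ^ (((c : ℝ) - 2 * j) / 4) := by
      exact_mod_cast sub_eq_zero.1 h0
    have h4 := (Real.rpow_right_inj hq.1 hq.2.ne).1 h3
    have : (i : ℝ) = j := by linarith
    exact_mod_cast this
  have hsq : 0 < √r := Real.sqrt_pos.2 hr
  set Φ : Spin c →ₗ[ℂ] Spin a ⊗[ℂ] Spin b :=
    (Pi.basisFun ℂ (Fin (c + 1))).constr ℂ
      (fun i => (((√r)⁻¹ : ℝ) : ℂ) • (T.f ^ (i : ℕ)) w) with hΦ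
  have hΦx : ∀ i ≤ c + 1, Φ (xVec c i) = (((√r)⁻¹ : ℝ) : ℂ) • (T.f ^ i) w := by
    intro i hi
    rcases hi.lt_or_eq with h | rfl
    · have := xVec_coe c ⟨i, h⟩
      simp only at this
      rw [this, hΦ, Module.Basis.constr_basis]
    · rw [hlast, xVec_eq_zero (by omega), map_zero, smul_zero]
  refine ⟨Φ, ⟨?_, ?_, ?_⟩, ?_, ?_⟩
  · have : Φ ∘ₗ (irrep hq c).e = T.e ∘ₗ Φ := end_ext fun i hi => by
      simp only [LinearMap.comp_apply, irrep_e hq hi, map_smul, hΦx i (by omega),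
        hΦx (i - 1) (by omega), (hpow i).2]
      rw [smul_comm]
    exact LinearMap.congr_fun this
  · have : Φ ∘ₗ (irrep hq c).f = T.f ∘ₗ Φ := end_ext fun i hi => by
      simp only [LinearMap.comp_apply, irrep_f, map_smul, hΦx i (by omega),
        hΦx (i + 1) (by omega), pow_succ', Module.End.mul_apply]
    exact LinearMap.congr_fun this
  · have : Φ ∘ₗ (irrep hq c).k = T.k ∘ₗ Φ := end_ext fun i hi => by
      simp only [LinearMap.comp_apply, irrep_k, map_smul, hΦx i (by omega), (hpow i).1]
      rw [smul_comm]
    exact LinearMap.congr_fun this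
  · have : LinearMap.compl₁₂ (shapovalovTensor q a b) Φ Φ = shapovalov q c := by
      refine shapovalov_ext fun i hi j hj => ?_
      rw [LinearMap.compl₁₂_apply, hΦx i (by omega), hΦx j (by omega), map_smul, map_smul,
        LinearMap.smul_apply, shapovalov_xVec q c i j hi]
      by_cases hij : i = j
      · subst hij
        rw [if_pos rfl, hdiag, smul_eq_mul, smul_eq_mul, ← Complex.ofReal_mul,
          ← Complex.ofReal_mul]
        congr 1
        field_simp
        rw [Real.sq_sqrt hr.le]
        ring
      · rw [if_neg hij, hoff i j hij, smul_zero, smul_zero]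
    exact LinearMap.congr_fun₂ this
  · have g1 : 0 < √(xNormSq q a 0) := Real.sqrt_pos.2 (xNormSq_pos hq (by omega))
    have g2 : 0 < √(xNormSq q b l) := Real.sqrt_pos.2 (xNormSq_pos hq hb)
    have g3 : 0 < √(xNormSq q c 0) := Real.sqrt_pos.2 (xNormSq_pos hq (by omega))
    refine ⟨(√(xNormSq q c 0))⁻¹ * (√r)⁻¹ * ((√(xNormSq q a 0))⁻¹ * (√(xNormSq q b l))⁻¹) *
      (xNormSq q a 0 * xNormSq q b l), by positivity, ?_⟩
    rw [stdVec, stdVec, stdVec, map_smul, hΦx 0 (by omega), pow_zero, Module.End.one_apply,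
      TensorProduct.smul_tmul_smul, map_smul, map_smul, map_smul, LinearMap.smul_apply,
      LinearMap.smul_apply, hwVec_top q ha hb]
    simp only [smul_eq_mul]
    push_cast
    ring

/-- The embedding `V^j → V^{j₁} ⊗ V^{j₂}`, `e_m^j ↦ e_m^j(j₁, j₂)`, with `j₁ = a/2`, `j₂ = b/2`,
`j = c/2` (and zero if `V^j` does not occur in `V^{j₁} ⊗ V^{j₂}`). -/
def stdEmbedding {q : ℝ} (hq : q ∈ Set.Ioo (0 : ℝ) 1) (a b c : ℕ) :
    Spin c →ₗ[ℂ] Spin a ⊗[ℂ] Spin b :=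
  if h : Triad a b c then (exists_isStdEmbedding hq h).choose else 0

/-- The standard basis vector `e_m^{j₁₂,j}(j₁, j₂ | j₃)` of the copy of `V^j` inside
`V^{j₁₂} ⊗ V^{j₃} ⊆ (V^{j₁} ⊗ V^{j₂}) ⊗ V^{j₃}`, viewed in `V^{j₁} ⊗ (V^{j₂} ⊗ V^{j₃})`.
Here `j₁, j₂, j₃, j₁₂, j` are half of `a, b, d, c, n`, and `m = j - i`. -/
def leftBasis {q : ℝ} (hq : q ∈ Set.Ioo (0 : ℝ) 1) (a b d c n i : ℕ) :
    Spin a ⊗[ℂ] (Spin b ⊗[ℂ] Spin d) :=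
  TensorProduct.assoc ℂ (Spin a) (Spin b) (Spin d)
    (TensorProduct.map (stdEmbedding hq a b c) LinearMap.id (stdEmbedding hq c d n (stdVec q n i)))

/-- The standard basis vector `e_m^{j₂₃,j}(j₁ | j₂, j₃)` of the copy of `V^j` inside
`V^{j₁} ⊗ V^{j₂₃} ⊆ V^{j₁} ⊗ (V^{j₂} ⊗ V^{j₃})`.
Here `j₁, j₂, j₃, j₂₃, j` are half of `a, b, d, p, n`, and `m = j - i`. -/
def rightBasis {q : ℝ} (hq : q ∈ Set.Ioo (0 : ℝ) 1) (a b d p n i : ℕ) :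
    Spin a ⊗[ℂ] (Spin b ⊗[ℂ] Spin d) :=
  TensorProduct.map LinearMap.id (stdEmbedding hq b d p) (stdEmbedding hq a p n (stdVec q n i))

open Classical in
/-- The `q`-Racah coefficient `W^{j₂,j₃,j₂₃}_{j₁₂-j₁,j-j₁₂,j-j₁}(j)`, where
`j₁, j₂, j₃, j₁₂, j, j₂₃` are half of `a, b, d, c, n, p`: the coefficient of
`e_m^{j₂₃,j}(j₁ | j₂, j₃)` in the expansion
`e_m^{j₁₂,j}(j₁, j₂ | j₃) = ∑_{j₂₃} W_{j₂₃} e_m^{j₂₃,j}(j₁ | j₂, j₃)` (valid for all `m`), with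
`j₂₃` running over the spins such that `V^{j₂₃}` occurs in `V^{j₂} ⊗ V^{j₃}` and `V^j` occurs in
`V^{j₁} ⊗ V^{j₂₃}`. By complete reducibility the expansion exists; its coefficients are unique,
because the vectors on the right are linearly independent. -/
def racah {q : ℝ} (hq : q ∈ Set.Ioo (0 : ℝ) 1) (a b d c n p : ℕ) : ℂ :=
  if h : ∃ W : ℕ → ℂ, ∀ i ≤ n, leftBasis hq a b d c n i =
      ∑ p ∈ Finset.range (b + d + 1) with Triad b d p ∧ Triad a p n,
        W p • rightBasis hq a b d p n i
  then h.choose p else 0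

/-- The `q`-`6j` symbol `{ j₃ j₁ j₁₃ ; j₂ j j₁₂ }_q`, where the entries
`j₃, j₁, j₁₃` (upper row) and `j₂, j, j₁₂` (lower row) are half of `a, b, c` and `d, n, p`:
`(-1)^{j₁+j₂+j+j₃} ([2j₁₂+1]_q [2j₁₃+1]_q)^{-1/2} W^{j₁,j₂,j₁₂}_{j₁₃-j₃,j-j₁₃,j-j₃}(j)`.
It is used only where `(a,b,c)`, `(c,d,n)`, `(b,d,p)`, `(a,p,n)` satisfy the triangle condition;
then `a + b + d + n` is even. -/
def sixJ {q : ℝ} (hq : q ∈ Set.Ioo (0 : ℝ) 1) (a b c d n p : ℕ) : ℂ :=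
  (-1) ^ ((b + d + n + a) / 2) *
    (((qNum q ((p : ℝ) + 1) * qNum q ((c : ℝ) + 1)) ^ (-(1 : ℝ) / 2) : ℝ) : ℂ) *
    racah hq a b d c n p

/-- `c_j = j (j + 1)` for `j = n/2`. -/
def casimir (n : ℕ) : ℝ := (n : ℝ) / 2 * ((n : ℝ) / 2 + 1)

end QSixJ

end

/-! Both sides are one and the same matrix element of an intertwining map, computed in two ways.
Write `Vᵢ` for the module of spin `nᵢ/2`. Take the copy of `V₉` in `V₁ ⊗ V₂ ⊗ V₆ ⊗ V₃` coupled as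
((1 (2 6)₅)₄ 3)₉, move the factor `V₁` to the far right with the R-matrix, and read off the
component along the copy coupled as (2 ((6 3)₇ 1)₈)₉.

One way is to recouple until `V₁` faces a single irreducible `Vₓ ⊆ V₂ ⊗ V₆ ⊗ V₃`, which it crosses
with a scalar; this gives three Racah coefficients and one eigenvalue. The other way is to cross
`V₂` first and `V₆ ⊗ V₃` afterwards, which is allowed by the hexagon identity. Crossing `V₂` alone
equals crossing `V₅ ⊆ V₂ ⊗ V₆` and then undoing the crossing of `V₆`; after recoupling, each of
these crossings is a scalar. This gives three Racah coefficients, two eigenvalues and the inverse of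
a third. Equating the results is `racah_yangBaxter`. Passing from Racah coefficients to 6j symbols
multiplies every summand on both sides by the same factor `yangBaxterFactor`, independent of x.

The R-matrix is given by an explicit formula on `V^{a/2} ⊗ W` for an arbitrary module W. Only its
commutation with f is computed (`braiding_f`); it amounts to the recursion `braidCoeff_succ_succ`.
Since f generates `V^{a/2} ⊗ W` from `x_a ⊗ W`, where only the Cartan term `k ^ a` of the R-matrix
survives, commutation with e and k, the hexagon identity and adjointness for the forms need checking
only there. On `V^j ⊆ V^{j₁} ⊗ V^{j₂}` multiplicity one makes the R-matrix a scalar; adjointness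
determines its square, and the positive normalization of the embeddings determines its sign
(`braiding_comp_stdEmbedding`). -/

noncomputable section

namespace QSixJ

/-! ### Intertwining maps and tensor products of modules -/

namespace UqRep

variable {q : ℝ} {U V W V' W' : Type*} [AddCommGroup U] [Module ℂ U] [AddCommGroup V] [Module ℂ V]
  [AddCommGroup W] [Module ℂ W] [AddCommGroup V'] [Module ℂ V'] [AddCommGroup W'] [Module ℂ W']

/-- Conjugating by the inverse makes this automatic; it is needed because the coproduct involves
`k'`. -/
theorem IsIntertwining.map_k' {ρ : UqRep q V} {σ : UqRep q W} {Φ : V →ₗ[ℂ] W}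
    (h : IsIntertwining ρ σ Φ) (v : V) : Φ (ρ.k' v) = σ.k' (Φ v) := by
  have h1 : ρ.k (ρ.k' v) = v := LinearMap.congr_fun ρ.k_mul_k' v
  have h2 : σ.k' (σ.k (Φ (ρ.k' v))) = Φ (ρ.k' v) := LinearMap.congr_fun σ.k'_mul_k _
  rw [← h2, ← h.map_k, h1]

theorem IsIntertwining.id (ρ : UqRep q V) : IsIntertwining ρ ρ LinearMap.id :=
  ⟨fun _ => rfl, fun _ => rfl, fun _ => rfl⟩

theorem IsIntertwining.comp {ρ : UqRep q U} {σ : UqRep q V} {τ : UqRep q W} {Ψ : V →ₗ[ℂ] W}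
    {Φ : U →ₗ[ℂ] V} (hΨ : IsIntertwining σ τ Ψ) (hΦ : IsIntertwining ρ σ Φ) :
    IsIntertwining ρ τ (Ψ ∘ₗ Φ) :=
  ⟨fun v => by simp [hΦ.map_e, hΨ.map_e], fun v => by simp [hΦ.map_f, hΨ.map_f],
    fun v => by simp [hΦ.map_k, hΨ.map_k]⟩

theorem IsIntertwining.tensor (hq : 0 < q) {ρ : UqRep q V} {ρ' : UqRep q V'} {σ : UqRep q W}
    {σ' : UqRep q W'} {Φ : V →ₗ[ℂ] V'} {Ψ : W →ₗ[ℂ] W'} (hΦ : IsIntertwining ρ ρ' Φ)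
    (hΨ : IsIntertwining σ σ' Ψ) :
    IsIntertwining (UqRep.tensor hq ρ σ) (UqRep.tensor hq ρ' σ') (TensorProduct.map Φ Ψ) := by
  refine ⟨fun v => ?_, fun v => ?_, fun v => ?_⟩ <;>
  induction v using TensorProduct.induction_on with
  | zero => simp
  | add x y hx hy => simp only [map_add, hx, hy]
  | tmul x y =>
    simp [UqRep.tensor, hΦ.map_e, hΦ.map_f, hΦ.map_k, hΦ.map_k', hΨ.map_e, hΨ.map_f, hΨ.map_k]

/-- This is coassociativity of the coproduct. -/
theorem isIntertwining_assoc (hq : 0 < q) (ρ : UqRep q U) (σ : UqRep q V) (τ : UqRep q W) :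
    IsIntertwining (UqRep.tensor hq (UqRep.tensor hq ρ σ) τ)
      (UqRep.tensor hq ρ (UqRep.tensor hq σ τ)) (TensorProduct.assoc ℂ U V W).toLinearMap := by
  refine ⟨fun v => ?_, fun v => ?_, fun v => ?_⟩ <;>
  induction v using TensorProduct.induction_on with
  | zero => simp
  | add x y hx hy => simp only [map_add, hx, hy]
  | tmul x y =>
    induction x using TensorProduct.induction_on with
    | zero => simp
    | add x x' hx hx' => simp only [map_add, TensorProduct.add_tmul, hx, hx']
    | tmul x x' =>
      simp [UqRep.tensor, TensorProduct.add_tmul, TensorProduct.tmul_add, add_assoc]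

end UqRep

/-! ### The invariant form on `V^j` and Schur's lemma -/

variable {q : ℝ} (hq : q ∈ Set.Ioo (0 : ℝ) 1)

theorem xVec_eq_f_pow (n i : ℕ) : xVec n i = ((irrep hq n).f ^ i) (xVec n 0) := by
  induction i with
  | zero => simp
  | succ i ih => rw [pow_succ', Module.End.mul_apply, ← ih, irrep_f]

theorem spin_eq_sum (n : ℕ) (v : Spin n) : v = ∑ i : Fin (n + 1), v i • xVec n i := by
  ext l
  simp [xVec, Finset.sum_apply, Fin.val_inj]

theorem shapovalov_apply_xVec (n : ℕ) (v : Spin n) (i : Fin (n + 1)) :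
    shapovalov q n v (xVec n i) = v i * ((xNormSq q n i : ℝ) : ℂ) := by
  conv_lhs => rw [spin_eq_sum n v]
  simp only [map_sum, map_smul, LinearMap.sum_apply, LinearMap.smul_apply]
  rw [Finset.sum_eq_single i]
  · rw [shapovalov_xVec _ _ _ _ (Nat.le_of_lt_succ i.2), if_pos rfl, smul_eq_mul]
  · intro j _ hj
    rw [shapovalov_xVec _ _ _ _ (Nat.le_of_lt_succ j.2), if_neg (fun h => hj (Fin.ext h)),
      smul_zero]
  · simp

theorem shapovalov_symm (n : ℕ) (v w : Spin n) : shapovalov q n v w = shapovalov q n w v := by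
  have : shapovalov q n = LinearMap.flip (shapovalov q n) := by
    refine shapovalov_ext fun i hi j hj => ?_
    rw [LinearMap.flip_apply, shapovalov_xVec _ _ _ _ hi, shapovalov_xVec _ _ _ _ hj]
    by_cases h : i = j
    · subst h; rfl
    · rw [if_neg h, if_neg (Ne.symm h)]
  exact LinearMap.congr_fun₂ this v w

theorem shapovalovTensor_symm (a b : ℕ) (v w : Spin a ⊗[ℂ] Spin b) :
    shapovalovTensor q a b v w = shapovalovTensor q a b w v := by
  induction v using TensorProduct.induction_on with
  | zero => simp
  | add x y hx hy => simp only [map_add, LinearMap.add_apply, hx, hy]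
  | tmul x y =>
    induction w using TensorProduct.induction_on with
    | zero => simp
    | add x y hx hy => simp only [map_add, LinearMap.add_apply, hx, hy]
    | tmul x' y' =>
      rw [shapovalovTensor_tmul, shapovalovTensor_tmul, shapovalov_symm, shapovalov_symm b]

theorem shapovalov_f (n : ℕ) (v w : Spin n) :
    shapovalov q n ((irrep hq n).f v) w = shapovalov q n v ((irrep hq n).e w) := by
  rw [shapovalov_symm, ← shapovalov_e, shapovalov_symm]

theorem shapovalovTensor_f (a b : ℕ) (v w : Spin a ⊗[ℂ] Spin b) :
    shapovalovTensor q a b ((UqRep.tensor hq.1 (irrep hq a) (irrep hq b)).f v) w =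
      shapovalovTensor q a b v ((UqRep.tensor hq.1 (irrep hq a) (irrep hq b)).e w) := by
  rw [shapovalovTensor_symm, ← shapovalovTensor_e, shapovalovTensor_symm]

theorem xNormSq_ne_zero (hq : q ∈ Set.Ioo (0 : ℝ) 1) (n : ℕ) (i : Fin (n + 1)) :
    ((xNormSq q n i : ℝ) : ℂ) ≠ 0 :=
  Complex.ofReal_ne_zero.2 (xNormSq_pos hq (Nat.le_of_lt_succ i.2)).ne'

/-- The form is diagonal in the x-basis with nonzero entries. Statements about adjoint maps are
proved by pairing with a test vector. -/
theorem shapovalov_left_ext (hq : q ∈ Set.Ioo (0 : ℝ) 1) {n : ℕ} {v w : Spin n}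
    (h : ∀ u, shapovalov q n v u = shapovalov q n w u) : v = w := by
  ext i
  have := h (xVec n i)
  rw [shapovalov_apply_xVec, shapovalov_apply_xVec] at this
  exact mul_right_cancel₀ (xNormSq_ne_zero hq n i) this

/-- Up to a nonzero norm, coordinate i + 1 of v is ⟨v, f x⟩ = ⟨e v, x⟩ with x the i-th basis vector,
so it vanishes. -/
theorem eq_smul_of_e_eq_zero {n : ℕ} {v : Spin n} (h : (irrep hq n).e v = 0) :
    v = v 0 • xVec n 0 := by
  have hv : ∀ i : Fin (n + 1), i ≠ 0 → v i = 0 := by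
    intro i hi
    obtain ⟨j, rfl⟩ := Fin.exists_succ_eq.2 hi
    have h1 := shapovalov_e hq n v (xVec n j)
    rw [h, irrep_f, map_zero, LinearMap.zero_apply] at h1
    have h2 := shapovalov_apply_xVec (q := q) n v j.succ
    rw [Fin.val_succ, ← h1] at h2
    exact (mul_eq_zero.1 h2.symm).resolve_right (xNormSq_ne_zero hq n j.succ)
  conv_lhs => rw [spin_eq_sum n v]
  rw [Finset.sum_eq_single 0]
  · simp
  · intro i _ hi
    rw [hv i hi, zero_smul]
  · simp

theorem UqRep.IsIntertwining.apply_xVec {n : ℕ} {W : Type*} [AddCommGroup W] [Module ℂ W]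
    {σ : UqRep q W} {Ψ : Spin n →ₗ[ℂ] W} (h : UqRep.IsIntertwining (irrep hq n) σ Ψ) (i : ℕ) :
    Ψ (xVec n i) = (σ.f ^ i) (Ψ (xVec n 0)) := by
  induction i with
  | zero => simp
  | succ i ih => rw [pow_succ', Module.End.mul_apply, ← ih, ← h.map_f, irrep_f]

/-- The image is killed by e, hence lies on the highest weight line. As f generates everything from
the highest weight vector, both forms of Schur's lemma follow from this one coefficient. -/
theorem UqRep.IsIntertwining.map_highest {n c : ℕ} {Ψ : Spin n →ₗ[ℂ] Spin c}
    (h : UqRep.IsIntertwining (irrep hq n) (irrep hq c) Ψ) :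
    Ψ (xVec n 0) = Ψ (xVec n 0) 0 • xVec c 0 := by
  refine eq_smul_of_e_eq_zero hq ?_
  rw [← h.map_e, irrep_e hq (Nat.zero_le n)]
  simp [qNum_zero]

/-- Schur's lemma: an endomorphism of `V^j` is a scalar. -/
theorem exists_smul_of_isIntertwining {n : ℕ} {Ψ : Spin n →ₗ[ℂ] Spin n}
    (h : UqRep.IsIntertwining (irrep hq n) (irrep hq n) Ψ) : ∃ t : ℂ, Ψ = t • LinearMap.id := by
  refine ⟨Ψ (xVec n 0) 0, end_ext fun i _ => ?_⟩
  conv_lhs => rw [h.apply_xVec, h.map_highest, map_smul, ← xVec_eq_f_pow]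
  simp

/-- Schur's lemma: there are no nonzero intertwining maps between different `V^j`. -/
theorem eq_zero_of_isIntertwining {n c : ℕ} (hnc : n ≠ c) {Ψ : Spin n →ₗ[ℂ] Spin c}
    (h : UqRep.IsIntertwining (irrep hq n) (irrep hq c) Ψ) : Ψ = 0 := by
  have h0 : Ψ (xVec n 0) 0 = 0 := by
    -- The operator k has eigenvalue `q ^ (n / 4)` on the source vector and `q ^ (c / 4)` on its
    -- image; these differ because 0 < q < 1.
    have h1 := h.map_k (xVec n 0)
    rw [irrep_k, map_smul, h.map_highest, map_smul, irrep_k, smul_smul, smul_smul, ← sub_eq_zero,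
      ← sub_smul] at h1
    have h2 := congrFun h1 0
    simp only [Pi.smul_apply, xVec, Pi.zero_apply, smul_eq_mul, Fin.val_zero, if_true,
      mul_one] at h2
    rw [mul_comm (Ψ _ 0), ← sub_mul] at h2
    refine (mul_eq_zero.1 h2).resolve_left fun h3 => hnc ?_
    have h4 := (Real.rpow_right_inj hq.1 hq.2.ne).1 (by exact_mod_cast sub_eq_zero.1 h3)
    have h5 : (n : ℝ) = c := by push_cast at h4; linarith
    exact_mod_cast h5
  refine end_ext fun i _ => ?_
  rw [h.apply_xVec, h.map_highest, h0]
  simp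

/-! ### The decomposition of a tensor product -/

theorem isStdEmbedding_stdEmbedding {a b c : ℕ} (h : Triad a b c) :
    IsStdEmbedding hq a b c (stdEmbedding hq a b c) := by
  rw [stdEmbedding, dif_pos h]
  exact (exists_isStdEmbedding hq h).choose_spec

theorem stdEmbedding_eq_zero {a b c : ℕ} (h : ¬ Triad a b c) : stdEmbedding hq a b c = 0 :=
  dif_neg h

theorem isIntertwining_zero {V W : Type*} [AddCommGroup V] [Module ℂ V] [AddCommGroup W]
    [Module ℂ W] (ρ : UqRep q V) (σ : UqRep q W) : UqRep.IsIntertwining ρ σ 0 :=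
  ⟨fun _ => by simp, fun _ => by simp, fun _ => by simp⟩

theorem isIntertwining_stdEmbedding (a b c : ℕ) :
    UqRep.IsIntertwining (irrep hq c) (UqRep.tensor hq.1 (irrep hq a) (irrep hq b))
      (stdEmbedding hq a b c) := by
  by_cases h : Triad a b c
  · exact (isStdEmbedding_stdEmbedding hq h).intertwining
  · rw [stdEmbedding_eq_zero hq h]
    exact isIntertwining_zero _ _

/-- The projection `V^{j₁} ⊗ V^{j₂} → V^j`, adjoint to the standard embedding. -/
def stdProj (a b c : ℕ) : Spin a ⊗[ℂ] Spin b →ₗ[ℂ] Spin c :=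
  -- The x-basis is orthogonal but not orthonormal, hence the division by the norm.
  LinearMap.pi fun i : Fin (c + 1) => ((xNormSq q c i : ℝ) : ℂ)⁻¹ •
    (shapovalovTensor q a b).flip (stdEmbedding hq a b c (xVec c i))

theorem shapovalov_stdProj (a b c : ℕ) (w : Spin a ⊗[ℂ] Spin b) (v : Spin c) :
    shapovalov q c (stdProj hq a b c w) v = shapovalovTensor q a b w (stdEmbedding hq a b c v) := by
  conv_rhs => rw [spin_eq_sum c v]
  conv_lhs => rw [spin_eq_sum c v]
  simp only [map_sum, map_smul]
  refine Finset.sum_congr rfl fun i _ => ?_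
  rw [shapovalov_apply_xVec]
  simp only [stdProj, LinearMap.pi_apply, LinearMap.smul_apply, smul_eq_mul]
  congr 1
  rw [LinearMap.BilinForm.flip_apply]
  have := xNormSq_ne_zero hq c i
  field_simp

/-- The adjoint of an intertwining map intertwines, because e and f are adjoint to each other and k
is self-adjoint. -/
theorem isIntertwining_stdProj (a b c : ℕ) :
    UqRep.IsIntertwining (UqRep.tensor hq.1 (irrep hq a) (irrep hq b)) (irrep hq c)
      (stdProj hq a b c) := by
  have h := isIntertwining_stdEmbedding hq a b c
  refine ⟨fun v => ?_, fun v => ?_, fun v => ?_⟩ <;>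
  refine shapovalov_left_ext hq fun u => ?_
  · rw [shapovalov_stdProj, shapovalovTensor_e, shapovalov_e, shapovalov_stdProj, h.map_f]
  · rw [shapovalov_stdProj, shapovalovTensor_f, shapovalov_f, shapovalov_stdProj, h.map_e]
  · rw [shapovalov_stdProj, shapovalovTensor_k, shapovalov_k, shapovalov_stdProj, h.map_k]

/-- For an isometry the adjoint is a left inverse. -/
theorem stdProj_comp_stdEmbedding {a b c : ℕ} (h : Triad a b c) :
    stdProj hq a b c ∘ₗ stdEmbedding hq a b c = LinearMap.id := by
  refine LinearMap.ext fun v => shapovalov_left_ext hq fun u => ?_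
  rw [LinearMap.comp_apply, shapovalov_stdProj, (isStdEmbedding_stdEmbedding hq h).isometry,
    LinearMap.id_apply]

theorem stdProj_comp_stdEmbedding_of_ne {a b c d : ℕ} (h : c ≠ d) :
    stdProj hq a b d ∘ₗ stdEmbedding hq a b c = 0 :=
  eq_zero_of_isIntertwining hq h
    ((isIntertwining_stdProj hq a b d).comp (isIntertwining_stdEmbedding hq a b c))

/-- The Clebsch–Gordan dimension count: the admissible c are a + b - 2l with l ≤ min a b. -/
theorem sum_triad_succ (a b : ℕ) :
    ∑ c ∈ Finset.range (a + b + 1) with Triad a b c, (c + 1) = (a + 1) * (b + 1) := by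
  have h1 : ∑ c ∈ Finset.range (a + b + 1) with Triad a b c, (c + 1) =
      ∑ l ∈ Finset.range (min a b + 1), (a + b - 2 * l + 1) := by
    symm
    refine Finset.sum_nbij' (fun l => a + b - 2 * l) (fun c => (a + b - c) / 2) ?_ ?_ ?_ ?_ ?_
    · intro l hl
      simp only [Finset.mem_range, Finset.mem_filter, Triad, Nat.even_iff] at hl ⊢
      omega
    · intro c hc
      simp only [Finset.mem_range, Finset.mem_filter, Triad, Nat.even_iff] at hc ⊢
      omega
    · intro l hl
      simp only [Finset.mem_range] at hl
      omega
    · intro c hc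
      simp only [Finset.mem_range, Finset.mem_filter, Triad, Nat.even_iff] at hc
      omega
    · simp
  have h2 : ∀ m s : ℕ, 2 * m ≤ s →
      ∑ l ∈ Finset.range (m + 1), (s - 2 * l + 1) = (m + 1) * (s + 1 - m) := by
    intro m s
    induction m with
    | zero => simp
    | succ m ih =>
      intro h
      rw [Finset.sum_range_succ, ih (by omega)]
      obtain ⟨t, rfl⟩ := Nat.exists_eq_add_of_le h
      rw [show 2 * (m + 1) + t + 1 - m = m + t + 3 by omega,
        show 2 * (m + 1) + t - 2 * (m + 1) + 1 = t + 1 by omega,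
        show 2 * (m + 1) + t + 1 - (m + 1) = m + t + 2 by omega]
      ring
  rw [h1, h2 _ _ (by omega)]
  rcases le_total a b with h | h
  · rw [min_eq_left h, show a + b + 1 - a = b + 1 by omega]
  · rw [min_eq_right h, show a + b + 1 - b = a + 1 by omega, mul_comm]

/-- The complementary idempotent has trace zero, and in characteristic zero the trace of an
idempotent is its rank. -/
theorem eq_one_of_trace_eq_finrank {V : Type*} [AddCommGroup V] [Module ℂ V]
    [FiniteDimensional ℂ V] {P : Module.End ℂ V} (h : P * P = P)
    (ht : LinearMap.trace ℂ V P = Module.finrank ℂ V) : P = 1 := by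
  have h0 : 1 - P = 0 := by
    refine LinearMap.IsIdempotentElem.eq_zero_of_trace_eq_zero (IsIdempotentElem.one_sub h) ?_
    rw [map_sub, LinearMap.trace_one, ht, sub_self]
  exact (sub_eq_zero.1 h0).symm

/-- Complete reducibility of `V^{j₁} ⊗ V^{j₂}`. -/
theorem sum_stdEmbedding_comp_stdProj (a b : ℕ) :
    ∑ c ∈ Finset.range (a + b + 1) with Triad a b c,
      stdEmbedding hq a b c ∘ₗ stdProj hq a b c = LinearMap.id := by
  set S := (Finset.range (a + b + 1)).filter (Triad a b) with hS
  set P : Module.End ℂ (Spin a ⊗[ℂ] Spin b) :=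
    ∑ c ∈ S, stdEmbedding hq a b c ∘ₗ stdProj hq a b c with hP
  -- Diagonal terms reproduce themselves by isometry; cross terms vanish by Schur's lemma.
  have hidem : P * P = P := by
    conv_lhs => rw [hP, Finset.sum_mul_sum]
    refine Finset.sum_congr rfl fun c hc => ?_
    rw [Finset.sum_eq_single_of_mem c hc]
    · rw [Module.End.mul_eq_comp, LinearMap.comp_assoc, ← LinearMap.comp_assoc _ _ (stdProj hq a b c),
        stdProj_comp_stdEmbedding hq (Finset.mem_filter.1 hc).2, LinearMap.id_comp]
    · intro d _ hd
      rw [Module.End.mul_eq_comp, LinearMap.comp_assoc, ← LinearMap.comp_assoc _ _ (stdProj hq a b c),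
        stdProj_comp_stdEmbedding_of_ne hq hd, LinearMap.zero_comp, LinearMap.comp_zero]
  -- By cyclicity each summand has the trace of the identity of `V^{c/2}`, which is c + 1.
  have htr : LinearMap.trace ℂ _ P = (((a + 1) * (b + 1) : ℕ) : ℂ) := by
    rw [hP, map_sum, ← sum_triad_succ, Nat.cast_sum]
    refine Finset.sum_congr rfl fun c hc => ?_
    rw [LinearMap.trace_comp_comm', stdProj_comp_stdEmbedding hq (Finset.mem_filter.1 hc).2,
      LinearMap.trace_id]
    simp
  refine eq_one_of_trace_eq_finrank hidem ?_
  rw [htr]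
  simp

/-- `V^j` occurs in `V^{j₁} ⊗ V^{j₂}` at most once. -/
theorem exists_smul_stdEmbedding {a b n : ℕ} {Ψ : Spin n →ₗ[ℂ] Spin a ⊗[ℂ] Spin b}
    (h : UqRep.IsIntertwining (irrep hq n) (UqRep.tensor hq.1 (irrep hq a) (irrep hq b)) Ψ) :
    ∃ t : ℂ, Ψ = t • stdEmbedding hq a b n := by
  obtain ⟨t, ht⟩ := exists_smul_of_isIntertwining hq ((isIntertwining_stdProj hq a b n).comp h)
  have h0 : ∀ c, c ≠ n → stdProj hq a b c ∘ₗ Ψ = 0 := fun c hc =>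
    eq_zero_of_isIntertwining hq hc.symm ((isIntertwining_stdProj hq a b c).comp h)
  have h1 : Ψ = ∑ c ∈ Finset.range (a + b + 1) with Triad a b c,
      stdEmbedding hq a b c ∘ₗ stdProj hq a b c ∘ₗ Ψ := by
    conv_lhs => rw [← LinearMap.id_comp Ψ, ← sum_stdEmbedding_comp_stdProj hq a b]
    exact LinearMap.ext fun v => by simp
  refine ⟨t, ?_⟩
  rw [h1, Finset.sum_eq_single n]
  · rw [ht, LinearMap.comp_smul, LinearMap.comp_id]
  · intro c _ hc
    rw [h0 c hc, LinearMap.comp_zero]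
  -- Without the triangle condition `stdEmbedding` is zero by default and the claim becomes Ψ = 0,
  -- so no such hypothesis is needed.
  · intro hn
    have : ¬ Triad a b n := fun hT => hn (Finset.mem_filter.2
      ⟨Finset.mem_range.2 (by have := hT.2.2.1; omega), hT⟩)
    rw [stdEmbedding_eq_zero hq this, LinearMap.zero_comp]

/-! ### The braiding -/

theorem qNum_denom_ne_zero (hq : q ∈ Set.Ioo (0 : ℝ) 1) :
    q ^ ((1 : ℝ) / 2) - q ^ (-(1 : ℝ) / 2) ≠ 0 := by
  have : q ^ ((1 : ℝ) / 2) < q ^ (-(1 : ℝ) / 2) :=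
    Real.rpow_lt_rpow_of_exponent_gt hq.1 hq.2 (by norm_num)
  linarith

/-- Both products on the left have the same argument sum x + y, so after clearing denominators the
terms `q ^ (±(x + y) / 2)` cancel and the rest factors. -/
theorem qNum_mul_sub_qNum_mul (hq : q ∈ Set.Ioo (0 : ℝ) 1) (x y z : ℝ) :
    qNum q x * qNum q y - qNum q (x - z) * qNum q (y + z) = qNum q z * qNum q (y - x + z) := by
  have h0 := hq.1
  have hd := qNum_denom_ne_zero hq
  have hX : q ^ (x / 2) ≠ 0 := (Real.rpow_pos_of_pos h0 _).ne'
  have hY : q ^ (y / 2) ≠ 0 := (Real.rpow_pos_of_pos h0 _).ne'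
  have hZ : q ^ (z / 2) ≠ 0 := (Real.rpow_pos_of_pos h0 _).ne'
  have e0 : ∀ t : ℝ, q ^ (-t / 2) = (q ^ (t / 2))⁻¹ := fun t => by
    rw [← Real.rpow_neg h0.le]; ring_nf
  have e1 : q ^ ((x - z) / 2) = q ^ (x / 2) / q ^ (z / 2) := by
    rw [← Real.rpow_sub h0]; ring_nf
  have e2 : q ^ ((y + z) / 2) = q ^ (y / 2) * q ^ (z / 2) := by
    rw [← Real.rpow_add h0]; ring_nf
  have e3 : q ^ ((y - x + z) / 2) = q ^ (y / 2) * q ^ (z / 2) / q ^ (x / 2) := by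
    rw [← Real.rpow_add h0, ← Real.rpow_sub h0]; ring_nf
  simp only [qNum, e0 x, e0 y, e0 z, e0 (x - z), e0 (y + z), e0 (y - x + z), e1, e2, e3]
  generalize q ^ (x / 2) = X at *
  generalize q ^ (y / 2) = Y at *
  generalize q ^ (z / 2) = Z at *
  generalize q ^ ((1 : ℝ) / 2) - q ^ (-(1 : ℝ) / 2) = d at *
  field_simp
  ring

/-- The product `[i]_q ⋯ [i-r+1]_q [a-i+1]_q ⋯ [a-i+r]_q / [r]_q!`. -/
def braidProd (q : ℝ) (a i r : ℕ) : ℝ :=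
  (∏ s ∈ Finset.range r, qNum q ((i : ℝ) - s)) * qPoch q ((a : ℝ) - i + 1) r / qFact q r

/-- The coefficients of the universal `R`-matrix in its action on `x_{a-2i} ∈ V^{a/2}`. -/
def braidCoeff (q : ℝ) (a i r : ℕ) : ℝ :=
  (q ^ ((1 : ℝ) / 2) - q ^ (-(1 : ℝ) / 2)) ^ r *
    q ^ ((r : ℝ) * (2 * i - r - 1 - a) / 4) * braidProd q a i r

theorem qFact_succ (q : ℝ) (r : ℕ) : qFact q (r + 1) = qFact q r * qNum q (r + 1) :=
  Finset.prod_range_succ _ _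

theorem qFact_ne_zero (hq : q ∈ Set.Ioo (0 : ℝ) 1) (r : ℕ) : qFact q r ≠ 0 :=
  Finset.prod_ne_zero_iff.2 fun _ _ => (qNum_pos hq (by positivity)).ne'

/-- `braidProd q a i r` is the matrix entry of e^r / [r]! from `x_{a-2i}` to `x_{a-2i+2r}`. The
recursion is the commutator of e^(r+1) / [r+1]! with f, evaluated on `x_{a-2i}`. -/
theorem braidProd_succ_succ (hq : q ∈ Set.Ioo (0 : ℝ) 1) (a i r : ℕ) :
    braidProd q a (i + 1) (r + 1) =
      braidProd q a i (r + 1) + braidProd q a i r * qNum q ((a : ℝ) - 2 * i + r) := by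
  have h1 : ∏ s ∈ Finset.range (r + 1), qNum q (((i + 1 : ℕ) : ℝ) - s) =
      (∏ s ∈ Finset.range r, qNum q ((i : ℝ) - s)) * qNum q ((i : ℝ) + 1) := by
    rw [Finset.prod_range_succ']
    push_cast
    simp only [add_sub_add_right_eq_sub, sub_zero]
  have h2 : qPoch q ((a : ℝ) - ((i + 1 : ℕ) : ℝ) + 1) (r + 1) =
      qPoch q ((a : ℝ) - i + 1) r * qNum q ((a : ℝ) - i) := by
    rw [qPoch, Finset.prod_range_succ', qPoch]
    push_cast
    congr 1
    · exact Finset.prod_congr rfl fun s _ => by ring_nf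
    · ring_nf
  have h3 : qPoch q ((a : ℝ) - i + 1) (r + 1) =
      qPoch q ((a : ℝ) - i + 1) r * qNum q ((a : ℝ) - i + 1 + r) := Finset.prod_range_succ _ _
  have h4 : qNum q ((i : ℝ) + 1) * qNum q ((a : ℝ) - i) =
      qNum q ((i : ℝ) - r) * qNum q ((a : ℝ) - i + 1 + r) +
        qNum q ((r : ℝ) + 1) * qNum q ((a : ℝ) - 2 * i + r) := by
    have := qNum_mul_sub_qNum_mul hq ((i : ℝ) + 1) ((a : ℝ) - i) ((r : ℝ) + 1)
    rw [show (i : ℝ) + 1 - (r + 1) = i - r by ring,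
      show (a : ℝ) - i + (r + 1) = a - i + 1 + r by ring,
      show (a : ℝ) - i - (i + 1) + (r + 1) = a - 2 * i + r by ring] at this
    linarith
  have hr : qNum q ((r : ℝ) + 1) ≠ 0 := (qNum_pos hq (by positivity)).ne'
  have hf := qFact_ne_zero hq r
  rw [braidProd, braidProd, braidProd, h1, h2, h3, qFact_succ, Finset.prod_range_succ]
  generalize qNum q ((a : ℝ) - 2 * i + r) = N at *
  field_simp
  linear_combination (∏ s ∈ Finset.range r, qNum q ((i : ℝ) - s)) *
    qPoch q ((a : ℝ) - i + 1) r * h4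

theorem braidCoeff_zero (q : ℝ) (a i : ℕ) : braidCoeff q a i 0 = 1 := by
  simp [braidCoeff, braidProd, qPoch, qFact]

/-- The factor [i - i] occurs: e^r kills `x_{a-2i}` once r > i. -/
theorem braidCoeff_eq_zero {a i r : ℕ} (h : i < r) : braidCoeff q a i r = 0 := by
  have : ∏ s ∈ Finset.range r, qNum q ((i : ℝ) - s) = 0 :=
    Finset.prod_eq_zero (Finset.mem_range.2 h) (by rw [sub_self, qNum_zero])
  rw [braidCoeff, braidProd, this]
  simp

/-- The factor [0] occurs. Row a + 1 therefore vanishes, in accordance with f `x_{-a}` = 0. -/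
theorem braidCoeff_succ_left_eq_zero (a r : ℕ) : braidCoeff q a (a + 1) (r + 1) = 0 := by
  have : qPoch q ((a : ℝ) - ((a + 1 : ℕ) : ℝ) + 1) (r + 1) = 0 :=
    Finset.prod_eq_zero (Finset.mem_range.2 (Nat.succ_pos r))
      (by push_cast; rw [show (a : ℝ) - (a + 1) + 1 + 0 = 0 by ring, qNum_zero])
  rw [braidCoeff, braidProd, this]
  simp

/-- This is the coefficient identity that makes the R-matrix commute with f: the bracket collects
the contributions of f ⊗ k after crossing and of k' ⊗ f before crossing. The power of q in
`braidCoeff` turns the bracket into the q-number of `braidProd_succ_succ`. -/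
theorem braidCoeff_succ_succ (hq : q ∈ Set.Ioo (0 : ℝ) 1) (a i r : ℕ) :
    braidCoeff q a (i + 1) (r + 1) = q ^ (((r : ℝ) + 1) / 2) * braidCoeff q a i (r + 1) +
      braidCoeff q a i r * (q ^ (((a : ℝ) - 2 * i + 2 * r) / 4) -
        q ^ (-((a : ℝ) - 2 * i) / 4 + (2 * i - r - a) / 2)) := by
  have h0 := hq.1
  set u := q ^ (((r + 1 : ℕ) : ℝ) * (2 * ((i + 1 : ℕ) : ℝ) - ((r + 1 : ℕ) : ℝ) - 1 - a) / 4) with hu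
  have e1 : q ^ (((r : ℝ) + 1) / 2) *
      q ^ (((r + 1 : ℕ) : ℝ) * (2 * (i : ℝ) - ((r + 1 : ℕ) : ℝ) - 1 - a) / 4) = u := by
    rw [hu, ← Real.rpow_add h0]; push_cast; ring_nf
  have e2 : q ^ ((r : ℝ) * (2 * i - r - 1 - a) / 4) * (q ^ (((a : ℝ) - 2 * i + 2 * r) / 4) -
        q ^ (-((a : ℝ) - 2 * i) / 4 + (2 * i - r - a) / 2)) =
      u * (q ^ ((1 : ℝ) / 2) - q ^ (-(1 : ℝ) / 2)) * qNum q ((a : ℝ) - 2 * i + r) := by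
    rw [qNum, mul_assoc, mul_div_cancel₀ _ (qNum_denom_ne_zero hq), mul_sub (q ^ _), mul_sub u, hu,
      ← Real.rpow_add h0, ← Real.rpow_add h0, ← Real.rpow_add h0, ← Real.rpow_add h0]
    push_cast
    ring_nf
  rw [braidCoeff, ← hu, braidProd_succ_succ hq, braidCoeff, braidCoeff]
  linear_combination (-(q ^ ((1 : ℝ) / 2) - q ^ (-(1 : ℝ) / 2)) ^ (r + 1) *
    braidProd q a i (r + 1)) * e1 -
    (q ^ ((1 : ℝ) / 2) - q ^ (-(1 : ℝ) / 2)) ^ r * braidProd q a i r * e2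

section

variable {W W' : Type*} [AddCommGroup W'] [Module ℂ W'] [AddCommGroup W] [Module ℂ W]

/-- The map `w ↦ Ř (x_{a-2i} ⊗ w)`. -/
def braidRow (q : ℝ) (a : ℕ) (σ : UqRep q W) (i : ℕ) : W →ₗ[ℂ] W ⊗[ℂ] Spin a :=
  -- On `x_{a-2i}` the Cartan factor q^(h ⊗ h / 4) acts on W as the power a - 2i of k, and the term
  -- e^r ⊗ f^r brings a further k^r. The total power a - 2i + r may be negative, so it is split into
  -- natural powers of k and `k'`; the subtraction 2i - r is exact since r ≤ i.
  ∑ r ∈ Finset.range (i + 1), ((braidCoeff q a i r : ℝ) : ℂ) •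
    (TensorProduct.mk ℂ W (Spin a)).flip (xVec a (i - r)) ∘ₗ
      (σ.f ^ r * (σ.k ^ a * σ.k' ^ (2 * i - r)))

/-- The braiding `V^{a/2} ⊗ W → W ⊗ V^{a/2}` given by the universal `R`-matrix. -/
def braiding (q : ℝ) (a : ℕ) (σ : UqRep q W) : Spin a ⊗[ℂ] W →ₗ[ℂ] W ⊗[ℂ] Spin a :=
  TensorProduct.lift ((Pi.basisFun ℂ (Fin (a + 1))).constr ℂ fun i => braidRow q a σ i)

theorem braidRow_apply (a : ℕ) (σ : UqRep q W) (i : ℕ) (w : W) :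
    braidRow q a σ i w = ∑ r ∈ Finset.range (i + 1), ((braidCoeff q a i r : ℝ) : ℂ) •
      ((σ.f ^ r * (σ.k ^ a * σ.k' ^ (2 * i - r))) w ⊗ₜ[ℂ] xVec a (i - r)) := by
  simp [braidRow, LinearMap.sum_apply]

/-- The bound includes i = a + 1, where both sides vanish, so that `braiding_f` needs no separate
case for the lowest weight vector. -/
theorem braiding_xVec (a : ℕ) (σ : UqRep q W) {i : ℕ} (hi : i ≤ a + 1) (w : W) :
    braiding q a σ (xVec a i ⊗ₜ w) = braidRow q a σ i w := by
  rcases hi.lt_or_eq with h | rfl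
  · have := xVec_coe a ⟨i, h⟩
    simp only at this
    rw [this, braiding, TensorProduct.lift.tmul, Module.Basis.constr_basis]
  · rw [xVec_eq_zero (by omega), TensorProduct.zero_tmul, map_zero, braidRow_apply,
      Finset.sum_range_succ']
    simp [braidCoeff_succ_left_eq_zero, xVec_eq_zero]

theorem spin_tensor_ext {M : Type*} [AddCommGroup M] [Module ℂ M] {a : ℕ}
    {A B : Spin a ⊗[ℂ] W →ₗ[ℂ] M} (h : ∀ i ≤ a, ∀ w, A (xVec a i ⊗ₜ w) = B (xVec a i ⊗ₜ w)) :
    A = B := by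
  refine TensorProduct.ext (end_ext fun i hi => LinearMap.ext fun w => ?_)
  exact h i hi w

/-- The R-matrix acts on W only through f, k and `k'`, with which Φ commutes. -/
theorem braiding_natural (a : ℕ) {σ : UqRep q W} {σ' : UqRep q W'} {Φ : W →ₗ[ℂ] W'}
    (h : UqRep.IsIntertwining σ σ' Φ) :
    braiding q a σ' ∘ₗ TensorProduct.map LinearMap.id Φ =
      TensorProduct.map Φ LinearMap.id ∘ₗ braiding q a σ := by
  have hpow : ∀ (A : Module.End ℂ W) (B : Module.End ℂ W'), (∀ v, Φ (A v) = B (Φ v)) →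
      ∀ (n : ℕ) v, Φ ((A ^ n) v) = (B ^ n) (Φ v) := by
    intro A B hAB n
    induction n with
    | zero => simp
    | succ n ih => intro v; rw [pow_succ, pow_succ, Module.End.mul_apply, ih, hAB]; rfl
  refine spin_tensor_ext fun i hi w => ?_
  simp only [LinearMap.comp_apply, TensorProduct.map_tmul, LinearMap.id_apply,
    braiding_xVec a _ (Nat.le_succ_of_le hi), braidRow_apply, map_sum, map_smul,
    Module.End.mul_apply, hpow _ _ h.map_f, hpow _ _ h.map_k, hpow _ _ h.map_k']

theorem UqRep.k'_mul_f_pow (hq : q ∈ Set.Ioo (0 : ℝ) 1) (σ : UqRep q W) (r : ℕ) :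
    σ.k' * σ.f ^ r = ((q ^ ((r : ℝ) / 2) : ℝ) : ℂ) • (σ.f ^ r * σ.k') := by
  induction r with
  | zero => simp
  | succ r ih =>
    rw [pow_succ, ← mul_assoc, ih, smul_mul_assoc, mul_assoc, σ.k'_mul_f hq.1, mul_smul_comm,
      smul_smul, ← mul_assoc, ← Complex.ofReal_mul, ← Real.rpow_add hq.1]
    push_cast
    ring_nf

theorem UqRep.k'_pow_mul_f (hq : q ∈ Set.Ioo (0 : ℝ) 1) (σ : UqRep q W) (m : ℕ) :
    σ.k' ^ m * σ.f = ((q ^ ((m : ℝ) / 2) : ℝ) : ℂ) • (σ.f * σ.k' ^ m) := by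
  induction m with
  | zero => simp
  | succ m ih =>
    rw [pow_succ', mul_assoc, ih, mul_smul_comm, ← mul_assoc, σ.k'_mul_f hq.1, smul_mul_assoc,
      smul_smul, mul_assoc, ← Complex.ofReal_mul, ← Real.rpow_add hq.1]
    push_cast
    ring_nf

theorem UqRep.k_pow_mul_f (hq : q ∈ Set.Ioo (0 : ℝ) 1) (σ : UqRep q W) (m : ℕ) :
    σ.k ^ m * σ.f = ((q ^ (-(m : ℝ) / 2) : ℝ) : ℂ) • (σ.f * σ.k ^ m) := by
  induction m with
  | zero => simp
  | succ m ih =>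
    rw [pow_succ', mul_assoc, ih, mul_smul_comm, ← mul_assoc, σ.k_mul_f, smul_mul_assoc,
      smul_smul, mul_assoc, ← Complex.ofReal_mul, ← Real.rpow_add hq.1]
    push_cast
    ring_nf

theorem UqRep.k_pow_mul_e (hq : q ∈ Set.Ioo (0 : ℝ) 1) (σ : UqRep q W) (m : ℕ) :
    σ.k ^ m * σ.e = ((q ^ ((m : ℝ) / 2) : ℝ) : ℂ) • (σ.e * σ.k ^ m) := by
  induction m with
  | zero => simp
  | succ m ih =>
    rw [pow_succ', mul_assoc, ih, mul_smul_comm, ← mul_assoc, σ.k_mul_e, smul_mul_assoc,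
      smul_smul, mul_assoc, ← Complex.ofReal_mul, ← Real.rpow_add hq.1]
    push_cast
    ring_nf

theorem UqRep.commute_k_k' (σ : UqRep q W) : Commute σ.k σ.k' := by
  rw [Commute, SemiconjBy, σ.k_mul_k', σ.k'_mul_k]

theorem braiding_f (a : ℕ) (σ : UqRep q W) (v : Spin a ⊗[ℂ] W) :
    braiding q a σ ((UqRep.tensor hq.1 (irrep hq a) σ).f v) =
      (UqRep.tensor hq.1 σ (irrep hq a)).f (braiding q a σ v) := by
  suffices h : braiding q a σ ∘ₗ (UqRep.tensor hq.1 (irrep hq a) σ).f =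
      (UqRep.tensor hq.1 σ (irrep hq a)).f ∘ₗ braiding q a σ from LinearMap.congr_fun h v
  refine spin_tensor_ext fun i hi w => ?_
  -- The Cartan part of the R-matrix: multiplying by k or `k'` shifts its index, and moving it past
  -- f costs a power of q.
  set D : ℕ → Module.End ℂ W := fun m => σ.k ^ a * σ.k' ^ m with hD
  have hDk : ∀ m, D (m + 1) * σ.k = D m := fun m => by
    rw [hD]; simp only; rw [mul_assoc, pow_succ, mul_assoc (σ.k' ^ m), σ.k'_mul_k, mul_one]
  have hkD : ∀ m, σ.k' * D m = D (m + 1) := fun m => by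
    rw [hD]; simp only
    rw [pow_succ', ← mul_assoc, ← mul_assoc, (σ.commute_k_k'.pow_left a).eq]
  have hDf : ∀ m, D m * σ.f = ((q ^ (((m : ℝ) - a) / 2) : ℝ) : ℂ) • (σ.f * D m) := fun m => by
    rw [hD]; simp only
    rw [mul_assoc, σ.k'_pow_mul_f hq, mul_smul_comm, ← mul_assoc, σ.k_pow_mul_f hq, smul_mul_assoc,
      smul_smul, mul_assoc, ← Complex.ofReal_mul, ← Real.rpow_add hq.1]
    ring_nf
  -- All terms of both sides are multiples of these vectors, so it suffices to compare coefficients.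
  set Y : ℕ → W ⊗[ℂ] Spin a := fun r => (σ.f ^ r * D (2 * i + 1 - r)) w ⊗ₜ xVec a (i + 1 - r)
    with hY
  have hL1 : braiding q a σ (xVec a (i + 1) ⊗ₜ σ.k w) =
      ∑ r ∈ Finset.range (i + 1 + 1), ((braidCoeff q a (i + 1) r : ℝ) : ℂ) • Y r := by
    rw [braiding_xVec a σ (by omega), braidRow_apply]
    refine Finset.sum_congr rfl fun r hr => ?_
    have hr' := Finset.mem_range.1 hr
    rw [← Module.End.mul_apply, mul_assoc, show 2 * (i + 1) - r = 2 * i + 1 - r + 1 by omega]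
    exact congrArg (fun A : Module.End ℂ W => _ • ((σ.f ^ r * A) w ⊗ₜ[ℂ] _)) (hDk _)
  have hL2 : braiding q a σ (xVec a i ⊗ₜ σ.f w) =
      ∑ r ∈ Finset.range (i + 1), ((braidCoeff q a i r * q ^ ((2 * (i : ℝ) - r - a) / 2) : ℝ) : ℂ) •
        Y (r + 1) := by
    rw [braiding_xVec a σ (by omega), braidRow_apply]
    refine Finset.sum_congr rfl fun r hr => ?_
    have hr' := Finset.mem_range.1 hr
    have h1 : σ.f ^ r * D (2 * i - r) * σ.f =
        ((q ^ ((2 * (i : ℝ) - r - a) / 2) : ℝ) : ℂ) • (σ.f ^ (r + 1) * D (2 * i - r)) := by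
      rw [mul_assoc, hDf, mul_smul_comm, ← mul_assoc, ← pow_succ, Nat.cast_sub (by omega)]
      push_cast
      rfl
    rw [← Module.End.mul_apply]
    change _ • ((σ.f ^ r * D (2 * i - r) * σ.f) w ⊗ₜ[ℂ] _) = _
    rw [h1, LinearMap.smul_apply, ← TensorProduct.smul_tmul', smul_smul, ← Complex.ofReal_mul, hY]
    simp only
    rw [show 2 * i + 1 - (r + 1) = 2 * i - r by omega, show i + 1 - (r + 1) = i - r by omega]
  have hR : (UqRep.tensor hq.1 σ (irrep hq a)).f (braiding q a σ (xVec a i ⊗ₜ w)) =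
      ∑ r ∈ Finset.range (i + 1),
        (((braidCoeff q a i r * q ^ (((a : ℝ) - 2 * i + 2 * r) / 4) : ℝ) : ℂ) • Y (r + 1) +
        ((q ^ ((r : ℝ) / 2) * braidCoeff q a i r : ℝ) : ℂ) • Y r) := by
    rw [braiding_xVec a σ (by omega), braidRow_apply, map_sum]
    refine Finset.sum_congr rfl fun r hr => ?_
    have hr' := Finset.mem_range.1 hr
    rw [map_smul, UqRep.tensor]
    simp only [LinearMap.add_apply, TensorProduct.map_tmul, irrep_k, irrep_f, smul_add]
    have h1 : σ.f * (σ.f ^ r * D (2 * i - r)) = σ.f ^ (r + 1) * D (2 * i - r) := by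
      rw [← mul_assoc, ← pow_succ']
    have h2 : σ.k' * (σ.f ^ r * D (2 * i - r)) =
        ((q ^ ((r : ℝ) / 2) : ℝ) : ℂ) • (σ.f ^ r * D (2 * i - r + 1)) := by
      rw [← mul_assoc, σ.k'_mul_f_pow hq, smul_mul_assoc, mul_assoc, hkD]
    rw [← Module.End.mul_apply σ.f, ← Module.End.mul_apply σ.k']
    change _ • ((σ.f * (σ.f ^ r * D (2 * i - r))) w ⊗ₜ[ℂ] _) +
      _ • ((σ.k' * (σ.f ^ r * D (2 * i - r))) w ⊗ₜ[ℂ] _) = _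
    rw [h1, h2, LinearMap.smul_apply, TensorProduct.tmul_smul, ← TensorProduct.smul_tmul', smul_smul,
      smul_smul, ← Complex.ofReal_mul, ← Complex.ofReal_mul, hY]
    simp only
    rw [show 2 * i + 1 - (r + 1) = 2 * i - r by omega, show i + 1 - (r + 1) = i - r by omega,
      show 2 * i - r + 1 = 2 * i + 1 - r by omega, show i - r + 1 = i + 1 - r by omega,
      mul_comm (q ^ ((r : ℝ) / 2)), Nat.cast_sub (by omega),
      show (a : ℝ) - 2 * (i - r) = a - 2 * i + 2 * r by ring]
  -- The added term r = i + 1 has coefficient zero; the sums on both sides now have equal length.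
  have hR2 : ∑ r ∈ Finset.range (i + 1), ((q ^ ((r : ℝ) / 2) * braidCoeff q a i r : ℝ) : ℂ) • Y r =
      ∑ r ∈ Finset.range (i + 1 + 1),
        ((q ^ ((r : ℝ) / 2) * braidCoeff q a i r : ℝ) : ℂ) • Y r := by
    rw [Finset.sum_range_succ _ (i + 1), braidCoeff_eq_zero (Nat.lt_succ_self i)]
    simp
  rw [LinearMap.comp_apply, LinearMap.comp_apply, hR, Finset.sum_add_distrib, hR2]
  have hL : braiding q a σ ((UqRep.tensor hq.1 (irrep hq a) σ).f (xVec a i ⊗ₜ w)) =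
      braiding q a σ (xVec a (i + 1) ⊗ₜ σ.k w) +
        ((q ^ (-((a : ℝ) - 2 * i) / 4) : ℝ) : ℂ) • braiding q a σ (xVec a i ⊗ₜ σ.f w) := by
    simp only [UqRep.tensor, LinearMap.add_apply, TensorProduct.map_tmul, irrep_f, irrep_k',
      map_add, ← TensorProduct.smul_tmul', map_smul]
  -- The r = 0 terms agree, both having coefficient 1; the remaining ones are matched by
  -- `braidCoeff_succ_succ`.
  rw [hL, hL1, hL2, Finset.sum_range_succ' _ (i + 1), Finset.sum_range_succ' _ (i + 1),
    braidCoeff_zero, braidCoeff_zero, ← add_assoc, Finset.smul_sum, add_right_comm,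
    ← Finset.sum_add_distrib, ← Finset.sum_add_distrib]
  congr 1
  · refine Finset.sum_congr rfl fun r _ => ?_
    rw [smul_smul, ← Complex.ofReal_mul, ← add_smul, ← add_smul, ← Complex.ofReal_add,
      ← Complex.ofReal_add, braidCoeff_succ_succ hq, Real.rpow_add hq.1]
    push_cast
    ring_nf
  · simp

theorem braiding_xVec_zero (a : ℕ) (σ : UqRep q W) (w : W) :
    braiding q a σ (xVec a 0 ⊗ₜ w) = (σ.k ^ a) w ⊗ₜ xVec a 0 := by
  rw [braiding_xVec a σ (Nat.zero_le _), braidRow_apply]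
  simp [braidCoeff_zero]

/-- `V^{a/2} ⊗ W` is generated by `x_a ⊗ W` under the action of `f`. -/
theorem mem_of_f_mem (a : ℕ) (σ : UqRep q W) (S : Submodule ℂ (Spin a ⊗[ℂ] W))
    (h0 : ∀ w, xVec a 0 ⊗ₜ w ∈ S)
    (hf : ∀ v ∈ S, (UqRep.tensor hq.1 (irrep hq a) σ).f v ∈ S) (v : Spin a ⊗[ℂ] W) : v ∈ S := by
  have hx : ∀ i w, xVec a i ⊗ₜ w ∈ S := by
    intro i
    induction i with
    | zero => exact h0
    | succ i ih =>
      intro w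
      -- Applying f to `x_{a-2i} ⊗ k' w` gives `x_{a-2i-2} ⊗ w` plus a multiple of a vector already
      -- known to lie in S.
      have h1 := hf _ (ih (σ.k' w))
      have h2 : σ.k (σ.k' w) = w := LinearMap.congr_fun σ.k_mul_k' w
      simp only [UqRep.tensor, LinearMap.add_apply, TensorProduct.map_tmul, irrep_f, irrep_k',
        ← TensorProduct.smul_tmul', h2] at h1
      exact (Submodule.add_mem_iff_left _ (S.smul_mem _ (ih _))).1 h1
  induction v using TensorProduct.induction_on with
  | zero => exact S.zero_mem
  | add x y hx hy => exact S.add_mem hx hy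
  | tmul x w =>
    rw [spin_eq_sum a x, TensorProduct.sum_tmul]
    refine S.sum_mem fun i _ => ?_
    rw [← TensorProduct.smul_tmul']
    exact S.smul_mem _ (hx _ _)

/-- The agreement locus is stable under f, so agreement on the generators suffices. M carries only
one operator F, which allows F to be the transpose of e on a dual space in
`shapovalovTensor_braiding`. -/
theorem eq_of_f_comm {M : Type*} [AddCommGroup M] [Module ℂ M] (F : Module.End ℂ M) (a : ℕ)
    (σ : UqRep q W) {A B : Spin a ⊗[ℂ] W →ₗ[ℂ] M}
    (hA : ∀ v, A ((UqRep.tensor hq.1 (irrep hq a) σ).f v) = F (A v))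
    (hB : ∀ v, B ((UqRep.tensor hq.1 (irrep hq a) σ).f v) = F (B v))
    (h0 : ∀ w, A (xVec a 0 ⊗ₜ w) = B (xVec a 0 ⊗ₜ w)) : A = B := by
  refine LinearMap.ext fun v => ?_
  refine mem_of_f_mem hq a σ (LinearMap.eqLocus A B) h0 (fun v hv => ?_) v
  rw [LinearMap.mem_eqLocus] at hv ⊢
  rw [hA, hB, hv]

/-- By the defining relations, the locus where the map commutes with k, respectively with e, is
stable under f; for e this uses that [e, f] is a combination of `k * k` and `k' * k'`. It remains to
look at `x_a ⊗ w`. -/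
theorem isIntertwining_braiding (a : ℕ) (σ : UqRep q W) :
    UqRep.IsIntertwining (UqRep.tensor hq.1 (irrep hq a) σ) (UqRep.tensor hq.1 σ (irrep hq a))
      (braiding q a σ) := by
  set T := UqRep.tensor hq.1 (irrep hq a) σ with hT
  set T' := UqRep.tensor hq.1 σ (irrep hq a) with hT'
  have hf : ∀ v, braiding q a σ (T.f v) = T'.f (braiding q a σ v) := braiding_f hq a σ
  have hk : ∀ v, braiding q a σ (T.k v) = T'.k (braiding q a σ v) := by
    refine mem_of_f_mem hq a σ
      (LinearMap.eqLocus (braiding q a σ ∘ₗ T.k) (T'.k ∘ₗ braiding q a σ)) ?_ ?_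
    · intro w
      simp only [LinearMap.mem_eqLocus, LinearMap.comp_apply, hT, hT', UqRep.tensor,
        TensorProduct.map_tmul, irrep_k, ← TensorProduct.smul_tmul', map_smul, braiding_xVec_zero,
        TensorProduct.tmul_smul]
      rw [← Module.End.mul_apply, ← Module.End.mul_apply, pow_mul_comm']
    · intro v hv
      simp only [LinearMap.mem_eqLocus, LinearMap.comp_apply] at hv ⊢
      have h1 : T.k (T.f v) = _ := LinearMap.congr_fun T.k_mul_f v
      have h2 : T'.k (T'.f (braiding q a σ v)) = _ :=
        LinearMap.congr_fun T'.k_mul_f (braiding q a σ v)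
      rw [← hT, h1, hf v, h2]
      simp only [LinearMap.smul_apply, Module.End.mul_apply, map_smul, hf, hv]
  have hk' : ∀ v, braiding q a σ (T.k' v) = T'.k' (braiding q a σ v) := by
    intro v
    have h1 : T.k (T.k' v) = v := LinearMap.congr_fun T.k_mul_k' v
    have h2 : T'.k' (T'.k (braiding q a σ (T.k' v))) = braiding q a σ (T.k' v) :=
      LinearMap.congr_fun T'.k'_mul_k _
    rw [← h2, ← hk, h1]
  refine ⟨?_, hf, hk⟩
  refine mem_of_f_mem hq a σ
    (LinearMap.eqLocus (braiding q a σ ∘ₗ T.e) (T'.e ∘ₗ braiding q a σ)) ?_ ?_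
  · intro w
    have h1 : (σ.k ^ a) (σ.e w) = _ := LinearMap.congr_fun (σ.k_pow_mul_e hq a) w
    simp only [LinearMap.mem_eqLocus, LinearMap.comp_apply, hT, hT', UqRep.tensor,
      TensorProduct.map_tmul, irrep_k, irrep_k', ← TensorProduct.smul_tmul', map_smul, map_add,
      braiding_xVec_zero, LinearMap.add_apply, TensorProduct.tmul_smul,
      irrep_e hq (Nat.zero_le a), h1, LinearMap.smul_apply, smul_smul, Module.End.mul_apply]
    simp only [Nat.cast_zero, qNum_zero, zero_mul, Complex.ofReal_zero, zero_smul, zero_add,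
      add_zero]
    rw [← Complex.ofReal_mul, ← Real.rpow_add hq.1]
    ring_nf
  · intro v hv
    simp only [LinearMap.mem_eqLocus, LinearMap.comp_apply] at hv ⊢
    have h1 : T.e (T.f v) = T.f (T.e v) + _ :=
      sub_eq_iff_eq_add'.1 (LinearMap.congr_fun T.e_f v)
    have h2 : T'.e (T'.f (braiding q a σ v)) = T'.f (T'.e (braiding q a σ v)) + _ :=
      sub_eq_iff_eq_add'.1 (LinearMap.congr_fun T'.e_f (braiding q a σ v))
    rw [← hT, h1, hf v, h2]
    simp only [LinearMap.smul_apply, LinearMap.sub_apply, Module.End.mul_apply, map_smul, map_add,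
      map_sub, hf, hv, hk, hk']

theorem isIntertwining_assoc_symm {U : Type*} [AddCommGroup U] [Module ℂ U] (hq : 0 < q)
    (ρ : UqRep q U) (σ : UqRep q W) (τ : UqRep q W') :
    UqRep.IsIntertwining (UqRep.tensor hq ρ (UqRep.tensor hq σ τ))
      (UqRep.tensor hq (UqRep.tensor hq ρ σ) τ) (TensorProduct.assoc ℂ U W W').symm.toLinearMap := by
  have h := UqRep.isIntertwining_assoc hq ρ σ τ
  refine ⟨fun v => ?_, fun v => ?_, fun v => ?_⟩ <;>
  obtain ⟨v, rfl⟩ := (TensorProduct.assoc ℂ U W W').surjective v <;>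
  rw [LinearEquiv.coe_coe, LinearEquiv.symm_apply_eq, LinearEquiv.symm_apply_apply]
  · exact (h.map_e v).symm
  · exact (h.map_f v).symm
  · exact (h.map_k v).symm

/-- The hexagon identity: braiding past a tensor product. -/
theorem braiding_tensor (a : ℕ) (σ : UqRep q W) (τ : UqRep q W') :
    (TensorProduct.assoc ℂ W W' (Spin a)).toLinearMap ∘ₗ braiding q a (UqRep.tensor hq.1 σ τ) ∘ₗ
      (TensorProduct.assoc ℂ (Spin a) W W').toLinearMap =
    TensorProduct.map LinearMap.id (braiding q a τ) ∘ₗ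
      (TensorProduct.assoc ℂ W (Spin a) W').toLinearMap ∘ₗ
        TensorProduct.map (braiding q a σ) LinearMap.id := by
  -- Moving the associator across makes both maps start from `V^{a/2} ⊗ (W ⊗ W')`, so that
  -- `eq_of_f_comm` applies.
  have key : (TensorProduct.assoc ℂ W W' (Spin a)).toLinearMap ∘ₗ
      braiding q a (UqRep.tensor hq.1 σ τ) =
      TensorProduct.map LinearMap.id (braiding q a τ) ∘ₗ
      (TensorProduct.assoc ℂ W (Spin a) W').toLinearMap ∘ₗ
        TensorProduct.map (braiding q a σ) LinearMap.id ∘ₗ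
        (TensorProduct.assoc ℂ (Spin a) W W').symm.toLinearMap := by
    have hA := (UqRep.isIntertwining_assoc hq.1 σ τ (irrep hq a)).comp
      (isIntertwining_braiding hq a (UqRep.tensor hq.1 σ τ))
    have hB := ((UqRep.IsIntertwining.id σ).tensor hq.1 (isIntertwining_braiding hq a τ)).comp
      ((UqRep.isIntertwining_assoc hq.1 σ (irrep hq a) τ).comp
      (((isIntertwining_braiding hq a σ).tensor hq.1 (UqRep.IsIntertwining.id τ)).comp
      (isIntertwining_assoc_symm hq.1 (irrep hq a) σ τ)))
    refine eq_of_f_comm hq _ a (UqRep.tensor hq.1 σ τ) hA.map_f hB.map_f fun w => ?_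
    induction w using TensorProduct.induction_on with
    | zero => simp
    | add x y hx hy => simp only [TensorProduct.tmul_add, map_add, hx, hy]
    | tmul x y =>
      -- On the generating vectors the hexagon identity says only that k is group-like.
      have hk : ((UqRep.tensor hq.1 σ τ).k ^ a) (x ⊗ₜ y) = (σ.k ^ a) x ⊗ₜ (τ.k ^ a) y := by
        simp only [UqRep.tensor, TensorProduct.map_pow, TensorProduct.map_tmul]
      simp [braiding_xVec_zero, hk]
  rw [← LinearMap.comp_assoc, key]
  exact LinearMap.ext fun v => by simp

end

/-! ### The eigenvalues of the braiding -/

/-- The adjoint e of f kills the highest weight vector. This removes every non-Cartan term of the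
R-matrix from a pairing with that vector. -/
theorem shapovalov_xVec_zero_f_pow (a r : ℕ) (v : Spin a) :
    shapovalov q a (xVec a 0) (((irrep hq a).f ^ (r + 1)) v) = 0 := by
  rw [pow_succ', Module.End.mul_apply, ← shapovalov_e, irrep_e hq (Nat.zero_le a)]
  simp [qNum_zero]

theorem irrep_k_pow (n i m : ℕ) :
    ((irrep hq n).k ^ m) (xVec n i) = ((q ^ ((m : ℝ) * ((n : ℝ) - 2 * i) / 4) : ℝ) : ℂ) • xVec n i := by
  induction m with
  | zero => simp
  | succ m ih =>
    rw [pow_succ, Module.End.mul_apply, irrep_k, map_smul, ih, smul_smul, ← Complex.ofReal_mul,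
      ← Real.rpow_add hq.1]
    push_cast
    ring_nf

theorem irrep_k'_pow (n i m : ℕ) :
    ((irrep hq n).k' ^ m) (xVec n i) =
      ((q ^ (-(m : ℝ) * ((n : ℝ) - 2 * i) / 4) : ℝ) : ℂ) • xVec n i := by
  induction m with
  | zero => simp
  | succ m ih =>
    rw [pow_succ, Module.End.mul_apply, irrep_k', map_smul, ih, smul_smul, ← Complex.ofReal_mul,
      ← Real.rpow_add hq.1]
    push_cast
    ring_nf

/-- As maps into the dual space both sides turn f into the transpose of e, so only `x_a ⊗ y` has to
be tested. There each side reduces to its Cartan term, and the two terms have the same power of q.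
-/
theorem shapovalovTensor_braiding (a b : ℕ) (v : Spin a ⊗[ℂ] Spin b) (w : Spin b ⊗[ℂ] Spin a) :
    shapovalovTensor q b a (braiding q a (irrep hq b) v) w =
      shapovalovTensor q a b v (braiding q b (irrep hq a) w) := by
  suffices h : shapovalovTensor q b a ∘ₗ braiding q a (irrep hq b) =
      LinearMap.compl₂ (shapovalovTensor q a b) (braiding q b (irrep hq a)) from
    LinearMap.congr_fun₂ h v w
  have hab := isIntertwining_braiding hq a (irrep hq b)
  have hba := isIntertwining_braiding hq b (irrep hq a)
  refine eq_of_f_comm hq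
    (Module.Dual.transpose (UqRep.tensor hq.1 (irrep hq b) (irrep hq a)).e) a (irrep hq b) ?_ ?_ ?_
  · intro v
    refine LinearMap.ext fun w => ?_
    simp only [LinearMap.comp_apply, Module.Dual.transpose_apply]
    rw [hab.map_f, shapovalovTensor_f]
  · intro v
    refine LinearMap.ext fun w => ?_
    simp only [LinearMap.comp_apply, Module.Dual.transpose_apply, LinearMap.compl₂_apply]
    rw [hba.map_e, shapovalovTensor_f]
  · intro y
    suffices h : ∀ j ≤ b, ∀ i ≤ b, ∀ l ≤ a,
        shapovalovTensor q b a (braiding q a (irrep hq b) (xVec a 0 ⊗ₜ xVec b j))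
          (xVec b i ⊗ₜ xVec a l) = shapovalovTensor q a b (xVec a 0 ⊗ₜ xVec b j)
          (braiding q b (irrep hq a) (xVec b i ⊗ₜ xVec a l)) by
      have : (shapovalovTensor q b a ∘ₗ braiding q a (irrep hq b)) ∘ₗ
          TensorProduct.mk ℂ (Spin a) (Spin b) (xVec a 0) =
          (LinearMap.compl₂ (shapovalovTensor q a b) (braiding q b (irrep hq a))) ∘ₗ
            TensorProduct.mk ℂ (Spin a) (Spin b) (xVec a 0) :=
        end_ext fun j hj => spin_tensor_ext fun i hi w => by
          rw [spin_eq_sum a w, TensorProduct.tmul_sum, map_sum, map_sum]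
          refine Finset.sum_congr rfl fun l _ => ?_
          rw [TensorProduct.tmul_smul, map_smul, map_smul]
          congr 1
          exact h j hj i hi l (Nat.le_of_lt_succ l.2)
      exact LinearMap.congr_fun this y
    intro j hj i hi l hl
    rw [braiding_xVec_zero, irrep_k_pow, braiding_xVec b _ (by omega), braidRow_apply,
      Finset.sum_range_succ', map_add, map_sum, Finset.sum_eq_zero, zero_add, map_smul,
      ← TensorProduct.smul_tmul', map_smul, LinearMap.smul_apply, shapovalovTensor_tmul,
      shapovalovTensor_tmul, braidCoeff_zero, pow_zero, one_mul, Module.End.mul_apply,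
      irrep_k'_pow, map_smul, irrep_k_pow, map_smul, map_smul, shapovalov_xVec _ _ _ _ hj,
      shapovalov_xVec _ _ _ _ (Nat.zero_le a), shapovalov_xVec _ _ _ _ hj]
    · by_cases h1 : 0 = l
      · subst h1
        by_cases h2 : j = i
        · subst h2
          simp only [if_true, smul_eq_mul, Complex.ofReal_one, one_mul, Nat.sub_zero]
          have e : q ^ ((a : ℝ) * ((b : ℝ) - 2 * j) / 4) =
              q ^ (-((2 * j : ℕ) : ℝ) * ((a : ℝ) - 2 * ((0 : ℕ) : ℝ)) / 4) *
                q ^ ((b : ℝ) * ((a : ℝ) - 2 * ((0 : ℕ) : ℝ)) / 4) := by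
            rw [← Real.rpow_add hq.1]
            push_cast
            ring_nf
          rw [e, Complex.ofReal_mul]
          ring
        · simp [h2]
      · simp [h1]
    · intro r _
      rw [map_smul, shapovalovTensor_tmul, Module.End.mul_apply, shapovalov_xVec_zero_f_pow,
        zero_mul, smul_zero]

/-- The image of the highest weight vector is killed by e; pairing this with `x_{a-2k} ⊗ x_{b-2m}`
and moving e to the other side as f leaves two terms. The ratio of their powers of q depends only on
k + m. -/
theorem stdEmbedding_coeff_succ {a b c l : ℕ} (k m : ℕ) (hkm : k + m + 1 = l) :
    shapovalovTensor q a b (stdEmbedding hq a b c (xVec c 0)) (xVec a (k + 1) ⊗ₜ xVec b m) =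
      ((-q ^ (-((a : ℝ) + b) / 4 + ((l : ℝ) - 1) / 2) : ℝ) : ℂ) *
      shapovalovTensor q a b (stdEmbedding hq a b c (xVec c 0)) (xVec a k ⊗ₜ xVec b (m + 1)) := by
  have h := shapovalovTensor_e hq a b (stdEmbedding hq a b c (xVec c 0)) (xVec a k ⊗ₜ xVec b m)
  rw [← (isIntertwining_stdEmbedding hq a b c).map_e, irrep_e hq (Nat.zero_le c)] at h
  simp only [Nat.cast_zero, qNum_zero, zero_mul, Complex.ofReal_zero, zero_smul, map_zero,
    LinearMap.zero_apply, UqRep.tensor, LinearMap.add_apply, TensorProduct.map_tmul, irrep_f,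
    irrep_k, irrep_k', TensorProduct.tmul_smul, ← TensorProduct.smul_tmul', map_add, map_smul,
    smul_eq_mul] at h
  have hA : q ^ (((b : ℝ) - 2 * m) / 4) ≠ 0 := (Real.rpow_pos_of_pos hq.1 _).ne'
  have hA' : ((q ^ (((b : ℝ) - 2 * m) / 4) : ℝ) : ℂ) ≠ 0 := Complex.ofReal_ne_zero.2 hA
  have he : q ^ (-((a : ℝ) + b) / 4 + ((l : ℝ) - 1) / 2) * q ^ (((b : ℝ) - 2 * m) / 4) =
      q ^ (-((a : ℝ) - 2 * k) / 4) := by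
    rw [← Real.rpow_add hq.1, ← hkm]
    push_cast
    ring_nf
  rw [← he] at h
  push_cast at h ⊢
  refine mul_left_cancel₀ hA' ?_
  linear_combination -h

/-- The ratio in the previous recursion does not depend on k, so the coefficients form a geometric
progression. At k = l it produces the sign of the braiding eigenvalue. -/
theorem stdEmbedding_coeff {a b c l : ℕ} (k : ℕ) (hk : k ≤ l) :
    shapovalovTensor q a b (stdEmbedding hq a b c (xVec c 0)) (xVec a k ⊗ₜ xVec b (l - k)) =
      (-1) ^ k * ((q ^ ((k : ℝ) * (-((a : ℝ) + b) / 4 + ((l : ℝ) - 1) / 2)) : ℝ) : ℂ) *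
      shapovalovTensor q a b (stdEmbedding hq a b c (xVec c 0)) (xVec a 0 ⊗ₜ xVec b l) := by
  induction k with
  | zero => simp
  | succ k ih =>
    rw [stdEmbedding_coeff_succ hq (l := l) k (l - (k + 1)) (by omega),
      show l - (k + 1) + 1 = l - k by omega, ih (by omega), pow_succ, Nat.cast_succ, add_mul,
      one_mul]
    generalize -((a : ℝ) + b) / 4 + ((l : ℝ) - 1) / 2 = z
    rw [Real.rpow_add hq.1]
    push_cast
    ring

theorem stdEmbedding_coeff_pos {a b c : ℕ} (h : Triad a b c) :
    ∃ p : ℝ, 0 < p ∧ shapovalovTensor q a b (stdEmbedding hq a b c (xVec c 0))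
      (xVec a 0 ⊗ₜ xVec b ((a + b - c) / 2)) = p := by
  obtain ⟨r, hr, h1⟩ := (isStdEmbedding_stdEmbedding hq h).positive
  have g1 : 0 < √(xNormSq q a 0) := Real.sqrt_pos.2 (xNormSq_pos hq (by omega))
  have g2 : 0 < √(xNormSq q b ((a + b - c) / 2)) :=
    Real.sqrt_pos.2 (xNormSq_pos hq (by obtain ⟨_, _, _, _⟩ := h; omega))
  have g3 : 0 < √(xNormSq q c 0) := Real.sqrt_pos.2 (xNormSq_pos hq (by omega))
  rw [stdVec, stdVec, stdVec, map_smul, TensorProduct.smul_tmul_smul, map_smul, map_smul,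
    LinearMap.smul_apply, smul_eq_mul, smul_eq_mul] at h1
  refine ⟨√(xNormSq q a 0) * √(xNormSq q b ((a + b - c) / 2)) * √(xNormSq q c 0) * r,
    by positivity, ?_⟩
  push_cast
  rw [← h1]
  push_cast
  have g1' := Complex.ofReal_ne_zero.2 g1.ne'
  have g2' := Complex.ofReal_ne_zero.2 g2.ne'
  have g3' := Complex.ofReal_ne_zero.2 g3.ne'
  field_simp

/-- The eigenvalue of the braiding on `V^j ⊆ V^{j₁} ⊗ V^{j₂}`. -/
def braidEigenvalue (q : ℝ) (a b c : ℕ) : ℂ :=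
  (-1) ^ ((a + b - c) / 2) * ((q ^ ((casimir c - casimir a - casimir b) / 2) : ℝ) : ℂ)

theorem Triad.swap {a b c : ℕ} (h : Triad a b c) : Triad b a c := by
  obtain ⟨h1, h2, h3, h4⟩ := h
  exact ⟨h2, h1, by omega, by rwa [add_comm b a]⟩

/-- Multiplicity one gives scalars t and t' for the two orders of the factors, and adjointness gives
t = t'. Comparing extreme coefficients p and p' of the two embeddings yields t p' = (-1)^l A p and t
p = (-1)^l A' p'. Multiplying eliminates the unknown ratio p / p' and leaves t² = A A'; since p and
p' are positive, t has the sign (-1)^l. -/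
theorem braiding_comp_stdEmbedding (a b c : ℕ) :
    braiding q a (irrep hq b) ∘ₗ stdEmbedding hq a b c =
      braidEigenvalue q a b c • stdEmbedding hq b a c := by
  by_cases h : Triad a b c
  swap
  · rw [stdEmbedding_eq_zero hq h, stdEmbedding_eq_zero hq fun h' => h h'.swap]
    simp
  have h' := h.swap
  obtain ⟨t, ht⟩ := exists_smul_stdEmbedding hq
    ((isIntertwining_braiding hq a (irrep hq b)).comp (isIntertwining_stdEmbedding hq a b c))
  obtain ⟨t', ht'⟩ := exists_smul_stdEmbedding hq
    ((isIntertwining_braiding hq b (irrep hq a)).comp (isIntertwining_stdEmbedding hq b a c))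
  have htx : ∀ v, braiding q a (irrep hq b) (stdEmbedding hq a b c v) =
      t • stdEmbedding hq b a c v := fun v => LinearMap.congr_fun ht v
  have htx' : ∀ v, braiding q b (irrep hq a) (stdEmbedding hq b a c v) =
      t' • stdEmbedding hq a b c v := fun v => LinearMap.congr_fun ht' v
  have htt : t' = t := by
    have h1 := shapovalovTensor_braiding hq a b (stdEmbedding hq a b c (xVec c 0))
      (stdEmbedding hq b a c (xVec c 0))
    rw [htx, htx', map_smul, map_smul, LinearMap.smul_apply,
      (isStdEmbedding_stdEmbedding hq h).isometry, (isStdEmbedding_stdEmbedding hq h').isometry,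
      shapovalov_xVec _ _ _ _ (Nat.zero_le c), if_pos rfl, smul_eq_mul, smul_eq_mul] at h1
    exact (mul_right_cancel₀ (xNormSq_ne_zero hq c 0) h1).symm
  have key : ∀ {a b : ℕ} {t : ℂ} {p p' : ℝ}, Triad a b c → (∀ v, braiding q a (irrep hq b)
      (stdEmbedding hq a b c v) = t • stdEmbedding hq b a c v) →
      shapovalovTensor q a b (stdEmbedding hq a b c (xVec c 0))
        (xVec a 0 ⊗ₜ xVec b ((a + b - c) / 2)) = p →
      shapovalovTensor q b a (stdEmbedding hq b a c (xVec c 0))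
        (xVec b 0 ⊗ₜ xVec a ((b + a - c) / 2)) = p' →
      t * p' = (-1) ^ ((a + b - c) / 2) *
        ((q ^ (((a : ℝ) * b - ((a + b - c) / 2 : ℕ) * (a + 3 * b) +
          2 * ((a + b - c) / 2 : ℕ) * (((a + b - c) / 2 : ℕ) - 1)) / 4) * p : ℝ) : ℂ) := by
    intro a b t p p' h htx hp hp'
    -- The test vector begins with the highest weight vector of `V^{b/2}`, so after adjunction the
    -- braiding contributes just a power of q.
    have h1 := shapovalovTensor_braiding hq a b (stdEmbedding hq a b c (xVec c 0))
      (xVec b 0 ⊗ₜ xVec a ((b + a - c) / 2))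
    have h2 := stdEmbedding_coeff hq (a := a) (b := b) (c := c) (l := (a + b - c) / 2)
      ((a + b - c) / 2) le_rfl
    rw [Nat.sub_self] at h2
    rw [htx, map_smul, LinearMap.smul_apply, hp', braiding_xVec_zero, irrep_k_pow,
      ← TensorProduct.smul_tmul', map_smul, add_comm b a, h2, hp, smul_eq_mul, smul_eq_mul] at h1
    rw [h1, mul_left_comm, mul_assoc, mul_assoc, ← Complex.ofReal_mul, ← Complex.ofReal_mul,
      ← mul_assoc (q ^ _), ← Real.rpow_add hq.1]
    ring_nf
  obtain ⟨p, hp, hpe⟩ := stdEmbedding_coeff_pos hq h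
  obtain ⟨p', hp', hpe'⟩ := stdEmbedding_coeff_pos hq h'
  have k1 := key h htx hpe hpe'
  have k2 := key h' htx' hpe' hpe
  rw [htt, add_comm b a] at k2
  set l := (a + b - c) / 2 with hl
  have hc : (c : ℝ) = a + b - 2 * l := by
    have : c + 2 * l = a + b := by obtain ⟨_, _, _, m, hm⟩ := h; omega
    have : (c : ℝ) + 2 * l = a + b := by exact_mod_cast this
    linarith
  set A := q ^ (((a : ℝ) * b - (l : ℝ) * (a + 3 * b) + 2 * (l : ℝ) * ((l : ℝ) - 1)) / 4) with hA
  set A' := q ^ (((b : ℝ) * a - (l : ℝ) * (b + 3 * a) + 2 * (l : ℝ) * ((l : ℝ) - 1)) / 4) with hA'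
  have hApos : 0 < A := Real.rpow_pos_of_pos hq.1 _
  have hs : ((-1 : ℂ) ^ l) * (-1) ^ l = 1 := by rw [← mul_pow]; simp
  have hp0 : (p' : ℂ) ≠ 0 := Complex.ofReal_ne_zero.2 hp'.ne'
  have ht1 : t = (-1) ^ l * ((A * p / p' : ℝ) : ℂ) := by
    push_cast
    rw [mul_div_assoc', eq_div_iff hp0, k1]
    push_cast
    ring
  have hsq : (A * p / p') * p = A' * p' := by
    rw [ht1] at k2
    have h3 : ((-1 : ℂ) ^ l) ≠ 0 := fun h0 => by rw [h0] at hs; simp at hs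
    rw [mul_assoc] at k2
    exact_mod_cast mul_left_cancel₀ h3 k2
  -- Both sides are positive, so their squares may be compared; the exponent of A A' is the Casimir
  -- difference.
  have hτ : A * p / p' = q ^ ((casimir c - casimir a - casimir b) / 2) := by
    refine (pow_left_inj₀ (by positivity) (Real.rpow_pos_of_pos hq.1 _).le two_ne_zero).1 ?_
    have h4 : A * A' = (q ^ ((casimir c - casimir a - casimir b) / 2)) ^ 2 := by
      rw [hA, hA', ← Real.rpow_add hq.1, ← Real.rpow_natCast, ← Real.rpow_mul hq.1.le]
      congr 1
      rw [casimir, casimir, casimir, hc]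
      push_cast
      ring
    rw [← h4]
    have hp'' := hp'.ne'
    field_simp at hsq ⊢
    linear_combination hsq
  rw [ht, ht1, hτ, braidEigenvalue]

/-- The inverse of the braiding of `V^{a/2}` and `V^{b/2}`. -/
def invBraiding (a b : ℕ) : Spin b ⊗[ℂ] Spin a →ₗ[ℂ] Spin a ⊗[ℂ] Spin b :=
  ∑ c ∈ Finset.range (b + a + 1) with Triad b a c,
    (braidEigenvalue q a b c)⁻¹ • (stdEmbedding hq a b c ∘ₗ stdProj hq b a c)

theorem braidEigenvalue_ne_zero (hq : q ∈ Set.Ioo (0 : ℝ) 1) (a b c : ℕ) :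
    braidEigenvalue q a b c ≠ 0 :=
  mul_ne_zero (pow_ne_zero _ (by norm_num))
    (Complex.ofReal_ne_zero.2 (Real.rpow_pos_of_pos hq.1 _).ne')

theorem Triad.mem_range {a b c : ℕ} (h : Triad a b c) : c ∈ Finset.range (a + b + 1) :=
  Finset.mem_range.2 (Nat.lt_succ_of_le h.2.2.1)

theorem invBraiding_comp_stdEmbedding (a b c : ℕ) :
    invBraiding hq a b ∘ₗ stdEmbedding hq b a c =
      (braidEigenvalue q a b c)⁻¹ • stdEmbedding hq a b c := by
  by_cases h : Triad b a c
  · refine LinearMap.ext fun v => ?_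
    simp only [invBraiding, LinearMap.comp_apply, LinearMap.sum_apply, LinearMap.smul_apply]
    rw [Finset.sum_eq_single_of_mem c (Finset.mem_filter.2 ⟨h.mem_range, h⟩)]
    · rw [← LinearMap.comp_apply (stdProj hq b a c), stdProj_comp_stdEmbedding hq h,
        LinearMap.id_apply]
    · intro d _ hd
      rw [← LinearMap.comp_apply (stdProj hq b a d), stdProj_comp_stdEmbedding_of_ne hq hd.symm,
        LinearMap.zero_apply, map_zero, smul_zero]
  · rw [stdEmbedding_eq_zero hq h, stdEmbedding_eq_zero hq fun h' => h h'.swap]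
    simp

/-- On each summand of the Clebsch–Gordan decomposition the two maps act by inverse scalars. A left
inverse is all that `partial_braid` needs. -/
theorem invBraiding_comp_braiding (a b : ℕ) :
    invBraiding hq a b ∘ₗ braiding q a (irrep hq b) = LinearMap.id := by
  refine LinearMap.ext fun v => ?_
  have hv : v = ∑ c ∈ Finset.range (a + b + 1) with Triad a b c,
      stdEmbedding hq a b c (stdProj hq a b c v) := by
    conv_lhs => rw [← LinearMap.id_apply (R := ℂ) v, ← sum_stdEmbedding_comp_stdProj hq a b]
    simp [LinearMap.sum_apply]
  rw [hv, map_sum, map_sum]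
  refine Finset.sum_congr rfl fun c _ => ?_
  rw [LinearMap.comp_apply, ← LinearMap.comp_apply (braiding q a (irrep hq b)),
    braiding_comp_stdEmbedding, LinearMap.smul_apply, map_smul,
    ← LinearMap.comp_apply (invBraiding hq a b), invBraiding_comp_stdEmbedding,
    LinearMap.smul_apply, smul_smul, mul_inv_cancel₀ (braidEigenvalue_ne_zero hq a b c), one_smul,
    LinearMap.id_apply]

/-! ### The expansion defining the Racah coefficients -/

section

variable {U V W X : Type*} [AddCommMonoid U] [Module ℂ U] [AddCommMonoid V] [Module ℂ V]
  [AddCommMonoid W] [Module ℂ W] [AddCommMonoid X] [Module ℂ X]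

theorem map_id_sum_smul {ι : Type*} (s : Finset ι) (c : ι → ℂ) (g : ι → V →ₗ[ℂ] W) :
    TensorProduct.map (LinearMap.id : U →ₗ[ℂ] U) (∑ i ∈ s, c i • g i) =
      ∑ i ∈ s, c i • TensorProduct.map LinearMap.id (g i) := by
  have := map_sum (LinearMap.lTensorHom (R := ℂ) (N := V) (P := W) U) (fun i => c i • g i) s
  simp only [map_smul] at this
  exact this

theorem map_sum_smul_id {ι : Type*} (s : Finset ι) (c : ι → ℂ) (g : ι → V →ₗ[ℂ] W) :
    TensorProduct.map (∑ i ∈ s, c i • g i) (LinearMap.id : U →ₗ[ℂ] U) =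
      ∑ i ∈ s, c i • TensorProduct.map (g i) LinearMap.id := by
  have := map_sum (LinearMap.rTensorHom (R := ℂ) (N := V) (P := W) U) (fun i => c i • g i) s
  simp only [map_smul] at this
  exact this

theorem map_id_comp (g : V →ₗ[ℂ] W) (h : W →ₗ[ℂ] X) :
    TensorProduct.map (LinearMap.id : U →ₗ[ℂ] U) (h ∘ₗ g) =
      TensorProduct.map LinearMap.id h ∘ₗ TensorProduct.map LinearMap.id g := by
  rw [← TensorProduct.map_comp, LinearMap.id_comp]

theorem map_comp_id (g : V →ₗ[ℂ] W) (h : W →ₗ[ℂ] X) :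
    TensorProduct.map (h ∘ₗ g) (LinearMap.id : U →ₗ[ℂ] U) =
      TensorProduct.map h LinearMap.id ∘ₗ TensorProduct.map g LinearMap.id := by
  rw [← TensorProduct.map_comp, LinearMap.id_comp]

/-- The pentagon for the associator, needed to regroup four factors. -/
theorem tensor_pentagon (y : ((U ⊗[ℂ] V) ⊗[ℂ] W) ⊗[ℂ] X) :
    TensorProduct.assoc ℂ U V (W ⊗[ℂ] X) (TensorProduct.assoc ℂ (U ⊗[ℂ] V) W X y) =
      TensorProduct.map LinearMap.id (TensorProduct.assoc ℂ V W X).toLinearMap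
        (TensorProduct.assoc ℂ U (V ⊗[ℂ] W) X
          (TensorProduct.map (TensorProduct.assoc ℂ U V W).toLinearMap LinearMap.id y)) := by
  suffices h : (TensorProduct.assoc ℂ U V (W ⊗[ℂ] X)).toLinearMap ∘ₗ
      (TensorProduct.assoc ℂ (U ⊗[ℂ] V) W X).toLinearMap =
      TensorProduct.map LinearMap.id (TensorProduct.assoc ℂ V W X).toLinearMap ∘ₗ
        (TensorProduct.assoc ℂ U (V ⊗[ℂ] W) X).toLinearMap ∘ₗ
          TensorProduct.map (TensorProduct.assoc ℂ U V W).toLinearMap LinearMap.id from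
    LinearMap.congr_fun h y
  exact TensorProduct.ext_fourfold fun a b c d => by simp

end

/-- The embedding of `V^j` in `V^{j₁₂} ⊗ V^{j₃} ⊆ V^{j₁} ⊗ (V^{j₂} ⊗ V^{j₃})`. -/
def leftMap (a b d c n : ℕ) : Spin n →ₗ[ℂ] Spin a ⊗[ℂ] (Spin b ⊗[ℂ] Spin d) :=
  (TensorProduct.assoc ℂ (Spin a) (Spin b) (Spin d)).toLinearMap ∘ₗ
    TensorProduct.map (stdEmbedding hq a b c) LinearMap.id ∘ₗ stdEmbedding hq c d n

/-- The embedding of `V^j` in `V^{j₁} ⊗ V^{j₂₃} ⊆ V^{j₁} ⊗ (V^{j₂} ⊗ V^{j₃})`. -/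
def rightMap (a b d p n : ℕ) : Spin n →ₗ[ℂ] Spin a ⊗[ℂ] (Spin b ⊗[ℂ] Spin d) :=
  TensorProduct.map LinearMap.id (stdEmbedding hq b d p) ∘ₗ stdEmbedding hq a p n

theorem isIntertwining_leftMap (a b d c n : ℕ) :
    UqRep.IsIntertwining (irrep hq n)
      (UqRep.tensor hq.1 (irrep hq a) (UqRep.tensor hq.1 (irrep hq b) (irrep hq d)))
      (leftMap hq a b d c n) :=
  (UqRep.isIntertwining_assoc hq.1 _ _ _).comp
    (((isIntertwining_stdEmbedding hq a b c).tensor hq.1 (UqRep.IsIntertwining.id _)).comp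
      (isIntertwining_stdEmbedding hq c d n))

theorem isIntertwining_rightMap (a b d p n : ℕ) :
    UqRep.IsIntertwining (irrep hq n)
      (UqRep.tensor hq.1 (irrep hq a) (UqRep.tensor hq.1 (irrep hq b) (irrep hq d)))
      (rightMap hq a b d p n) :=
  ((UqRep.IsIntertwining.id _).tensor hq.1 (isIntertwining_stdEmbedding hq b d p)).comp
    (isIntertwining_stdEmbedding hq a p n)

/-- Insert the decomposition of the identity on the last two factors. Each projection yields an
intertwining map into `V^{a/2} ⊗ V^{p/2}`, hence a multiple of the standard embedding, and that
embedding is zero when p is not admissible. -/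
theorem exists_leftMap_eq_sum (a b d c n : ℕ) : ∃ w : ℕ → ℂ, leftMap hq a b d c n =
    ∑ p ∈ Finset.range (b + d + 1) with Triad b d p ∧ Triad a p n,
      w p • rightMap hq a b d p n := by
  have h := fun p => exists_smul_stdEmbedding hq
    (((UqRep.IsIntertwining.id (irrep hq a)).tensor hq.1 (isIntertwining_stdProj hq b d p)).comp
      (isIntertwining_leftMap hq a b d c n))
  choose w hw using h
  refine ⟨w, ?_⟩
  have h1 : leftMap hq a b d c n = TensorProduct.map LinearMap.id
      (∑ p ∈ Finset.range (b + d + 1) with Triad b d p,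
        (1 : ℂ) • (stdEmbedding hq b d p ∘ₗ stdProj hq b d p)) ∘ₗ leftMap hq a b d c n := by
    simp only [one_smul]
    rw [sum_stdEmbedding_comp_stdProj, TensorProduct.map_id, LinearMap.id_comp]
  rw [h1, map_id_sum_smul, ← Finset.filter_filter, Finset.sum_filter (fun p => Triad a p n)]
  refine LinearMap.ext fun v => ?_
  simp only [LinearMap.comp_apply, LinearMap.sum_apply, one_smul]
  refine Finset.sum_congr rfl fun p _ => ?_
  have h2 := LinearMap.congr_fun (hw p) v
  rw [LinearMap.comp_apply, LinearMap.smul_apply] at h2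
  rw [map_id_comp, LinearMap.comp_apply, h2, map_smul]
  split_ifs with hp
  · rfl
  · rw [stdEmbedding_eq_zero hq hp]
    simp

/-- Existence of the expansion shows that `racah` does not take its default value. Any choice of
coefficients would serve: the argument uses only this relation, not their uniqueness. -/
theorem leftMap_eq_sum_racah (a b d c n : ℕ) : leftMap hq a b d c n =
    ∑ p ∈ Finset.range (b + d + 1) with Triad b d p ∧ Triad a p n,
      racah hq a b d c n p • rightMap hq a b d p n := by
  classical
  have hex : ∃ W : ℕ → ℂ, ∀ i ≤ n, leftBasis hq a b d c n i =
      ∑ p ∈ Finset.range (b + d + 1) with Triad b d p ∧ Triad a p n,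
        W p • rightBasis hq a b d p n i := by
    obtain ⟨w, hw⟩ := exists_leftMap_eq_sum hq a b d c n
    refine ⟨w, fun i _ => ?_⟩
    have := LinearMap.congr_fun hw (stdVec q n i)
    rw [LinearMap.sum_apply] at this
    exact this
  have hr : ∀ p, racah hq a b d c n p = hex.choose p := fun p => by
    rw [racah, dif_pos hex]
  refine end_ext fun i hi => ?_
  have hs := hex.choose_spec i hi
  have hx : xVec n i = ((√(xNormSq q n i) : ℝ) : ℂ) • stdVec q n i := by
    rw [stdVec, smul_smul, ← Complex.ofReal_mul,
      mul_inv_cancel₀ (Real.sqrt_pos.2 (xNormSq_pos hq hi)).ne', Complex.ofReal_one, one_smul]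
  rw [hx, map_smul, map_smul]
  congr 1
  simp only [LinearMap.sum_apply, LinearMap.smul_apply, hr]
  exact hs

/-! ### Two evaluations of the braiding on a fourfold tensor product -/

/-- The copy of `V^{n₉/2}` in `V₁ ⊗ (V₂ ⊗ (V₆ ⊗ V₃))` with intermediate spins `n₅`, `n₄`,
coupled as `((1 (2 6)) 3)`. -/
def sourceTree (n₁ n₂ n₃ n₄ n₅ n₆ n₉ : ℕ) :
    Spin n₉ →ₗ[ℂ] Spin n₁ ⊗[ℂ] (Spin n₂ ⊗[ℂ] (Spin n₆ ⊗[ℂ] Spin n₃)) :=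
  TensorProduct.map LinearMap.id
    ((TensorProduct.assoc ℂ (Spin n₂) (Spin n₆) (Spin n₃)).toLinearMap ∘ₗ
      TensorProduct.map (stdEmbedding hq n₂ n₆ n₅) LinearMap.id) ∘ₗ leftMap hq n₁ n₅ n₃ n₄ n₉

/-- The copy of `V^{n₉/2}` in `V₂ ⊗ ((V₆ ⊗ V₃) ⊗ V₁)` with intermediate spins `p`, `r`,
coupled as `(2 ((6 3) 1))`. -/
def targetTree (n₁ n₂ n₃ n₆ n₉ p r : ℕ) :
    Spin n₉ →ₗ[ℂ] Spin n₂ ⊗[ℂ] ((Spin n₆ ⊗[ℂ] Spin n₃) ⊗[ℂ] Spin n₁) :=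
  TensorProduct.map LinearMap.id
    (TensorProduct.map (stdEmbedding hq n₆ n₃ p) LinearMap.id) ∘ₗ rightMap hq n₂ p n₁ r n₉

/-- The braiding of `V₁` past `V₂ ⊗ (V₆ ⊗ V₃)`. -/
def fullBraiding (n₁ n₂ n₃ n₆ : ℕ) :
    Spin n₁ ⊗[ℂ] (Spin n₂ ⊗[ℂ] (Spin n₆ ⊗[ℂ] Spin n₃)) →ₗ[ℂ]
      Spin n₂ ⊗[ℂ] ((Spin n₆ ⊗[ℂ] Spin n₃) ⊗[ℂ] Spin n₁) :=
  (TensorProduct.assoc ℂ (Spin n₂) (Spin n₆ ⊗[ℂ] Spin n₃) (Spin n₁)).toLinearMap ∘ₗ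
    braiding q n₁
      (UqRep.tensor hq.1 (irrep hq n₂) (UqRep.tensor hq.1 (irrep hq n₆) (irrep hq n₃)))

theorem leftMap_apply (a b d c n : ℕ) (z : Spin n) : leftMap hq a b d c n z =
    ∑ p ∈ Finset.range (b + d + 1) with Triad b d p ∧ Triad a p n,
      racah hq a b d c n p • rightMap hq a b d p n z := by
  rw [leftMap_eq_sum_racah, LinearMap.sum_apply]
  rfl

theorem map_id_leftMap_apply {U : Type*} [AddCommGroup U] [Module ℂ U] (a b d c n : ℕ)
    (y : U ⊗[ℂ] Spin n) : TensorProduct.map LinearMap.id (leftMap hq a b d c n) y =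
    ∑ p ∈ Finset.range (b + d + 1) with Triad b d p ∧ Triad a p n,
      racah hq a b d c n p • TensorProduct.map LinearMap.id (rightMap hq a b d p n) y := by
  rw [leftMap_eq_sum_racah, map_id_sum_smul, LinearMap.sum_apply]
  rfl

theorem braiding_stdEmbedding (a b c : ℕ) (z : Spin c) :
    braiding q a (irrep hq b) (stdEmbedding hq a b c z) =
      braidEigenvalue q a b c • stdEmbedding hq b a c z :=
  LinearMap.congr_fun (braiding_comp_stdEmbedding hq a b c) z

theorem braiding_map_id {W W' : Type*} [AddCommGroup W] [Module ℂ W] [AddCommGroup W']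
    [Module ℂ W'] (a : ℕ) {σ : UqRep q W} {σ' : UqRep q W'} {Φ : W →ₗ[ℂ] W'}
    (h : UqRep.IsIntertwining σ σ' Φ) (y : Spin a ⊗[ℂ] W) :
    braiding q a σ' (TensorProduct.map LinearMap.id Φ y) =
      TensorProduct.map Φ LinearMap.id (braiding q a σ y) :=
  LinearMap.congr_fun (braiding_natural a h) y

/-- Naturality pulls the crossing back to `V₁` and the single irreducible of spin x/2, where it is a
scalar. What remains is coupled as ((2 p) 1) and is recoupled to (2 (p 1)). -/
theorem fullBraiding_rightMap (n₁ n₂ n₃ n₆ n₉ x p : ℕ) (z : Spin n₉) :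
    fullBraiding hq n₁ n₂ n₃ n₆ (TensorProduct.map LinearMap.id (rightMap hq n₂ n₆ n₃ p x)
      (stdEmbedding hq n₁ x n₉ z)) =
    ∑ r ∈ Finset.range (p + n₁ + 1) with Triad p n₁ r ∧ Triad n₂ r n₉,
      (braidEigenvalue q n₁ x n₉ * racah hq n₂ p n₁ x n₉ r) •
        targetTree hq n₁ n₂ n₃ n₆ n₉ p r z := by
  rw [fullBraiding, LinearMap.comp_apply, braiding_map_id n₁ (isIntertwining_rightMap hq _ _ _ _ _),
    braiding_stdEmbedding, map_smul, map_smul, rightMap, map_comp_id, LinearMap.comp_apply,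
    LinearEquiv.coe_coe, ← TensorProduct.map_map_assoc]
  have h := leftMap_apply hq n₂ p n₁ x n₉ z
  rw [leftMap, LinearMap.comp_apply, LinearMap.comp_apply, LinearEquiv.coe_coe] at h
  rw [h, map_sum, Finset.smul_sum]
  refine Finset.sum_congr rfl fun r _ => ?_
  rw [map_smul, smul_smul]
  rfl

/-- First evaluation: recouple ((1 5) 3) to (1 (5 3)), then ((2 6) 3) to (2 (6 3)), and only then
cross. -/
theorem fullBraiding_sourceTree (n₁ n₂ n₃ n₄ n₅ n₆ n₉ : ℕ) (z : Spin n₉) :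
    fullBraiding hq n₁ n₂ n₃ n₆ (sourceTree hq n₁ n₂ n₃ n₄ n₅ n₆ n₉ z) =
    ∑ x ∈ Finset.range (n₅ + n₃ + 1) with Triad n₅ n₃ x ∧ Triad n₁ x n₉,
      ∑ p ∈ Finset.range (n₆ + n₃ + 1) with Triad n₆ n₃ p ∧ Triad n₂ p x,
        ∑ r ∈ Finset.range (p + n₁ + 1) with Triad p n₁ r ∧ Triad n₂ r n₉,
          (racah hq n₁ n₅ n₃ n₄ n₉ x * racah hq n₂ n₆ n₃ n₅ x p *
            braidEigenvalue q n₁ x n₉ * racah hq n₂ p n₁ x n₉ r) •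
              targetTree hq n₁ n₂ n₃ n₆ n₉ p r z := by
  rw [sourceTree, LinearMap.comp_apply, leftMap_apply, map_sum, map_sum]
  refine Finset.sum_congr rfl fun x _ => ?_
  have h : TensorProduct.map LinearMap.id
      ((TensorProduct.assoc ℂ (Spin n₂) (Spin n₆) (Spin n₃)).toLinearMap ∘ₗ
        TensorProduct.map (stdEmbedding hq n₂ n₆ n₅) LinearMap.id) (rightMap hq n₁ n₅ n₃ x n₉ z) =
      TensorProduct.map LinearMap.id (leftMap hq n₂ n₆ n₃ n₅ x) (stdEmbedding hq n₁ x n₉ z) := by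
    rw [rightMap, LinearMap.comp_apply, ← LinearMap.comp_apply (TensorProduct.map _ _),
      ← map_id_comp]
    rfl
  rw [map_smul, map_smul, h, map_id_leftMap_apply, map_sum, Finset.smul_sum]
  refine Finset.sum_congr rfl fun p _ => ?_
  rw [map_smul, fullBraiding_rightMap, smul_smul, Finset.smul_sum]
  refine Finset.sum_congr rfl fun r _ => ?_
  rw [smul_smul, mul_assoc (_ * _)]

/-- The same embedding regrouped so that factor 3 stands outside the first three; `V₁` can then
cross `V₂` before the coupling with factor 3 is changed. -/
theorem sourceTree_apply (n₁ n₂ n₃ n₄ n₅ n₆ n₉ : ℕ) (z : Spin n₉) :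
    sourceTree hq n₁ n₂ n₃ n₄ n₅ n₆ n₉ z =
      TensorProduct.assoc ℂ _ _ _ (TensorProduct.assoc ℂ _ _ _
        (TensorProduct.map ((TensorProduct.assoc ℂ (Spin n₁) (Spin n₂) (Spin n₆)).symm.toLinearMap ∘ₗ
          TensorProduct.map LinearMap.id (stdEmbedding hq n₂ n₆ n₅) ∘ₗ stdEmbedding hq n₁ n₅ n₄)
          LinearMap.id (stdEmbedding hq n₄ n₃ n₉ z))) := by
  rw [tensor_pentagon, map_comp_id, LinearMap.comp_apply,
    ← LinearMap.comp_apply (TensorProduct.map _ LinearMap.id), ← map_comp_id]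
  simp only [LinearEquiv.comp_coe, LinearEquiv.symm_trans_self, LinearEquiv.refl_toLinearMap,
    TensorProduct.map_id, LinearMap.id_apply]
  rw [map_comp_id, LinearMap.comp_apply, ← TensorProduct.map_map_assoc, sourceTree,
    map_id_comp]
  rfl

/-- By the hexagon identity, crossing 2 and then 6 is crossing their product, which by naturality is
a scalar on `V₅`. -/
theorem braid_leftMap (n₁ n₂ n₆ n₅ n₄ : ℕ) :
    TensorProduct.map LinearMap.id (braiding q n₁ (irrep hq n₆)) ∘ₗ
      (TensorProduct.assoc ℂ (Spin n₂) (Spin n₁) (Spin n₆)).toLinearMap ∘ₗ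
        TensorProduct.map (braiding q n₁ (irrep hq n₂)) LinearMap.id ∘ₗ
          (TensorProduct.assoc ℂ (Spin n₁) (Spin n₂) (Spin n₆)).symm.toLinearMap ∘ₗ
          TensorProduct.map LinearMap.id (stdEmbedding hq n₂ n₆ n₅) ∘ₗ stdEmbedding hq n₁ n₅ n₄ =
    braidEigenvalue q n₁ n₅ n₄ • leftMap hq n₂ n₆ n₁ n₅ n₄ := by
  refine LinearMap.ext fun z => ?_
  have h := LinearMap.congr_fun (braiding_tensor hq n₁ (irrep hq n₂) (irrep hq n₆))
    ((TensorProduct.assoc ℂ (Spin n₁) (Spin n₂) (Spin n₆)).symm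
      (TensorProduct.map LinearMap.id (stdEmbedding hq n₂ n₆ n₅) (stdEmbedding hq n₁ n₅ n₄ z)))
  simp only [LinearMap.comp_apply, LinearEquiv.coe_coe, LinearEquiv.apply_symm_apply] at h ⊢
  rw [← h, braiding_map_id n₁ (isIntertwining_stdEmbedding hq n₂ n₆ n₅), braiding_stdEmbedding,
    map_smul, map_smul]
  rfl

/-- Crossing `V₂` alone is not diagonal in the coupling (2 6). Crossing `V₆` too, recoupling to (2
(6 1)) and undoing the second crossing there makes every crossing a scalar. -/
theorem partial_braid (n₁ n₂ n₆ n₅ n₄ : ℕ) :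
    (TensorProduct.assoc ℂ (Spin n₂) (Spin n₁) (Spin n₆)).toLinearMap ∘ₗ
        TensorProduct.map (braiding q n₁ (irrep hq n₂)) LinearMap.id ∘ₗ
          (TensorProduct.assoc ℂ (Spin n₁) (Spin n₂) (Spin n₆)).symm.toLinearMap ∘ₗ
          TensorProduct.map LinearMap.id (stdEmbedding hq n₂ n₆ n₅) ∘ₗ stdEmbedding hq n₁ n₅ n₄ =
    ∑ x ∈ Finset.range (n₆ + n₁ + 1) with Triad n₆ n₁ x ∧ Triad n₂ x n₄,
      (braidEigenvalue q n₁ n₅ n₄ * racah hq n₂ n₆ n₁ n₅ n₄ x *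
        (braidEigenvalue q n₁ n₆ x)⁻¹) • rightMap hq n₂ n₁ n₆ x n₄ := by
  have h := congrArg (fun A => TensorProduct.map LinearMap.id (invBraiding hq n₁ n₆) ∘ₗ A)
    (braid_leftMap hq n₁ n₂ n₆ n₅ n₄)
  rw [← LinearMap.comp_assoc, ← map_id_comp, invBraiding_comp_braiding, TensorProduct.map_id,
    LinearMap.id_comp] at h
  rw [h]
  refine LinearMap.ext fun z => ?_
  rw [LinearMap.comp_apply, LinearMap.smul_apply, leftMap_apply, map_smul, map_sum,
    Finset.smul_sum, LinearMap.sum_apply]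
  refine Finset.sum_congr rfl fun x _ => ?_
  rw [map_smul, smul_smul, rightMap, LinearMap.comp_apply,
    ← LinearMap.comp_apply (TensorProduct.map _ _), ← map_id_comp, invBraiding_comp_stdEmbedding,
    TensorProduct.map_smul_right, LinearMap.smul_apply, smul_smul]
  rfl

/-- Second evaluation: cross `V₂` by `partial_braid`, recouple ((2 x) 3) and then ((1 6) 3), and
finally cross the part coupled from 6 and 3. -/
theorem fullBraiding_sourceTree' (n₁ n₂ n₃ n₄ n₅ n₆ n₉ : ℕ) (z : Spin n₉) :
    fullBraiding hq n₁ n₂ n₃ n₆ (sourceTree hq n₁ n₂ n₃ n₄ n₅ n₆ n₉ z) =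
    ∑ x ∈ Finset.range (n₆ + n₁ + 1) with Triad n₆ n₁ x ∧ Triad n₂ x n₄,
      ∑ r ∈ Finset.range (x + n₃ + 1) with Triad x n₃ r ∧ Triad n₂ r n₉,
        ∑ p ∈ Finset.range (n₆ + n₃ + 1) with Triad n₆ n₃ p ∧ Triad n₁ p r,
          (braidEigenvalue q n₁ n₅ n₄ * racah hq n₂ n₆ n₁ n₅ n₄ x *
            (braidEigenvalue q n₁ n₆ x)⁻¹ * racah hq n₂ x n₃ n₄ n₉ r *
            racah hq n₁ n₆ n₃ x r p * braidEigenvalue q n₁ p r) •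
              targetTree hq n₁ n₂ n₃ n₆ n₉ p r z := by
  -- The second crossing, of `V₁` past `V₆ ⊗ V₃`, is a scalar once these two are coupled to spin
  -- p/2.
  have hb : ∀ p r (y : Spin n₂ ⊗[ℂ] Spin r),
      TensorProduct.map LinearMap.id
        (braiding q n₁ (UqRep.tensor hq.1 (irrep hq n₆) (irrep hq n₃)))
        (TensorProduct.map LinearMap.id (rightMap hq n₁ n₆ n₃ p r) y) =
      braidEigenvalue q n₁ p r • TensorProduct.map LinearMap.id
        (TensorProduct.map (stdEmbedding hq n₆ n₃ p) LinearMap.id ∘ₗ stdEmbedding hq p n₁ r) y := by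
    intro p r y
    rw [← LinearMap.comp_apply, ← map_id_comp, ← LinearMap.smul_apply,
      ← TensorProduct.map_smul_right]
    congr 2
    refine LinearMap.ext fun v => ?_
    rw [LinearMap.comp_apply, rightMap, LinearMap.comp_apply,
      braiding_map_id n₁ (isIntertwining_stdEmbedding hq n₆ n₃ p), braiding_stdEmbedding, map_smul]
    rfl
  have h := LinearMap.congr_fun (braiding_tensor hq n₁ (irrep hq n₂)
    (UqRep.tensor hq.1 (irrep hq n₆) (irrep hq n₃)))
  simp only [LinearMap.comp_apply, LinearEquiv.coe_coe] at h
  rw [fullBraiding, LinearMap.comp_apply, sourceTree_apply, LinearEquiv.coe_coe, h]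
  have h2 : ∀ y : ((Spin n₁ ⊗[ℂ] Spin n₂) ⊗[ℂ] Spin n₆) ⊗[ℂ] Spin n₃,
      TensorProduct.map (braiding q n₁ (irrep hq n₂)) LinearMap.id
        (TensorProduct.assoc ℂ _ _ _ y) =
      TensorProduct.assoc ℂ _ _ _ (TensorProduct.map
        (TensorProduct.map (braiding q n₁ (irrep hq n₂)) LinearMap.id) LinearMap.id y) := by
    intro y
    rw [← TensorProduct.map_map_assoc, TensorProduct.map_id]
  rw [h2, tensor_pentagon, ← LinearMap.comp_apply (TensorProduct.map _ LinearMap.id),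
    ← map_comp_id, ← LinearMap.comp_apply (TensorProduct.map _ LinearMap.id),
    ← map_comp_id, LinearMap.comp_assoc, partial_braid, map_sum_smul_id, LinearMap.sum_apply,
    map_sum, map_sum, map_sum]
  refine Finset.sum_congr rfl fun x _ => ?_
  rw [LinearMap.smul_apply, map_smul, map_smul, map_smul, rightMap, map_comp_id,
    LinearMap.comp_apply, ← TensorProduct.map_map_assoc]
  have h3 := leftMap_apply hq n₂ x n₃ n₄ n₉ z
  rw [leftMap, LinearMap.comp_apply, LinearMap.comp_apply, LinearEquiv.coe_coe] at h3
  rw [h3, ← LinearMap.comp_apply (TensorProduct.map LinearMap.id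
    (TensorProduct.assoc ℂ (Spin n₁) (Spin n₆) (Spin n₃)).toLinearMap), ← map_id_comp, map_sum,
    map_sum, Finset.smul_sum]
  refine Finset.sum_congr rfl fun r _ => ?_
  have h4 : TensorProduct.map LinearMap.id
      ((TensorProduct.assoc ℂ (Spin n₁) (Spin n₆) (Spin n₃)).toLinearMap ∘ₗ
        TensorProduct.map (stdEmbedding hq n₁ n₆ x) LinearMap.id) (rightMap hq n₂ x n₃ r n₉ z) =
      TensorProduct.map LinearMap.id (leftMap hq n₁ n₆ n₃ x r) (stdEmbedding hq n₂ r n₉ z) := by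
    rw [rightMap, LinearMap.comp_apply, ← LinearMap.comp_apply (TensorProduct.map _ _),
      ← map_id_comp]
    rfl
  rw [map_smul, h4, map_smul, smul_smul, map_id_leftMap_apply, map_sum, Finset.smul_sum]
  refine Finset.sum_congr rfl fun p _ => ?_
  rw [map_smul, hb, smul_smul, smul_smul, targetTree, rightMap, map_id_comp]
  rfl

/-! ### Comparing coefficients of the two evaluations -/

/-- The coefficient of `targetTree` in a vector. -/
def targetProj (n₁ n₂ n₃ n₆ n₇ n₈ n₉ : ℕ) :
    Spin n₂ ⊗[ℂ] ((Spin n₆ ⊗[ℂ] Spin n₃) ⊗[ℂ] Spin n₁) →ₗ[ℂ] Spin n₉ :=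
  stdProj hq n₂ n₈ n₉ ∘ₗ TensorProduct.map LinearMap.id
    (stdProj hq n₇ n₁ n₈ ∘ₗ TensorProduct.map (stdProj hq n₆ n₃ n₇) LinearMap.id)

/-- Orthogonality of the coupled copies: a mismatch in p or r meets a projection onto a different
spin and gives zero. Applied to both evaluations, this isolates the component with p = n₇ and r =
n₈. -/
theorem targetProj_targetTree {n₁ n₂ n₃ n₆ n₇ n₈ n₉ : ℕ} (h178 : Triad n₇ n₁ n₈)
    (h289 : Triad n₂ n₈ n₉) (h367 : Triad n₆ n₃ n₇) (p r : ℕ) (z : Spin n₉) :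
    targetProj hq n₁ n₂ n₃ n₆ n₇ n₈ n₉ (targetTree hq n₁ n₂ n₃ n₆ n₉ p r z) =
      if p = n₇ then (if r = n₈ then z else 0) else 0 := by
  have h : targetProj hq n₁ n₂ n₃ n₆ n₇ n₈ n₉ (targetTree hq n₁ n₂ n₃ n₆ n₉ p r z) =
      stdProj hq n₂ n₈ n₉ (TensorProduct.map LinearMap.id (stdProj hq n₇ n₁ n₈ ∘ₗ
        TensorProduct.map (stdProj hq n₆ n₃ n₇ ∘ₗ stdEmbedding hq n₆ n₃ p) LinearMap.id ∘ₗ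
          stdEmbedding hq p n₁ r) (stdEmbedding hq n₂ r n₉ z)) := by
    simp only [targetProj, targetTree, rightMap, map_id_comp, map_comp_id, LinearMap.comp_apply]
  rw [h]
  split_ifs with hp hr
  · subst hp hr
    rw [stdProj_comp_stdEmbedding hq h367, TensorProduct.map_id, LinearMap.id_comp,
      stdProj_comp_stdEmbedding hq h178, TensorProduct.map_id, LinearMap.id_apply,
      ← LinearMap.comp_apply, stdProj_comp_stdEmbedding hq h289, LinearMap.id_apply]
  · subst hp
    rw [stdProj_comp_stdEmbedding hq h367, TensorProduct.map_id, LinearMap.id_comp,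
      stdProj_comp_stdEmbedding_of_ne hq hr, TensorProduct.map_zero_right, LinearMap.zero_apply,
      map_zero]
  · rw [stdProj_comp_stdEmbedding_of_ne hq hp, TensorProduct.map_zero_left, LinearMap.zero_comp,
      LinearMap.comp_zero, TensorProduct.map_zero_right, LinearMap.zero_apply, map_zero]

theorem sum_sum_eq_ite {M : Type*} [AddCommMonoid M] (A : Finset ℕ) (B : ℕ → Finset ℕ)
    (g : ℕ → ℕ → M) {P R : ℕ} (h : ∀ p r, ¬ (p = P ∧ r = R) → g p r = 0) :
    ∑ p ∈ A, ∑ r ∈ B p, g p r = if P ∈ A ∧ R ∈ B P then g P R else 0 := by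
  split_ifs with hPR
  · rw [Finset.sum_eq_single_of_mem P hPR.1, Finset.sum_eq_single_of_mem R hPR.2]
    · exact fun r _ hr => h _ _ fun hh => hr hh.2
    · exact fun p _ hp => Finset.sum_eq_zero fun r _ => h _ _ fun hh => hp hh.1
  · refine Finset.sum_eq_zero fun p hp => Finset.sum_eq_zero fun r hr => h _ _ ?_
    rintro ⟨rfl, rfl⟩
    exact hPR ⟨hp, hr⟩

/-- The Yang–Baxter identity in terms of Racah coefficients and braiding eigenvalues. -/
theorem racah_yangBaxter {n₁ n₂ n₃ n₄ n₅ n₆ n₇ n₈ n₉ : ℕ} (h178 : Triad n₇ n₁ n₈)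
    (h289 : Triad n₂ n₈ n₉) (h367 : Triad n₆ n₃ n₇) :
    ∑ x ∈ Finset.range (n₁ + n₉ + 1) with Triad n₁ n₉ x ∧ Triad n₂ n₇ x ∧ Triad n₃ n₅ x,
      racah hq n₁ n₅ n₃ n₄ n₉ x * racah hq n₂ n₆ n₃ n₅ x n₇ *
        braidEigenvalue q n₁ x n₉ * racah hq n₂ n₇ n₁ x n₉ n₈ =
    ∑ x ∈ Finset.range (n₁ + n₆ + 1) with Triad n₁ n₆ x ∧ Triad n₂ n₄ x ∧ Triad n₃ n₈ x,
      braidEigenvalue q n₁ n₅ n₄ * racah hq n₂ n₆ n₁ n₅ n₄ x *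
        (braidEigenvalue q n₁ n₆ x)⁻¹ * racah hq n₂ x n₃ n₄ n₉ n₈ *
        racah hq n₁ n₆ n₃ x n₈ n₇ * braidEigenvalue q n₁ n₇ n₈ := by
  have h := (fullBraiding_sourceTree hq n₁ n₂ n₃ n₄ n₅ n₆ n₉ (xVec n₉ 0)).symm.trans
    (fullBraiding_sourceTree' hq n₁ n₂ n₃ n₄ n₅ n₆ n₉ (xVec n₉ 0))
  have h' := congrArg (fun v => targetProj hq n₁ n₂ n₃ n₆ n₇ n₈ n₉ v 0) h
  have hz : ∀ p r, ¬ (p = n₇ ∧ r = n₈) → targetProj hq n₁ n₂ n₃ n₆ n₇ n₈ n₉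
      (targetTree hq n₁ n₂ n₃ n₆ n₉ p r (xVec n₉ 0)) 0 = 0 := by
    intro p r hpr
    rw [targetProj_targetTree hq h178 h289 h367]
    split_ifs with h1 h2
    · exact absurd ⟨h1, h2⟩ hpr
    · rfl
    · rfl
  have h1 : targetProj hq n₁ n₂ n₃ n₆ n₇ n₈ n₉
      (targetTree hq n₁ n₂ n₃ n₆ n₉ n₇ n₈ (xVec n₉ 0)) 0 = 1 := by
    rw [targetProj_targetTree hq h178 h289 h367, if_pos rfl, if_pos rfl]
    simp [xVec]
  simp only [map_sum, map_smul, Finset.sum_apply, Pi.smul_apply, smul_eq_mul] at h'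
  have e1 := fun x => sum_sum_eq_ite
    ((Finset.range (n₆ + n₃ + 1)).filter fun p => Triad n₆ n₃ p ∧ Triad n₂ p x)
    (fun p => (Finset.range (p + n₁ + 1)).filter fun r => Triad p n₁ r ∧ Triad n₂ r n₉)
    (fun p r => racah hq n₁ n₅ n₃ n₄ n₉ x * racah hq n₂ n₆ n₃ n₅ x p *
      braidEigenvalue q n₁ x n₉ * racah hq n₂ p n₁ x n₉ r *
      targetProj hq n₁ n₂ n₃ n₆ n₇ n₈ n₉ (targetTree hq n₁ n₂ n₃ n₆ n₉ p r (xVec n₉ 0)) 0)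
    (P := n₇) (R := n₈) (fun p r hpr => by simp only [hz p r hpr, mul_zero])
  have e2 := fun x => sum_sum_eq_ite
    ((Finset.range (x + n₃ + 1)).filter fun r => Triad x n₃ r ∧ Triad n₂ r n₉)
    (fun r => (Finset.range (n₆ + n₃ + 1)).filter fun p => Triad n₆ n₃ p ∧ Triad n₁ p r)
    (fun r p => braidEigenvalue q n₁ n₅ n₄ * racah hq n₂ n₆ n₁ n₅ n₄ x *
      (braidEigenvalue q n₁ n₆ x)⁻¹ * racah hq n₂ x n₃ n₄ n₉ r *
      racah hq n₁ n₆ n₃ x r p * braidEigenvalue q n₁ p r *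
      targetProj hq n₁ n₂ n₃ n₆ n₇ n₈ n₉ (targetTree hq n₁ n₂ n₃ n₆ n₉ p r (xVec n₉ 0)) 0)
    (P := n₈) (R := n₇) (fun r p hpr => by simp only [hz p r fun hh => hpr hh.symm, mul_zero])
  simp only [e1, e2, h1, mul_one] at h'
  rw [← Finset.sum_filter, ← Finset.sum_filter] at h'
  refine Eq.trans (Finset.sum_congr ?_ fun _ _ => rfl)
    (h'.trans (Finset.sum_congr ?_ fun _ _ => rfl))
  -- The two index sets agree: the range bounds follow from the triangle conditions, and those not
  -- involving x are the hypotheses.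
  · ext x
    simp only [Triad, Nat.even_iff, Finset.mem_filter, Finset.mem_range] at h178 h289 h367 ⊢
    omega
  · ext x
    simp only [Triad, Nat.even_iff, Finset.mem_filter, Finset.mem_range] at h178 h289 h367 ⊢
    omega

/-! ### Signs and normalization of the 6j symbols -/

theorem neg_one_pow_congr_mod {m n : ℕ} (h : m % 2 = n % 2) : (-1 : ℂ) ^ m = (-1) ^ n := by
  rw [neg_one_pow_eq_pow_mod_two, h, ← neg_one_pow_eq_pow_mod_two]

theorem inv_neg_one_pow (m : ℕ) : ((-1 : ℂ) ^ m)⁻¹ = (-1) ^ m := by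
  rw [← inv_pow]
  norm_num

/-- `[n+1]_q^{-1/2}`. -/
def invSqrtDim (q : ℝ) (n : ℕ) : ℝ := qNum q ((n : ℝ) + 1) ^ (-(1 : ℝ) / 2)

theorem qNum_mul_invSqrtDim_sq {q : ℝ} (hq : q ∈ Set.Ioo (0 : ℝ) 1) (n : ℕ) :
    qNum q ((n : ℝ) + 1) * (invSqrtDim q n * invSqrtDim q n) = 1 := by
  have h : 0 < qNum q ((n : ℝ) + 1) := qNum_pos hq (by positivity)
  rw [invSqrtDim, ← Real.rpow_add h, show -(1 : ℝ) / 2 + -(1 : ℝ) / 2 = -1 by norm_num,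
    Real.rpow_neg_one, mul_inv_cancel₀ h.ne']

theorem sixJ_eq {q : ℝ} (hq : q ∈ Set.Ioo (0 : ℝ) 1) (a b c d n p : ℕ) :
    sixJ hq a b c d n p = (-1) ^ ((b + d + n + a) / 2) *
      ((invSqrtDim q p : ℂ) * (invSqrtDim q c : ℂ)) * racah hq a b d c n p := by
  rw [sixJ, Real.mul_rpow (qNum_pos hq (by positivity)).le (qNum_pos hq (by positivity)).le,
    Complex.ofReal_mul]
  rfl

/-- The factor relating the sums of products of `6j` symbols to the matrix elements of the
braiding. -/
def yangBaxterFactor (q : ℝ) (n₁ n₂ n₃ n₄ n₅ n₆ n₇ n₈ n₉ : ℕ) : ℂ :=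
  (-1) ^ (n₁ + n₉ + (n₁ + 2 * n₂ + 2 * n₃ + n₅ + n₆ + n₇ + 3 * n₉) / 2) *
    ((q ^ (-(casimir n₉ - casimir n₁ + casimir n₈ + casimir n₆ + casimir n₄) / 2) : ℝ) : ℂ) *
    (invSqrtDim q n₈ * invSqrtDim q n₇ * invSqrtDim q n₅ * invSqrtDim q n₄ : ℂ)

theorem Triad.exists_half {a b c : ℕ} (h : Triad a b c) : ∃ m, a + b + c = 2 * m := by
  obtain ⟨_, _, _, m, hm⟩ := h
  exact ⟨m, by omega⟩

/-- All the halved sums are even by the triangle conditions, so the division is exact. Adding the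
three half-sums from the 6j symbols gives the fixed half-sum plus the eigenvalue exponent, and x ≡
n₁ + n₉ mod 2. -/
theorem left_sign {n₁ n₂ n₃ n₄ n₅ n₆ n₇ n₈ n₉ x : ℕ}
    (h145 : Triad n₁ n₄ n₅) (h178 : Triad n₁ n₇ n₈)
    (h289 : Triad n₂ n₈ n₉) (h367 : Triad n₃ n₆ n₇) (h349 : Triad n₃ n₄ n₉)
    (hx1 : Triad n₁ n₉ x) (hx2 : Triad n₂ n₇ x) :
    (x + (n₇ + n₁ + n₉ + n₂) / 2 + (n₆ + n₃ + x + n₂) / 2 + (n₅ + n₃ + n₉ + n₁) / 2) % 2 =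
      (n₁ + n₉ + (n₁ + 2 * n₂ + 2 * n₃ + n₅ + n₆ + n₇ + 3 * n₉) / 2 + (n₁ + x - n₉) / 2) % 2 := by
  -- Guarantees n₉ ≤ n₁ + x, so the truncated subtraction in the eigenvalue exponent is a genuine
  -- one.
  have i1 := hx1.2.1
  obtain ⟨m1, e1⟩ := h145.exists_half
  obtain ⟨m2, e2⟩ := h178.exists_half
  obtain ⟨m4, e4⟩ := h289.exists_half
  obtain ⟨m5, e5⟩ := h367.exists_half
  obtain ⟨m6, e6⟩ := h349.exists_half
  obtain ⟨m7, e7⟩ := hx1.exists_half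
  obtain ⟨m8, e8⟩ := hx2.exists_half
  clear h145 h178 h289 h367 h349 hx1 hx2
  obtain ⟨u₁, f1⟩ : ∃ u, n₇ + n₁ + n₉ + n₂ = 2 * u :=
    ⟨(n₇ + n₁ + n₉ + n₂) / 2, by clear e1 e5 e6 e7 e8 i1; omega⟩
  obtain ⟨u₂, f2⟩ : ∃ u, n₆ + n₃ + x + n₂ = 2 * u :=
    ⟨(n₆ + n₃ + x + n₂) / 2, by clear e1 e2 e4 e6 e7 i1 f1; omega⟩
  obtain ⟨u₃, f3⟩ : ∃ u, n₅ + n₃ + n₉ + n₁ = 2 * u :=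
    ⟨(n₅ + n₃ + n₉ + n₁) / 2, by clear e2 e4 e5 e7 e8 i1 f1 f2; omega⟩
  obtain ⟨u₅, f5⟩ : ∃ u, n₁ + x = n₉ + 2 * u :=
    ⟨(n₁ + x - n₉) / 2, by clear e1 e2 e4 e5 e6 e8 f1 f2 f3; omega⟩
  clear e1 e2 e4 e5 e6 e8 i1
  have f4 : n₁ + 2 * n₂ + 2 * n₃ + n₅ + n₆ + n₇ + 3 * n₉ + 2 * u₅ = 2 * (u₁ + u₂ + u₃) := by
    linarith
  have f4' : (n₁ + 2 * n₂ + 2 * n₃ + n₅ + n₆ + n₇ + 3 * n₉) / 2 + u₅ = u₁ + u₂ + u₃ := by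
    clear f1 f2 f3 f5 e7; omega
  have g5 : (n₁ + x - n₉) / 2 = u₅ := by clear f1 f2 f3 f4 f4' e7; omega
  rw [f1, f2, f3, g5, Nat.mul_div_cancel_left _ two_pos, Nat.mul_div_cancel_left _ two_pos,
    Nat.mul_div_cancel_left _ two_pos, add_assoc (n₁ + n₉), f4']
  clear f1 f2 f3 f4 f4' f5 g5
  omega

theorem right_sign {n₁ n₂ n₃ n₄ n₅ n₆ n₇ n₈ n₉ x : ℕ}
    (h145 : Triad n₁ n₄ n₅) (h178 : Triad n₁ n₇ n₈) (h256 : Triad n₂ n₅ n₆)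
    (h289 : Triad n₂ n₈ n₉) (h367 : Triad n₃ n₆ n₇)
    (hx1 : Triad n₁ n₆ x) (hx3 : Triad n₃ n₈ x) :
    (x + (n₆ + n₃ + n₈ + n₁) / 2 + (x + n₃ + n₉ + n₂) / 2 + (n₆ + n₁ + n₄ + n₂) / 2) % 2 =
      (n₁ + n₉ + (n₁ + 2 * n₂ + 2 * n₃ + n₅ + n₆ + n₇ + 3 * n₉) / 2 + (n₁ + n₅ - n₄) / 2 +
        (n₁ + n₆ - x) / 2 + (n₁ + n₇ - n₈) / 2) % 2 := by
  have i1 := h145.2.1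
  have i2 := hx1.2.2.1
  have i3 := h178.2.2.1
  obtain ⟨m1, e1⟩ := h145.exists_half
  obtain ⟨m2, e2⟩ := h178.exists_half
  obtain ⟨m3, e3⟩ := h256.exists_half
  obtain ⟨m4, e4⟩ := h289.exists_half
  obtain ⟨m5, e5⟩ := h367.exists_half
  obtain ⟨m6, e6⟩ := hx1.exists_half
  obtain ⟨m7, e7⟩ := hx3.exists_half
  clear h145 h178 h256 h289 h367 hx1 hx3
  obtain ⟨v₁, f1⟩ : ∃ u, n₆ + n₃ + n₈ + n₁ = 2 * u :=
    ⟨(n₆ + n₃ + n₈ + n₁) / 2, by clear e1 e3 e4 e6 e7 i1 i2 i3; omega⟩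
  obtain ⟨v₂, f2⟩ : ∃ u, x + n₃ + n₉ + n₂ = 2 * u :=
    ⟨(x + n₃ + n₉ + n₂) / 2, by clear e1 e2 e3 e5 e6 i1 i2 i3 f1; omega⟩
  obtain ⟨v₃, f3⟩ : ∃ u, n₆ + n₁ + n₄ + n₂ = 2 * u :=
    ⟨(n₆ + n₁ + n₄ + n₂) / 2, by clear e2 e4 e5 e6 e7 i1 i2 i3 f1 f2; omega⟩
  obtain ⟨v₅, f5⟩ : ∃ u, n₁ + n₅ = n₄ + 2 * u :=
    ⟨(n₁ + n₅ - n₄) / 2, by clear e2 e3 e4 e5 e6 e7 i2 i3 f1 f2 f3; omega⟩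
  obtain ⟨v₆, f6⟩ : ∃ u, n₁ + n₆ = x + 2 * u :=
    ⟨(n₁ + n₆ - x) / 2, by clear e1 e2 e3 e4 e5 e7 i1 i3 f1 f2 f3 f5; omega⟩
  obtain ⟨v₇, f7⟩ : ∃ u, n₁ + n₇ = n₈ + 2 * u :=
    ⟨(n₁ + n₇ - n₈) / 2, by clear e1 e3 e4 e5 e6 e7 i1 i2 f1 f2 f3 f5 f6; omega⟩
  clear e1 e2 e3 e4 e5 e6 e7 i1 i2 i3
  have f4 : n₁ + 2 * n₂ + 2 * n₃ + n₅ + n₆ + n₇ + 3 * n₉ + 2 * (x + n₁ + v₆) =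
      2 * (v₁ + v₂ + v₃ + v₅ + v₇ + n₉) := by
    linarith
  have f4' : (n₁ + 2 * n₂ + 2 * n₃ + n₅ + n₆ + n₇ + 3 * n₉) / 2 + (x + n₁ + v₆) =
      v₁ + v₂ + v₃ + v₅ + v₇ + n₉ := by
    clear f1 f2 f3 f5 f6 f7; omega
  rw [f1, f2, f3, Nat.sub_eq_of_eq_add' f5, Nat.sub_eq_of_eq_add' f6, Nat.sub_eq_of_eq_add' f7]
  simp only [Nat.mul_div_cancel_left _ two_pos]
  generalize (n₁ + 2 * n₂ + 2 * n₃ + n₅ + n₆ + n₇ + 3 * n₉) / 2 = D at f4' ⊢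
  clear f1 f2 f3 f4 f5 f6 f7
  omega

/-- The spin x occurs in the normalization of two of the three symbols, which cancels its
q-dimension. Its sign and its Casimir power are absorbed by the braiding eigenvalue, up to factors
independent of x. -/
theorem left_summand_eq {q : ℝ} (hq : q ∈ Set.Ioo (0 : ℝ) 1) {n₁ n₂ n₃ n₄ n₅ n₆ n₇ n₈ n₉ x : ℕ}
    (h145 : Triad n₁ n₄ n₅) (h178 : Triad n₁ n₇ n₈)
    (h289 : Triad n₂ n₈ n₉) (h367 : Triad n₃ n₆ n₇) (h349 : Triad n₃ n₄ n₉)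
    (hx1 : Triad n₁ n₉ x) (hx2 : Triad n₂ n₇ x) :
    (-1 : ℂ) ^ x * ((qNum q ((x : ℝ) + 1) : ℝ) : ℂ) *
        ((q ^ (-(casimir x + casimir n₈ + casimir n₆ + casimir n₄) / 2) : ℝ) : ℂ) *
        sixJ hq n₂ n₇ x n₁ n₉ n₈ * sixJ hq n₂ n₆ n₅ n₃ x n₇ * sixJ hq n₁ n₅ n₄ n₃ n₉ x =
      yangBaxterFactor q n₁ n₂ n₃ n₄ n₅ n₆ n₇ n₈ n₉ *
        (racah hq n₁ n₅ n₃ n₄ n₉ x * racah hq n₂ n₆ n₃ n₅ x n₇ *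
          braidEigenvalue q n₁ x n₉ * racah hq n₂ n₇ n₁ x n₉ n₈) := by
  have hs : (-1 : ℂ) ^ x * (-1) ^ ((n₇ + n₁ + n₉ + n₂) / 2) * (-1) ^ ((n₆ + n₃ + x + n₂) / 2) *
      (-1) ^ ((n₅ + n₃ + n₉ + n₁) / 2) =
      (-1) ^ (n₁ + n₉ + (n₁ + 2 * n₂ + 2 * n₃ + n₅ + n₆ + n₇ + 3 * n₉) / 2) *
        (-1) ^ ((n₁ + x - n₉) / 2) := by
    rw [← pow_add, ← pow_add, ← pow_add, ← pow_add]
    exact neg_one_pow_congr_mod (left_sign h145 h178 h289 h367 h349 hx1 hx2)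
  have hc : q ^ (-(casimir x + casimir n₈ + casimir n₆ + casimir n₄) / 2) =
      q ^ (-(casimir n₉ - casimir n₁ + casimir n₈ + casimir n₆ + casimir n₄) / 2) *
        q ^ ((casimir n₉ - casimir n₁ - casimir x) / 2) := by
    rw [← Real.rpow_add hq.1]
    ring_nf
  have hd : ((qNum q ((x : ℝ) + 1) : ℝ) : ℂ) * (invSqrtDim q x * invSqrtDim q x) = 1 := by
    exact_mod_cast qNum_mul_invSqrtDim_sq hq x
  rw [sixJ_eq, sixJ_eq, sixJ_eq, hc, yangBaxterFactor, braidEigenvalue, Complex.ofReal_mul]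
  generalize ((qNum q ((x : ℝ) + 1) : ℝ) : ℂ) = N at *
  generalize ((q ^ ((casimir n₉ - casimir n₁ - casimir x) / 2) : ℝ) : ℂ) = Q
  generalize ((q ^ (-(casimir n₉ - casimir n₁ + casimir n₈ + casimir n₆ + casimir n₄) / 2) : ℝ) : ℂ)
    = Q'
  calc _ = ((-1 : ℂ) ^ x * (-1) ^ ((n₇ + n₁ + n₉ + n₂) / 2) * (-1) ^ ((n₆ + n₃ + x + n₂) / 2) *
      (-1) ^ ((n₅ + n₃ + n₉ + n₁) / 2)) * (N * (invSqrtDim q x * invSqrtDim q x)) *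
      (Q' * Q * (invSqrtDim q n₈ * invSqrtDim q n₇ * invSqrtDim q n₅ * invSqrtDim q n₄) *
        (racah hq n₁ n₅ n₃ n₄ n₉ x * racah hq n₂ n₆ n₃ n₅ x n₇ * racah hq n₂ n₇ n₁ x n₉ n₈)) := by
        ring
    _ = _ := by
        rw [hs, hd]
        ring

/-- The same cancellation with three eigenvalues, one of them inverted. The inverse does not affect
its sign, and in the combined exponent the Casimirs of n₁, n₄, n₆ and n₈ drop out against those in
`yangBaxterFactor`. -/
theorem right_summand_eq {q : ℝ} (hq : q ∈ Set.Ioo (0 : ℝ) 1) {n₁ n₂ n₃ n₄ n₅ n₆ n₇ n₈ n₉ x : ℕ}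
    (h145 : Triad n₁ n₄ n₅) (h178 : Triad n₁ n₇ n₈) (h256 : Triad n₂ n₅ n₆)
    (h289 : Triad n₂ n₈ n₉) (h367 : Triad n₃ n₆ n₇)
    (hx1 : Triad n₁ n₆ x) (hx3 : Triad n₃ n₈ x) :
    (-1 : ℂ) ^ x * ((qNum q ((x : ℝ) + 1) : ℝ) : ℂ) *
        ((q ^ (-(casimir x + casimir n₇ + casimir n₉ + casimir n₅) / 2) : ℝ) : ℂ) *
        sixJ hq n₁ n₆ x n₃ n₈ n₇ * sixJ hq n₂ x n₄ n₃ n₉ n₈ * sixJ hq n₂ n₆ n₅ n₁ n₄ x =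
      yangBaxterFactor q n₁ n₂ n₃ n₄ n₅ n₆ n₇ n₈ n₉ *
        (braidEigenvalue q n₁ n₅ n₄ * racah hq n₂ n₆ n₁ n₅ n₄ x *
          (braidEigenvalue q n₁ n₆ x)⁻¹ * racah hq n₂ x n₃ n₄ n₉ n₈ *
          racah hq n₁ n₆ n₃ x n₈ n₇ * braidEigenvalue q n₁ n₇ n₈) := by
  have hs : (-1 : ℂ) ^ x * (-1) ^ ((n₆ + n₃ + n₈ + n₁) / 2) * (-1) ^ ((x + n₃ + n₉ + n₂) / 2) *
      (-1) ^ ((n₆ + n₁ + n₄ + n₂) / 2) =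
      (-1) ^ (n₁ + n₉ + (n₁ + 2 * n₂ + 2 * n₃ + n₅ + n₆ + n₇ + 3 * n₉) / 2) *
        (-1) ^ ((n₁ + n₅ - n₄) / 2) * (-1) ^ ((n₁ + n₆ - x) / 2) * (-1) ^ ((n₁ + n₇ - n₈) / 2) := by
    rw [← pow_add, ← pow_add, ← pow_add, ← pow_add, ← pow_add, ← pow_add]
    exact neg_one_pow_congr_mod (right_sign h145 h178 h256 h289 h367 hx1 hx3)
  have hc : q ^ (-(casimir x + casimir n₇ + casimir n₉ + casimir n₅) / 2) =
      q ^ (-(casimir n₉ - casimir n₁ + casimir n₈ + casimir n₆ + casimir n₄) / 2) *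
        q ^ ((casimir n₄ - casimir n₁ - casimir n₅) / 2) *
        (q ^ ((casimir x - casimir n₁ - casimir n₆) / 2))⁻¹ *
        q ^ ((casimir n₈ - casimir n₁ - casimir n₇) / 2) := by
    rw [← Real.rpow_neg hq.1.le, ← Real.rpow_add hq.1, ← Real.rpow_add hq.1, ← Real.rpow_add hq.1]
    ring_nf
  have hd : ((qNum q ((x : ℝ) + 1) : ℝ) : ℂ) * (invSqrtDim q x * invSqrtDim q x) = 1 := by
    exact_mod_cast qNum_mul_invSqrtDim_sq hq x
  rw [sixJ_eq, sixJ_eq, sixJ_eq, hc, yangBaxterFactor, braidEigenvalue, braidEigenvalue,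
    braidEigenvalue, mul_inv, inv_neg_one_pow, Complex.ofReal_mul, Complex.ofReal_mul,
    Complex.ofReal_mul, Complex.ofReal_inv]
  generalize ((qNum q ((x : ℝ) + 1) : ℝ) : ℂ) = N at *
  generalize ((q ^ ((casimir n₄ - casimir n₁ - casimir n₅) / 2) : ℝ) : ℂ) = Q₁
  generalize ((q ^ ((casimir x - casimir n₁ - casimir n₆) / 2) : ℝ) : ℂ)⁻¹ = Q₂
  generalize ((q ^ ((casimir n₈ - casimir n₁ - casimir n₇) / 2) : ℝ) : ℂ) = Q₃
  generalize ((q ^ (-(casimir n₉ - casimir n₁ + casimir n₈ + casimir n₆ + casimir n₄) / 2) : ℝ) : ℂ)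
    = Q'
  calc _ = ((-1 : ℂ) ^ x * (-1) ^ ((n₆ + n₃ + n₈ + n₁) / 2) * (-1) ^ ((x + n₃ + n₉ + n₂) / 2) *
      (-1) ^ ((n₆ + n₁ + n₄ + n₂) / 2)) * (N * (invSqrtDim q x * invSqrtDim q x)) *
      (Q' * Q₁ * Q₂ * Q₃ *
        (invSqrtDim q n₈ * invSqrtDim q n₇ * invSqrtDim q n₅ * invSqrtDim q n₄) *
        (racah hq n₂ n₆ n₁ n₅ n₄ x * racah hq n₂ x n₃ n₄ n₉ n₈ * racah hq n₁ n₆ n₃ x n₈ n₇)) := by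
        ring
    _ = _ := by
        rw [hs, hd]
        ring

end QSixJ

end

/-- The Yang–Baxter (IRF) identity for `q`-`6j` symbols. The spins are `jᵢ = nᵢ / 2`; the summation
variable `x` is `2 j₁₀`. -/
theorem mainTheorem12 {q : ℝ} (hq : q ∈ Set.Ioo (0 : ℝ) 1) (n₁ n₂ n₃ n₄ n₅ n₆ n₇ n₈ n₉ : ℕ)
    (h145 : QSixJ.Triad n₁ n₄ n₅) (h178 : QSixJ.Triad n₁ n₇ n₈) (h256 : QSixJ.Triad n₂ n₅ n₆)
    (h289 : QSixJ.Triad n₂ n₈ n₉) (h367 : QSixJ.Triad n₃ n₆ n₇) (h349 : QSixJ.Triad n₃ n₄ n₉) :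
    ∑ x ∈ Finset.range (n₁ + n₉ + 1) with
        QSixJ.Triad n₁ n₉ x ∧ QSixJ.Triad n₂ n₇ x ∧ QSixJ.Triad n₃ n₅ x,
      (-1 : ℂ) ^ x * ((QSixJ.qNum q ((x : ℝ) + 1) : ℝ) : ℂ) *
        ((q ^ (-(QSixJ.casimir x + QSixJ.casimir n₈ + QSixJ.casimir n₆ + QSixJ.casimir n₄) / 2) :
          ℝ) : ℂ) *
        QSixJ.sixJ hq n₂ n₇ x n₁ n₉ n₈ *
        QSixJ.sixJ hq n₂ n₆ n₅ n₃ x n₇ *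
        QSixJ.sixJ hq n₁ n₅ n₄ n₃ n₉ x =
    ∑ x ∈ Finset.range (n₁ + n₆ + 1) with
        QSixJ.Triad n₁ n₆ x ∧ QSixJ.Triad n₂ n₄ x ∧ QSixJ.Triad n₃ n₈ x,
      (-1 : ℂ) ^ x * ((QSixJ.qNum q ((x : ℝ) + 1) : ℝ) : ℂ) *
        ((q ^ (-(QSixJ.casimir x + QSixJ.casimir n₇ + QSixJ.casimir n₉ + QSixJ.casimir n₅) / 2) :
          ℝ) : ℂ) *
        QSixJ.sixJ hq n₁ n₆ x n₃ n₈ n₇ *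
        QSixJ.sixJ hq n₂ x n₄ n₃ n₉ n₈ *
        QSixJ.sixJ hq n₂ n₆ n₅ n₁ n₄ x := by
  have h178' : QSixJ.Triad n₇ n₁ n₈ := h178.swap
  have h367' : QSixJ.Triad n₆ n₃ n₇ := h367.swap
  have key := congrArg (QSixJ.yangBaxterFactor q n₁ n₂ n₃ n₄ n₅ n₆ n₇ n₈ n₉ * ·)
    (QSixJ.racah_yangBaxter hq (n₄ := n₄) (n₅ := n₅) h178' h289 h367')
  simp only [Finset.mul_sum] at key
  refine Eq.trans (Finset.sum_congr rfl fun x hx => ?_)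
    (key.trans (Finset.sum_congr rfl fun x hx => ?_))
  · obtain ⟨hx1, hx2, _⟩ := (Finset.mem_filter.1 hx).2
    exact QSixJ.left_summand_eq hq h145 h178 h289 h367 h349 hx1 hx2
  · obtain ⟨hx1, _, hx3⟩ := (Finset.mem_filter.1 hx).2
    exact (QSixJ.right_summand_eq hq h145 h178 h256 h289 h367 hx1 hx3).symm
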